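/- Let $\ell$ be a prime and let $G$ be a pro-$\ell$ group. Write $\Phi(G)=\mathrm{cl}(G^{\ell}G')$ for its Frattini subgroup, where $G'$ is the closure of the commutator subgroup and $G^n$ is the closed subgroup generated by all $n$-th powers. A pro-$\ell$ group $H$ is *powerful* if $H'\subseteq H^{\ell}$ (if $\ell=2$: $H'\subseteq H^{4}$), *uniform* if it is powerful, topologically finitely generated and has no non-trivial element of finite order, and *locally uniform* if every closed subgroup of $H$ is uniform. A *Frattini extension with kernel $N$* is a short exact sequence of pro-$\ell$ groups $\{1\}\to N\to G\to\bar G\to\{1\}$ (with continuous maps) such that $N\subseteq\Phi(G)$; one also calls $G\to\bar G$ a Frattini pro-$\ell$ cover. An *orientation* of $G$ is a continuous homomorphism $\theta\colon G\to\mathbb{Z}_\ell^\times$. The oriented pro-$\ell$ group $(G,\theta)$ is *torsion-free* if $\ell\neq2$, or if $\ell=2$ and $\mathrm{im}(\theta)\subseteq1+4\mathbb{Z}_2$. Let $\mathbb{Z}_\ell(1)$ be $\mathbb{Z}_\ell$ with $G$ acting by $g\cdot v=\theta(g)v$; a torsion-free $(G,\theta)$ is *Kummerian* if the natural map $H^1(G,\mathbb{Z}_\ell(1)/\ell^n)\to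 H^1(G,\mathbb{Z}_\ell(1)/\ell)=H^1(G,\mathbb{F}_\ell)$ in continuous cohomology is surjective for every $n\ge1$. Let $$K_\theta(G)=\mathrm{cl}\big\langle\, h^{-\theta(g)}ghg^{-1}\;\big|\; g\in G,\ h\in\ker\theta\,\big\rangle .$$ Then: 1. There is a Frattini extension $\{1\}\to N\to G\to\bar G\to\{1\}$ with $\bar G$ locally uniform if, and only if, $G$ is topologically finitely generated and there is an orientation $\theta$ of $G$ such that $(G,\theta)$ is torsion-free and Kummerian. 2. More precisely, a subgroup $N$ of $G$ is the kernel of a Frattini extension of $G$ with $\bar G$ locally uniform if, and only if, $G$ is topologically finitely generated and there is an orientation $\theta$ of $G$ with $N\subseteq\ker\theta$ such that $(G,\theta)$ is torsion-free and Kummerian and $N=K_\theta(G)$. 3. If $N$ is the kernel of such an extension and $\theta$ is any orientation of $G$ with $(G,\theta)$ torsion-free and $K_\theta(G)\subseteq N\subseteq\ker\theta$, then $(G,\theta)$ is Kummerian and $N=K_\theta(G)$. -/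

import Mathlib

open Filter Topology

universe u

namespace OrientedProL

/-! ### Pro-ℓ groups and their standard subgroups -/

/-- A pro-`ℓ` group: a profinite group all of whose continuous finite quotients are `ℓ`-groups. -/
structure IsProL (ℓ : ℕ) (G : Type*) [Group G] [TopologicalSpace G] [IsTopologicalGroup G] :
    Prop where
  compact : CompactSpace G
  t2 : T2Space G
  totallyDisconnected : TotallyDisconnectedSpace G
  isPGroup_quotient : ∀ U : OpenNormalSubgroup G, IsPGroup ℓ (G ⧸ U.toSubgroup)

section Subgroups

variable (G : Type*) [Group G] [TopologicalSpace G] [IsTopologicalGroup G]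

/-- `G^n`: the closed subgroup of `G` generated by the `n`-th powers of all elements of `G`. -/
def closedPow (n : ℕ) : Subgroup G :=
  (Subgroup.closure (Set.range fun g : G => g ^ n)).topologicalClosure

/-- `G'`: the closure of the commutator subgroup of `G`. -/
def closedCommutator : Subgroup G :=
  (commutator G).topologicalClosure

/-- The Frattini subgroup `Φ(G) = cl(G^ℓ · G')` of a pro-`ℓ` group `G` (the supremum of two
normal subgroups is their product). -/
def frattiniSubgroup (ℓ : ℕ) : Subgroup G :=
  (closedPow G ℓ ⊔ closedCommutator G).topologicalClosure

/-- `G` is finitely generated as a topological group. -/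
def IsTopFG : Prop :=
  ∃ S : Set G, S.Finite ∧ (Subgroup.closure S).topologicalClosure = ⊤

/-- `G` is powerful: `G' ⊆ G^ℓ` if `ℓ ≠ 2`, and `G' ⊆ G^4` if `ℓ = 2`. -/
def IsPowerful (ℓ : ℕ) : Prop :=
  closedCommutator G ≤ closedPow G (if ℓ = 2 then 4 else ℓ)

/-- `G` is uniform: powerful, (topologically) finitely generated, and without non-trivial elements
of finite order. -/
structure IsUniform (ℓ : ℕ) : Prop where
  powerful : IsPowerful G ℓ
  fg : IsTopFG G
  torsionFree : ∀ g : G, IsOfFinOrder g → g = 1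

/-- `G` is locally uniform: every closed subgroup of `G` is uniform. -/
def IsLocallyUniform (ℓ : ℕ) : Prop :=
  ∀ H : Subgroup G, IsClosed (H : Set G) → IsUniform H ℓ

end Subgroups

/-! ### Powers with `ℓ`-adic exponents -/

/-- `h ^ z` for an `ℓ`-adic integer `z`: the limit of `h ^ m` as the natural numbers `m = z.appr k`
tend to `z` (they satisfy `m ≡ z` modulo `ℓ ^ k`). In a pro-`ℓ` group the limit exists, see
`tendsto_padicPow`. -/
noncomputable def padicPow {ℓ : ℕ} [Fact ℓ.Prime] {G : Type*} [Group G] [TopologicalSpace G]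
    (h : G) (z : ℤ_[ℓ]) : G :=
  haveI : Nonempty G := ⟨1⟩
  limUnder atTop fun k : ℕ => h ^ z.appr k

theorem tendsto_padicPow {ℓ : ℕ} [Fact ℓ.Prime] {G : Type*} [Group G] [TopologicalSpace G]
    [IsTopologicalGroup G] (hG : IsProL ℓ G) (h : G) (z : ℤ_[ℓ]) :
    Tendsto (fun k : ℕ => h ^ z.appr k) atTop (𝓝 (padicPow h z)) := by
  have := hG.compact
  have := hG.t2
  have := hG.totallyDisconnected
  apply tendsto_nhds_limUnder
  have key : ∀ U : OpenNormalSubgroup G, ∃ m, ∀ k, m ≤ k →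
      (h ^ z.appr m)⁻¹ * h ^ z.appr k ∈ U.toSubgroup := by
    intro U
    obtain ⟨m, hm⟩ := hG.isPGroup_quotient U (h : G ⧸ U.toSubgroup)
    refine ⟨m, fun k hk => ?_⟩
    obtain ⟨c, hc⟩ := z.dvd_appr_sub_appr m k hk
    have hle : z.appr m ≤ z.appr k := z.appr_mono hk
    have e : z.appr k = z.appr m + ℓ ^ m * c := by omega
    have hm' : h ^ ℓ ^ m ∈ U.toSubgroup := by
      rw [← QuotientGroup.eq_one_iff]
      exact_mod_cast hm
    rw [e, pow_add, inv_mul_cancel_left, pow_mul]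
    exact U.toSubgroup.pow_mem hm' c
  obtain ⟨x, hx⟩ := exists_clusterPt_of_compactSpace (map (fun k : ℕ => h ^ z.appr k) atTop)
  refine ⟨x, fun V hV => ?_⟩
  have hV1 : (fun y => x * y) ⁻¹' V ∈ 𝓝 (1 : G) := by
    apply (continuous_const_mul x).continuousAt
    simpa using hV
  obtain ⟨W, hWV, hWo, hW1⟩ := mem_nhds_iff.1 hV1
  obtain ⟨U, hUW⟩ := ProfiniteGrp.exist_openNormalSubgroup_sub_open_nhds_of_one hWo hW1
  obtain ⟨m, hm⟩ := key U
  have hclosed : IsClosed ((fun y => (h ^ z.appr m)⁻¹ * y) ⁻¹' (U.toSubgroup : Set G)) :=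
    (U.toOpenSubgroup.isClosed).preimage (continuous_const_mul _)
  have hev : ∀ᶠ k in atTop, h ^ z.appr k ∈
      (fun y => (h ^ z.appr m)⁻¹ * y) ⁻¹' (U.toSubgroup : Set G) :=
    eventually_atTop.2 ⟨m, fun k hk => hm k hk⟩
  have hxm : x ∈ (fun y => (h ^ z.appr m)⁻¹ * y) ⁻¹' (U.toSubgroup : Set G) := by
    rw [← hclosed.closure_eq, mem_closure_iff_clusterPt]
    exact hx.mono (le_principal_iff.2 hev)
  rw [mem_map]
  filter_upwards [hev] with k hk
  change h ^ z.appr k ∈ V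
  have hmem : x⁻¹ * h ^ z.appr k ∈ U.toSubgroup := by
    have := U.toSubgroup.mul_mem (U.toSubgroup.inv_mem hxm) hk
    simpa [mul_assoc] using this
  have := hWV (hUW hmem)
  simpa using this

/-! ### Oriented pro-ℓ groups

An orientation of a pro-`ℓ` group `G` is a continuous homomorphism `θ : G →ₜ* ℤ_[ℓ]ˣ`. -/

section Orientation

variable {ℓ : ℕ} [Fact ℓ.Prime] {G : Type*} [Group G] [TopologicalSpace G]

/-- The kernel of a continuous homomorphism. -/
def kernel {Q : Type*} [Group Q] [TopologicalSpace Q] (φ : G →ₜ* Q) : Subgroup G :=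
  φ.toMonoidHom.ker

/-- `(G, θ)` is torsion-free: `ℓ ≠ 2`, or `ℓ = 2` and `im θ ⊆ 1 + 4 ℤ₂`. -/
def IsTorsionFreeOrientation (θ : G →ₜ* ℤ_[ℓ]ˣ) : Prop :=
  ℓ = 2 → ∀ g : G, (4 : ℤ_[ℓ]) ∣ (θ g : ℤ_[ℓ]) - 1

/-- `K_θ(G)`: the closed subgroup generated by all `h^{-θ(g)} g h g⁻¹`, `g ∈ G`, `h ∈ ker θ`. -/
noncomputable def kSubgroup [IsTopologicalGroup G] (θ : G →ₜ* ℤ_[ℓ]ˣ) : Subgroup G :=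
  (Subgroup.closure
    {x : G | ∃ g : G, ∃ h ∈ kernel θ,
      x = (padicPow h (θ g : ℤ_[ℓ]))⁻¹ * (g * h * g⁻¹)}).topologicalClosure

/-- The scalar by which `g` acts on the module `ℤ_ℓ(1)/ℓ^n`, whose underlying discrete group is
`ℤ/ℓ^n`: the residue class of `θ(g)`. -/
noncomputable def twist (θ : G →ₜ* ℤ_[ℓ]ˣ) (n : ℕ) (g : G) : ZMod (ℓ ^ n) :=
  PadicInt.toZModPow n (θ g : ℤ_[ℓ])

/-- Continuous 1-cocycles `G → ℤ_ℓ(1)/ℓ^n`. -/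
noncomputable def cocycles (θ : G →ₜ* ℤ_[ℓ]ˣ) (n : ℕ) : AddSubgroup (G → ZMod (ℓ ^ n)) where
  carrier := {c | Continuous c ∧ ∀ g h : G, c (g * h) = c g + twist θ n g * c h}
  zero_mem' := ⟨continuous_const, fun _ _ => by simp⟩
  add_mem' := by
    rintro a b ⟨ha, ha'⟩ ⟨hb, hb'⟩
    refine ⟨ha.add hb, fun g h => ?_⟩
    simp only [Pi.add_apply, ha', hb']
    ring
  neg_mem' := by
    rintro a ⟨ha, ha'⟩
    refine ⟨ha.neg, fun g h => ?_⟩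
    simp only [Pi.neg_apply, ha']
    ring

/-- 1-coboundaries `g ↦ g.m - m`, as a subgroup of the continuous 1-cocycles. -/
noncomputable def coboundaries (θ : G →ₜ* ℤ_[ℓ]ˣ) (n : ℕ) : AddSubgroup (cocycles θ n) where
  carrier := {c | ∃ m : ZMod (ℓ ^ n), ∀ g : G, c.1 g = twist θ n g * m - m}
  zero_mem' := ⟨0, fun _ => by simp⟩
  add_mem' := by
    rintro a b ⟨m, hm⟩ ⟨k, hk⟩
    refine ⟨m + k, fun g => ?_⟩
    simp only [AddSubgroup.coe_add, Pi.add_apply, hm, hk]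
    ring
  neg_mem' := by
    rintro a ⟨m, hm⟩
    refine ⟨-m, fun g => ?_⟩
    simp only [AddSubgroup.coe_neg, Pi.neg_apply, hm]
    ring

/-- The continuous cohomology group `H¹(G, ℤ_ℓ(1)/ℓ^n)`. -/
abbrev H1 (θ : G →ₜ* ℤ_[ℓ]ˣ) (n : ℕ) : Type _ :=
  cocycles θ n ⧸ coboundaries θ n

/-- The reduction `ℤ_ℓ(1)/ℓ^n → ℤ_ℓ(1)/ℓ^k` for `k ≤ n`. -/
def reduction (ℓ : ℕ) {k n : ℕ} (hkn : k ≤ n) : ZMod (ℓ ^ n) →+* ZMod (ℓ ^ k) :=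
  ZMod.castHom (pow_dvd_pow ℓ hkn) (ZMod (ℓ ^ k))

theorem reduction_twist (θ : G →ₜ* ℤ_[ℓ]ˣ) {k n : ℕ} (hkn : k ≤ n) (g : G) :
    reduction ℓ hkn (twist θ n g) = twist θ k g :=
  PadicInt.cast_toZModPow k n hkn _

/-- The map on continuous 1-cocycles induced by the reduction. -/
noncomputable def cocyclesMap (θ : G →ₜ* ℤ_[ℓ]ˣ) {k n : ℕ} (hkn : k ≤ n) :
    cocycles θ n →+ cocycles θ k where
  toFun c := ⟨fun g => reduction ℓ hkn (c.1 g),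
    continuous_of_discreteTopology.comp c.2.1, fun g h => by
      change reduction ℓ hkn (c.1 (g * h)) = _
      rw [c.2.2, map_add, map_mul, reduction_twist]⟩
  map_zero' := by ext g; simp
  map_add' a b := by ext g; simp

/-- The map `H¹(G, ℤ_ℓ(1)/ℓ^n) → H¹(G, ℤ_ℓ(1)/ℓ^k)` induced by the reduction. -/
noncomputable def H1Map (θ : G →ₜ* ℤ_[ℓ]ˣ) {k n : ℕ} (hkn : k ≤ n) : H1 θ n →+ H1 θ k :=
  QuotientAddGroup.map _ _ (cocyclesMap θ hkn) (by
    rintro c ⟨m, hm⟩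
    refine ⟨reduction ℓ hkn m, fun g => ?_⟩
    change reduction ℓ hkn (c.1 g) = _
    rw [hm, map_sub, map_mul, reduction_twist])

/-- `(G, θ)` is Kummerian: `H¹(G, ℤ_ℓ(1)/ℓ^n) → H¹(G, ℤ_ℓ(1)/ℓ)` is surjective for all `n ≥ 1`.
(For torsion-free `(G, θ)`, `ℤ_ℓ(1)/ℓ` is the trivial module `𝔽_ℓ`.) -/
def IsKummerian (θ : G →ₜ* ℤ_[ℓ]ˣ) : Prop :=
  ∀ (n : ℕ) (hn : 1 ≤ n), Function.Surjective (H1Map θ hn)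

end Orientation

/-! ### Frattini covers -/

/-- The subgroup `N` of `G` is the kernel in a Frattini extension `1 → N → G → Q → 1` of pro-`ℓ`
groups (so `N ⊆ Φ(G)`) with `Q` locally uniform. -/
def IsFrattiniCoverKernel (ℓ : ℕ) {G : Type u} [Group G] [TopologicalSpace G]
    [IsTopologicalGroup G] (N : Subgroup G) : Prop :=
  ∃ (Q : Type u) (_ : Group Q) (_ : TopologicalSpace Q) (_ : IsTopologicalGroup Q)
    (φ : G →ₜ* Q),
    IsProL ℓ Q ∧ Function.Surjective φ ∧ kernel φ = N ∧ N ≤ frattiniSubgroup G ℓ ∧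
      IsLocallyUniform Q ℓ

end OrientedProL

/-!
Let `Q` be a locally uniform pro-`ℓ` group. The heart of the matter is that `Q` has a torsion-free
orientation `θ` such that `g h g⁻¹ = h ^ θ(g)` for all `h ∈ ker θ`
(`IsLocallyUniform.exists_orientation`); an orientation with this property is called abelian here,
see `IsAbelianOrientation`. For its construction one studies the closed subgroup generated by two
elements `x`, `y` with `c = [x, y] ≠ 1`. Powerfulness, applied to the finite quotients, shows that
all commutators are `ℓ`-adic powers of `c` (`exists_commutator_eq_padicPow`), and a second use of it
together with torsion-freeness shows that the group acts nontrivially on `c` and that the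
centralizer of `c` is commensurable with the procyclic group generated by `c`
(`structure_of_two_generators`). It follows that commuting eigenvectors of an element have equal
eigenvalues and that `c` generates a normal subgroup of all of `Q`; then `θ` is the action on `c`.

Conversely, a topologically finitely generated torsion-free group with an abelian torsion-free
orientation is locally uniform (`IsAbelianOrientation.isLocallyUniform`), and such an orientation is
Kummerian, since a cocycle can be written down on `ker θ` (a free `ℤ_ℓ`-module of finite rank) and
on a procyclic complement (`IsAbelianOrientation.exists_cocycle`).

For a pro-`ℓ` group `G` with a torsion-free orientation `θ`, the induced orientation of
`G / K_θ(G)` is abelian, and `K_θ(G) ⊆ Φ(G)`. So it has to be seen that `G / K_θ(G)` is torsion-free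
if `θ` is Kummerian (`IsKummerian.torsionFree_quotient`), and that for a Frattini cover
`G → Q` with kernel `N`, where `K_θ(G) ⊆ N ⊆ ker θ`, the orientation `θ` is Kummerian and
`N = K_θ(G)` (`isKummerian_of_frattini_cover`, `kernel_le_kSubgroup`). The first and the last of
these use that an element of the kernel of an abelian orientation which is not an `ℓ`-th power there lies
outside the Frattini subgroup (`IsAbelianOrientation.exists_pow_eq`), so that it is detected by a
homomorphism to `ℤ/ℓ`; such homomorphisms lift to `ℤ_ℓ(1)/ℓ^n` in the Kummerian case, and cocycles
vanish on `K_θ(G)`.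
-/

set_option linter.unusedSectionVars false

namespace OrientedProL

open scoped commutatorElement

/-! ### Pro-ℓ groups and `ℓ`-adic powers -/

/-- The power `h ^ₚ z` with an `ℓ`-adic exponent `z`. -/
infixr:75 " ^ₚ " => padicPow

section PadicPow

variable {ℓ : ℕ} [Fact ℓ.Prime] {G : Type*} [Group G] [TopologicalSpace G] [IsTopologicalGroup G]

theorem IsProL.exists_le (hG : IsProL ℓ G) {V : Set G} (hV : V ∈ 𝓝 (1 : G)) :
    ∃ U : OpenNormalSubgroup G, (U.toSubgroup : Set G) ⊆ V := by
  have := hG.compact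
  have := hG.totallyDisconnected
  obtain ⟨W, hWV, hWo, hW1⟩ := mem_nhds_iff.1 hV
  obtain ⟨U, hU⟩ := ProfiniteGrp.exist_openNormalSubgroup_sub_open_nhds_of_one hWo hW1
  exact ⟨U, hU.trans hWV⟩

theorem IsProL.eq_one (hG : IsProL ℓ G) {x : G}
    (hx : ∀ U : OpenNormalSubgroup G, x ∈ U.toSubgroup) : x = 1 := by
  have := hG.t2
  by_contra h
  obtain ⟨U, hU⟩ := hG.exists_le (isOpen_compl_singleton.mem_nhds (Ne.symm h) : {x}ᶜ ∈ 𝓝 (1 : G))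
  exact hU (hx U) rfl

theorem IsProL.exists_pow_mem (hG : IsProL ℓ G) (U : OpenNormalSubgroup G) (h : G) :
    ∃ m, h ^ ℓ ^ m ∈ U.toSubgroup := by
  obtain ⟨m, hm⟩ := hG.isPGroup_quotient U (h : G ⧸ U.toSubgroup)
  refine ⟨m, ?_⟩
  rw [← QuotientGroup.eq_one_iff]
  exact_mod_cast hm

theorem openNormal_isClosed (U : OpenNormalSubgroup G) : IsClosed (U.toSubgroup : Set G) :=
  U.toOpenSubgroup.isClosed

/-- Modulo an open normal subgroup, `h ^ₚ z` may be computed with any natural number close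
to `z`. -/
theorem inv_pow_mul_padicPow_mem (hG : IsProL ℓ G) (U : OpenNormalSubgroup G) {h : G} {m : ℕ}
    (hm : h ^ ℓ ^ m ∈ U.toSubgroup) {z : ℤ_[ℓ]} {n : ℕ}
    (hn : z - n ∈ (Ideal.span {(ℓ : ℤ_[ℓ]) ^ m})) : (h ^ n)⁻¹ * h ^ₚ z ∈ U.toSubgroup := by
  have hcl : IsClosed ((fun y => (h ^ n)⁻¹ * y) ⁻¹' (U.toSubgroup : Set G)) :=
    (openNormal_isClosed U).preimage (continuous_const_mul _)
  refine hcl.mem_of_tendsto (tendsto_padicPow hG h z) (eventually_atTop.2 ⟨m, fun k hk => ?_⟩)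
  have h1 : ((z.appr k : ℤ) - (n : ℤ) : ℤ_[ℓ]) ∈ Ideal.span {(ℓ : ℤ_[ℓ]) ^ m} := by
    have h2 := Ideal.span_singleton_le_span_singleton.2 (pow_dvd_pow (ℓ : ℤ_[ℓ]) hk)
      (z.appr_spec k)
    have := Ideal.sub_mem _ hn h2
    push_cast
    convert this using 1
    ring
  have h3 : ((ℓ ^ m : ℕ) : ℤ) ∣ (z.appr k : ℤ) - n := by
    rw [← Int.cast_sub, ← PadicInt.norm_le_pow_iff_mem_span_pow,
      PadicInt.norm_int_le_pow_iff_dvd] at h1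
    exact_mod_cast h1
  obtain ⟨c, hc⟩ := h3
  have : (h ^ n)⁻¹ * h ^ z.appr k = (h ^ ℓ ^ m) ^ c := by
    rw [← zpow_natCast, ← zpow_natCast, ← zpow_neg, ← zpow_add, ← zpow_natCast, ← zpow_mul, ← hc]
    congr 1
    ring
  change (h ^ n)⁻¹ * h ^ z.appr k ∈ U.toSubgroup
  rw [this]
  exact U.toSubgroup.zpow_mem hm c

theorem padicPow_natCast (hG : IsProL ℓ G) (h : G) (n : ℕ) : h ^ₚ (n : ℤ_[ℓ]) = h ^ n := by
  symm
  rw [← inv_mul_eq_one]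
  refine hG.eq_one fun U => ?_
  obtain ⟨m, hm⟩ := hG.exists_pow_mem U h
  exact inv_pow_mul_padicPow_mem hG U hm (by simp)

theorem continuous_padicPow (hG : IsProL ℓ G) (h : G) : Continuous fun z : ℤ_[ℓ] => h ^ₚ z := by
  rw [continuous_iff_continuousAt]
  intro z V hV
  have hV1 : (fun y => h ^ₚ z * y) ⁻¹' V ∈ 𝓝 (1 : G) := by
    apply (continuous_const_mul (h ^ₚ z)).continuousAt
    simpa using hV
  obtain ⟨U, hU⟩ := hG.exists_le hV1
  obtain ⟨m, hm⟩ := hG.exists_pow_mem U h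
  have hball : Metric.ball z ((ℓ : ℝ) ^ (-(m : ℤ))) ∈ 𝓝 z :=
    Metric.ball_mem_nhds _ (zpow_pos (by exact_mod_cast (Fact.out : ℓ.Prime).pos) _)
  rw [mem_map]
  filter_upwards [hball] with w hw
  have h1 : w - z ∈ Ideal.span {(ℓ : ℤ_[ℓ]) ^ m} := by
    rw [← PadicInt.norm_le_pow_iff_mem_span_pow, ← dist_eq_norm]
    exact (Metric.mem_ball.1 hw).le
  have h2 := inv_pow_mul_padicPow_mem hG U hm (z.appr_spec m)
  have h3 : (h ^ z.appr m)⁻¹ * h ^ₚ w ∈ U.toSubgroup := by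
    refine inv_pow_mul_padicPow_mem hG U hm ?_
    have := Ideal.add_mem _ h1 (z.appr_spec m)
    simpa using this
  have h4 : (h ^ₚ z)⁻¹ * h ^ₚ w ∈ U.toSubgroup := by
    have := U.toSubgroup.mul_mem (U.toSubgroup.inv_mem h2) h3
    simpa [mul_assoc] using this
  simpa using hU h4

theorem map_padicPow (hG : IsProL ℓ G) {H : Type*} [Group H] [TopologicalSpace H] [T2Space H]
    (f : G →* H) (hf : Continuous f) (h : G) (z : ℤ_[ℓ]) : f (h ^ₚ z) = f h ^ₚ z := by
  symm
  have := (hf.tendsto _).comp (tendsto_padicPow hG h z)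
  refine Tendsto.limUnder_eq ?_
  simpa [Function.comp_def] using this

theorem padicPow_ext (hG : IsProL ℓ G) {f g : ℤ_[ℓ] → G} (hf : Continuous f) (hg : Continuous g)
    (h : ∀ n : ℕ, f n = g n) (z : ℤ_[ℓ]) : f z = g z := by
  have := hG.t2
  exact congr_fun (PadicInt.denseRange_natCast.equalizer hf hg (funext h)) z

@[simp] theorem padicPow_zero (hG : IsProL ℓ G) (h : G) : h ^ₚ (0 : ℤ_[ℓ]) = 1 := by
  simpa using padicPow_natCast hG h 0

theorem padicPow_one (hG : IsProL ℓ G) (h : G) : h ^ₚ (1 : ℤ_[ℓ]) = h := by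
  simpa using padicPow_natCast hG h 1

theorem padicPow_add (hG : IsProL ℓ G) (h : G) (z w : ℤ_[ℓ]) :
    h ^ₚ (z + w) = h ^ₚ z * h ^ₚ w := by
  have hc := continuous_padicPow hG h
  revert w
  refine padicPow_ext hG (by fun_prop) (by fun_prop) fun n => ?_
  revert z
  refine padicPow_ext hG (by fun_prop) (by fun_prop) fun k => ?_
  rw [← Nat.cast_add, padicPow_natCast hG, padicPow_natCast hG, padicPow_natCast hG, pow_add]

theorem one_padicPow (hG : IsProL ℓ G) (z : ℤ_[ℓ]) : (1 : G) ^ₚ z = 1 := by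
  revert z
  exact padicPow_ext hG (continuous_padicPow hG _) continuous_const fun n => by
    rw [padicPow_natCast hG, one_pow]

/-- The homomorphism `z ↦ h ^ₚ z` from the additive group of `ℤ_ℓ`. -/
noncomputable def padicPowHom (hG : IsProL ℓ G) (h : G) : Multiplicative ℤ_[ℓ] →* G where
  toFun z := h ^ₚ z.toAdd
  map_one' := padicPow_zero hG h
  map_mul' _ _ := padicPow_add hG h _ _

theorem padicPow_neg (hG : IsProL ℓ G) (h : G) (z : ℤ_[ℓ]) : h ^ₚ (-z) = (h ^ₚ z)⁻¹ :=
  map_inv (padicPowHom hG h) (Multiplicative.ofAdd z)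

theorem padicPow_sub (hG : IsProL ℓ G) (h : G) (z w : ℤ_[ℓ]) :
    h ^ₚ (z - w) = h ^ₚ z * (h ^ₚ w)⁻¹ := by
  rw [sub_eq_add_neg, padicPow_add hG, padicPow_neg hG]

theorem padicPow_mul (hG : IsProL ℓ G) (h : G) (z w : ℤ_[ℓ]) :
    h ^ₚ (z * w) = (h ^ₚ z) ^ₚ w := by
  have hc := continuous_padicPow hG h
  revert w
  refine padicPow_ext hG (by fun_prop) (continuous_padicPow hG _) fun n => ?_
  rw [padicPow_natCast hG]
  induction n with
  | zero => simp [padicPow_zero hG]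
  | succ n ih => rw [Nat.cast_succ, mul_add, padicPow_add hG, ih, mul_one, pow_succ]

theorem padicPow_mul_natCast (hG : IsProL ℓ G) (h : G) (z : ℤ_[ℓ]) (n : ℕ) :
    h ^ₚ (z * (n : ℤ_[ℓ])) = (h ^ₚ z) ^ n := by
  rw [padicPow_mul hG, padicPow_natCast hG]

theorem padicPow_natCast_mul (hG : IsProL ℓ G) (h : G) (z : ℤ_[ℓ]) (n : ℕ) :
    h ^ₚ ((n : ℤ_[ℓ]) * z) = (h ^ n) ^ₚ z := by
  rw [padicPow_mul hG, padicPow_natCast hG]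

theorem conj_padicPow (hG : IsProL ℓ G) (g h : G) (z : ℤ_[ℓ]) :
    g * h ^ₚ z * g⁻¹ = (g * h * g⁻¹) ^ₚ z := by
  have := hG.t2
  exact map_padicPow hG (MulAut.conj g).toMonoidHom
    (by change Continuous fun x => g * x * g⁻¹; fun_prop) h z

theorem commute_padicPow_right (hG : IsProL ℓ G) {g h : G} (hc : Commute g h) (z : ℤ_[ℓ]) :
    Commute g (h ^ₚ z) := by
  have := conj_padicPow hG g h z
  rw [hc.eq, mul_inv_cancel_right] at this
  exact mul_inv_eq_iff_eq_mul.1 this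

theorem commute_padicPow_left (hG : IsProL ℓ G) {g h : G} (hc : Commute g h) (z : ℤ_[ℓ]) :
    Commute (g ^ₚ z) h :=
  (commute_padicPow_right hG hc.symm z).symm

theorem mul_padicPow (hG : IsProL ℓ G) {g h : G} (hc : Commute g h) (z : ℤ_[ℓ]) :
    (g * h) ^ₚ z = g ^ₚ z * h ^ₚ z := by
  have h1 := continuous_padicPow hG g
  have h2 := continuous_padicPow hG h
  revert z
  refine padicPow_ext hG (continuous_padicPow hG _) (by fun_prop) fun n => ?_
  simp only [padicPow_natCast hG, hc.mul_pow]

theorem inv_padicPow (hG : IsProL ℓ G) (h : G) (z : ℤ_[ℓ]) : h⁻¹ ^ₚ z = (h ^ₚ z)⁻¹ := by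
  have h1 := continuous_padicPow hG h
  revert z
  refine padicPow_ext hG (continuous_padicPow hG _) (by fun_prop) fun n => ?_
  simp only [padicPow_natCast hG, inv_pow]

theorem padicPow_mem_of_isClosed (hG : IsProL ℓ G) {H : Subgroup G} (hH : IsClosed (H : Set G))
    {h : G} (hh : h ∈ H) (z : ℤ_[ℓ]) : h ^ₚ z ∈ H :=
  hH.mem_of_tendsto (tendsto_padicPow hG h z) (Eventually.of_forall fun _ => H.pow_mem hh _)

/-- The closed procyclic subgroup `{h ^ₚ z}` generated by `h`. -/
noncomputable def procyclic (hG : IsProL ℓ G) (h : G) : Subgroup G :=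
  (padicPowHom hG h).range

theorem mem_procyclic (hG : IsProL ℓ G) {h g : G} :
    g ∈ procyclic hG h ↔ ∃ z : ℤ_[ℓ], h ^ₚ z = g :=
  ⟨fun ⟨z, hz⟩ => ⟨z.toAdd, hz⟩, fun ⟨z, hz⟩ => ⟨Multiplicative.ofAdd z, hz⟩⟩

theorem isClosed_procyclic (hG : IsProL ℓ G) (h : G) : IsClosed (procyclic hG h : Set G) := by
  have := hG.t2
  have : (procyclic hG h : Set G) = Set.range fun z : ℤ_[ℓ] => h ^ₚ z := by
    ext g
    exact mem_procyclic hG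
  rw [this]
  exact (isCompact_range (continuous_padicPow hG h)).isClosed

theorem self_mem_procyclic (hG : IsProL ℓ G) (h : G) : h ∈ procyclic hG h :=
  (mem_procyclic hG).2 ⟨1, padicPow_one hG h⟩

theorem IsProL.tendsto_pow (hG : IsProL ℓ G) (h : G) :
    Tendsto (fun k : ℕ => h ^ ℓ ^ k) atTop (𝓝 1) := by
  intro V hV
  obtain ⟨U, hU⟩ := hG.exists_le hV
  obtain ⟨m, hm⟩ := hG.exists_pow_mem U h
  rw [mem_map]
  filter_upwards [eventually_ge_atTop m] with k hk
  obtain ⟨j, rfl⟩ := Nat.exists_eq_add_of_le hk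
  apply hU
  change h ^ ℓ ^ (m + j) ∈ U.toSubgroup
  rw [pow_add, pow_mul]
  exact U.toSubgroup.pow_mem hm _

/-- A profinite group in which `h ^ ℓ ^ k → 1` for every `h` is a pro-`ℓ` group. -/
theorem isProL_of_tendsto [CompactSpace G] [T2Space G] [TotallyDisconnectedSpace G]
    (h : ∀ h : G, Tendsto (fun k : ℕ => h ^ ℓ ^ k) atTop (𝓝 1)) : IsProL ℓ G where
  compact := inferInstance
  t2 := inferInstance
  totallyDisconnected := inferInstance
  isPGroup_quotient U := by
    rintro ⟨g⟩
    obtain ⟨k, hk⟩ := ((h g).eventually (U.toOpenSubgroup.mem_nhds_one)).exists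
    refine ⟨k, ?_⟩
    change ((g : G ⧸ U.toSubgroup)) ^ ℓ ^ k = 1
    rw [← QuotientGroup.mk_pow, QuotientGroup.eq_one_iff]
    exact hk

theorem IsProL.subgroup (hG : IsProL ℓ G) {H : Subgroup G} (hH : IsClosed (H : Set G)) :
    IsProL ℓ H := by
  have := hG.compact
  have := hG.t2
  have := hG.totallyDisconnected
  have : CompactSpace H := isCompact_iff_compactSpace.1 hH.isCompact
  refine isProL_of_tendsto fun h => ?_
  rw [tendsto_subtype_rng]
  simpa using hG.tendsto_pow (h : G)

theorem coe_padicPow (hG : IsProL ℓ G) {H : Subgroup G} (hH : IsClosed (H : Set G)) (h : H)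
    (z : ℤ_[ℓ]) : ((h ^ₚ z : H) : G) = (h : G) ^ₚ z := by
  have := hG.t2
  exact map_padicPow (hG.subgroup hH) H.subtype continuous_subtype_val h z

theorem IsProL.quotient (hG : IsProL ℓ G) {N : Subgroup G} [N.Normal]
    (hN : IsClosed (N : Set G)) : IsProL ℓ (G ⧸ N) := by
  have := hG.compact
  have := hG.t2
  have := hG.totallyDisconnected
  have : IsClosed (N : Set G) := hN
  have ht2 : T2Space (G ⧸ N) := by
    have : T3Space (G ⧸ N) := inferInstance
    infer_instance
  have : TotallyDisconnectedSpace (G ⧸ N) := by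
    have key : ∀ x : G ⧸ N, x ≠ 1 → ∃ V : Subgroup (G ⧸ N), IsOpen (V : Set (G ⧸ N)) ∧ x ∉ V := by
      intro x hx
      obtain ⟨W, hW⟩ := hG.exists_le (V := (QuotientGroup.mk : G → G ⧸ N) ⁻¹' {x}ᶜ)
        ((isOpen_compl_singleton.preimage QuotientGroup.continuous_mk).mem_nhds
          fun h => hx h.symm)
      refine ⟨W.toSubgroup.map (QuotientGroup.mk' N), ?_, ?_⟩
      · exact QuotientGroup.isOpenMap_coe _ W.toOpenSubgroup.isOpen
      · rintro ⟨w, hw, hwx⟩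
        exact hW hw hwx
    rw [totallyDisconnectedSpace_iff_connectedComponent_subsingleton]
    intro x
    have : ∀ y ∈ connectedComponent x, y = x := by
      intro y hy
      by_contra hne
      obtain ⟨V, hVo, hV⟩ := key (x⁻¹ * y) (by
        intro h
        exact hne (inv_mul_eq_one.1 h).symm)
      have hcl : IsClopen ((fun z => x⁻¹ * z) ⁻¹' (V : Set (G ⧸ N))) :=
        ⟨(Subgroup.isClosed_of_isOpen V hVo).preimage (continuous_const_mul _),
          hVo.preimage (continuous_const_mul _)⟩
      have := hcl.connectedComponent_subset (x := x) (by simp [V.one_mem]) hy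
      exact hV this
    intro y hy z hz
    rw [this y hy, this z hz]
  refine isProL_of_tendsto fun h => ?_
  obtain ⟨g, rfl⟩ := QuotientGroup.mk_surjective h
  have := ((continuous_quot_mk (r := (QuotientGroup.leftRel N).r)).tendsto (1 : G)).comp
    (hG.tendsto_pow g)
  exact this

/-! ### Torsion-free pro-ℓ groups -/

theorem eq_one_of_padicPow_eq_one (hG : IsProL ℓ G) (htf : ∀ g : G, IsOfFinOrder g → g = 1)
    {h : G} {z : ℤ_[ℓ]} (hz : z ≠ 0) (h1 : h ^ₚ z = 1) : h = 1 := by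
  refine htf h (isOfFinOrder_iff_pow_eq_one.2
    ⟨ℓ ^ z.valuation, pow_pos (Fact.out : ℓ.Prime).pos _, ?_⟩)
  have h2 := PadicInt.unitCoeff_spec hz
  set v := PadicInt.unitCoeff hz
  have : ((ℓ ^ z.valuation : ℕ) : ℤ_[ℓ]) = z * (v⁻¹ : ℤ_[ℓ]ˣ) := by
    rw [mul_comm, Units.eq_inv_mul_iff_mul_eq]
    push_cast
    exact h2.symm
  rw [← padicPow_natCast hG, this, padicPow_mul hG, h1, one_padicPow hG]

theorem padicPow_injective (hG : IsProL ℓ G) (htf : ∀ g : G, IsOfFinOrder g → g = 1)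
    {h : G} (hh : h ≠ 1) : Function.Injective fun z : ℤ_[ℓ] => h ^ₚ z := by
  intro z w hzw
  by_contra hne
  refine hh (eq_one_of_padicPow_eq_one hG htf (sub_ne_zero.2 hne) ?_)
  rw [padicPow_sub hG, mul_inv_eq_one]
  exact hzw

/-- In a pro-`ℓ` group, an element of finite order has `ℓ`-power order, so it suffices to exclude
elements of order `ℓ`. -/
theorem torsionFree_of_pow_prime (hG : IsProL ℓ G) (h : ∀ g : G, g ^ ℓ = 1 → g = 1) :
    ∀ g : G, IsOfFinOrder g → g = 1 := by
  intro g hg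
  obtain ⟨n, hn, hgn⟩ := isOfFinOrder_iff_pow_eq_one.1 hg
  have hz : (n : ℤ_[ℓ]) ≠ 0 := by exact_mod_cast hn.ne'
  have h2 := PadicInt.unitCoeff_spec hz
  set v := PadicInt.unitCoeff hz
  have h3 : ((ℓ ^ (n : ℤ_[ℓ]).valuation : ℕ) : ℤ_[ℓ]) = n * (v⁻¹ : ℤ_[ℓ]ˣ) := by
    rw [mul_comm, Units.eq_inv_mul_iff_mul_eq]
    push_cast
    exact h2.symm
  have h4 : g ^ ℓ ^ (n : ℤ_[ℓ]).valuation = 1 := by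
    rw [← padicPow_natCast hG, h3, padicPow_mul hG, padicPow_natCast hG, hgn, one_padicPow hG]
  generalize (n : ℤ_[ℓ]).valuation = k at h4
  clear h3 h2
  induction k with
  | zero => simpa using h4
  | succ k ih => exact ih (h _ (by rw [← pow_mul, ← pow_succ, h4]))

end PadicPow

/-! ### Principal units of `ℤ_ℓ` -/

/-- The exponent in the definition of powerful groups: `4` if `ℓ = 2`, and `ℓ` otherwise. -/
def powExp (ℓ : ℕ) : ℕ := if ℓ = 2 then 4 else ℓ

section Principal

variable {ℓ : ℕ} [Fact ℓ.Prime]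

/-- `u ∈ 1 + ℓℤ_ℓ`, respectively `u ∈ 1 + 4ℤ₂` if `ℓ = 2`. These `u` form a torsion-free group. -/
def IsPrincipal (u : ℤ_[ℓ]) : Prop := (powExp ℓ : ℤ_[ℓ]) ∣ u - 1

theorem dvd_powExp (ℓ : ℕ) : ℓ ∣ powExp ℓ := by
  unfold powExp
  split_ifs with h
  · subst h; norm_num
  · rfl

theorem dvd_powExp_choose_two (ℓ : ℕ) [hp : Fact ℓ.Prime] : ℓ ∣ (powExp ℓ).choose 2 := by
  unfold powExp
  split_ifs with h
  · subst h; decide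
  · exact hp.out.dvd_choose_self two_ne_zero (lt_of_le_of_ne hp.out.two_le (Ne.symm h))

theorem IsPrincipal.dvd {u : ℤ_[ℓ]} (hu : IsPrincipal u) : (ℓ : ℤ_[ℓ]) ∣ u - 1 :=
  dvd_trans (Nat.cast_dvd_cast (dvd_powExp ℓ)) hu

theorem isPrincipal_one : IsPrincipal (1 : ℤ_[ℓ]) := by simp [IsPrincipal]

theorem isUnit_one_add (e : ℤ_[ℓ]) : IsUnit (1 + ℓ * e : ℤ_[ℓ]) := by
  by_contra h
  have h1 := PadicInt.mem_nonunits.1 h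
  rw [PadicInt.norm_lt_one_iff_dvd] at h1
  have h2 : (ℓ : ℤ_[ℓ]) ∣ 1 := (dvd_add_left (dvd_mul_right _ e)).1 h1
  exact PadicInt.prime_p.not_isUnit (isUnit_of_dvd_one h2)

theorem IsPrincipal.isUnit {u : ℤ_[ℓ]} (hu : IsPrincipal u) : IsUnit u := by
  obtain ⟨e, he⟩ := hu.dvd
  rw [← sub_add_cancel u 1, he, add_comm]
  exact isUnit_one_add e

theorem one_add_pow_eq {R : Type*} [CommRing R] (a : R) (n : ℕ) :
    ∃ r, (1 + a) ^ n = 1 + n * a + (n.choose 2 : ℕ) * a ^ 2 + a ^ 3 * r := by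
  induction n with
  | zero => exact ⟨0, by simp⟩
  | succ n ih =>
    obtain ⟨r, hr⟩ := ih
    refine ⟨r + a * r + (n.choose 2 : ℕ), ?_⟩
    rw [pow_succ, hr, Nat.choose_succ_succ' n 1, Nat.choose_one_right]
    push_cast
    ring

theorem IsPrincipal.pow_prime_sub_one {u : ℤ_[ℓ]} (hu : IsPrincipal u) :
    ∃ e, u ^ ℓ - 1 = (u - 1) * (ℓ * (1 + ℓ * e)) := by
  obtain ⟨r, hr⟩ := one_add_pow_eq (u - 1) ℓ
  rw [add_sub_cancel] at hr
  obtain ⟨b, hb⟩ := hu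
  by_cases h : ℓ = 2
  · have h4 : ((powExp ℓ : ℕ) : ℤ_[ℓ]) = 4 := by simp [powExp, h]
    have h2 : (ℓ : ℤ_[ℓ]) = 2 := by exact_mod_cast congrArg (Nat.cast : ℕ → ℤ_[ℓ]) h
    have h3 : u ^ ℓ = u ^ 2 := congrArg (u ^ ·) h
    refine ⟨b, ?_⟩
    rw [h3, h2]
    rw [h4] at hb
    linear_combination (u - 1) * hb
  · have h4 : powExp ℓ = ℓ := if_neg h
    rw [h4] at hb
    obtain ⟨k, hk⟩ := dvd_powExp_choose_two ℓ
    rw [h4] at hk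
    rw [hk] at hr
    refine ⟨k * b + b ^ 2 * r, ?_⟩
    rw [hr]
    push_cast
    rw [hb]
    ring

theorem IsPrincipal.pow {u : ℤ_[ℓ]} (hu : IsPrincipal u) (n : ℕ) : IsPrincipal (u ^ n) :=
  dvd_trans hu (by simpa using sub_dvd_pow_sub_pow u 1 n)

theorem IsPrincipal.pow_prime_pow_sub_one {u : ℤ_[ℓ]} (hu : IsPrincipal u) (i : ℕ) :
    ∃ e, u ^ ℓ ^ i - 1 = (u - 1) * (ℓ ^ i * (1 + ℓ * e)) := by
  induction i with
  | zero => exact ⟨0, by simp⟩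
  | succ i ih =>
    obtain ⟨e, he⟩ := ih
    obtain ⟨e', he'⟩ := (hu.pow (ℓ ^ i)).pow_prime_sub_one
    refine ⟨e + e' + ℓ * e * e', ?_⟩
    rw [pow_succ, pow_mul, he', he]
    ring

theorem IsPrincipal.eq_one_of_pow {u : ℤ_[ℓ]} (hu : IsPrincipal u) {i : ℕ}
    (h : u ^ ℓ ^ i = 1) : u = 1 := by
  obtain ⟨e, he⟩ := hu.pow_prime_pow_sub_one i
  rw [h, sub_self, eq_comm, mul_eq_zero, mul_eq_zero] at he
  rcases he with he | he | he
  · exact sub_eq_zero.1 he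
  · exact absurd he (pow_ne_zero _ (by exact_mod_cast (Fact.out : ℓ.Prime).ne_zero))
  · exact absurd he (isUnit_one_add e).ne_zero

theorem IsPrincipal.pow_mul_sub_one {u : ℤ_[ℓ]} (hu : IsPrincipal u) (i j : ℕ) :
    ∃ r, u ^ (ℓ ^ i * j) - 1 = (u - 1) * ℓ ^ i * (j + ℓ * r) := by
  obtain ⟨e, he⟩ := hu.pow_prime_pow_sub_one i
  obtain ⟨s, hs⟩ := hu.dvd
  obtain ⟨r, hr⟩ := one_add_pow_eq (u ^ ℓ ^ i - 1) j
  rw [add_sub_cancel] at hr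
  rw [pow_mul, hr, he]
  refine ⟨j * e + s * ℓ ^ i * (1 + ℓ * e) ^ 2 * ((j.choose 2 : ℕ) +
    (u - 1) * ℓ ^ i * (1 + ℓ * e) * r), ?_⟩
  linear_combination ((u - 1) * (ℓ : ℤ_[ℓ]) ^ (i * 2) * (1 + ℓ * e) ^ 2 * ((j.choose 2 : ℕ) +
    (u - 1) * ℓ ^ i * (1 + ℓ * e) * r)) * hs

/-- A principal unit `u` topologically generates all `v` with `u - 1 ∣ v - 1`: this is proved by
successive approximation of `v` by powers of `u`. -/
theorem IsPrincipal.exists_pow_sub_dvd {u v : ℤ_[ℓ]} (hu : IsPrincipal u) (huv : u - 1 ∣ v - 1)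
    (n : ℕ) : ∃ m : ℕ, (u - 1) * ℓ ^ n ∣ u ^ m - v := by
  induction n with
  | zero => exact ⟨0, by simpa using (dvd_neg.2 huv)⟩
  | succ n ih =>
    obtain ⟨m, s, hs⟩ := ih
    obtain ⟨w, hw⟩ := hu.isUnit.pow m
    obtain ⟨j, -, hj⟩ := PadicInt.exists_mem_range (-((w⁻¹ : ℤ_[ℓ]ˣ) : ℤ_[ℓ]) * s)
    rw [PadicInt.maximalIdeal_eq_span_p, Ideal.mem_span_singleton] at hj
    obtain ⟨d, hd⟩ := hj
    obtain ⟨r, hr⟩ := hu.pow_mul_sub_one n j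
    refine ⟨m + ℓ ^ n * j, u ^ m * (r - d), ?_⟩
    have h1 : u ^ m * ((w⁻¹ : ℤ_[ℓ]ˣ) : ℤ_[ℓ]) = 1 := by rw [← hw, Units.mul_inv]
    have h2 : u ^ (m + ℓ ^ n * j) - v = u ^ m * (u ^ (ℓ ^ n * j) - 1) + (u ^ m - v) := by
      rw [pow_add]; ring
    rw [h2, hr, hs]
    linear_combination (-(u - 1) * ℓ ^ n * u ^ m) * hd - ((u - 1) * ℓ ^ n * s) * h1

theorem IsPrincipal.mem_closure {u v : ℤ_[ℓ]} (hu : IsPrincipal u) (huv : u - 1 ∣ v - 1) :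
    v ∈ closure (Set.range fun m : ℕ => u ^ m) := by
  rw [Metric.mem_closure_range_iff]
  intro ε hε
  obtain ⟨n, hn⟩ := PadicInt.exists_pow_neg_lt ℓ hε
  obtain ⟨m, hm⟩ := hu.exists_pow_sub_dvd huv n
  refine ⟨m, lt_of_le_of_lt ?_ hn⟩
  rw [dist_comm, dist_eq_norm, PadicInt.norm_le_pow_iff_mem_span_pow, Ideal.mem_span_singleton]
  exact dvd_trans (dvd_mul_left _ _) hm

end Principal

/-! ### Finite `ℓ`-groups -/

section Finite

variable {ℓ : ℕ} [hp : Fact ℓ.Prime] {F : Type*} [Group F]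

/-- A proper subgroup of a finite `ℓ`-group lies in a normal subgroup of index `ℓ`, hence in a
proper subgroup which contains all `ℓ`-th powers and all commutators. -/
theorem exists_maximal_subgroup [Finite F] (hF : IsPGroup ℓ F) {S : Subgroup F} (hS : S ≠ ⊤) :
    ∃ M : Subgroup F, M ≠ ⊤ ∧ S ≤ M ∧ (∀ g, g ^ ℓ ∈ M) ∧ ∀ g h : F, ⁅g, h⁆ ∈ M := by
  obtain ⟨m, hm⟩ := IsPGroup.iff_card.1 hF
  obtain ⟨n, hn⟩ := IsPGroup.iff_card.1 (hF.to_subgroup S)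
  have hnm : n < m := by
    have h1 : Nat.card S < Nat.card F :=
      lt_of_le_of_ne (Subgroup.card_le_card_group S) fun h =>
        hS (Subgroup.card_eq_iff_eq_top S |>.1 h)
    rw [hm, hn] at h1
    exact (Nat.pow_lt_pow_iff_right hp.out.one_lt).1 h1
  obtain ⟨k, rfl⟩ : ∃ k, m = k + 1 := ⟨m - 1, by omega⟩
  obtain ⟨M, hM, hSM⟩ := Sylow.exists_subgroup_card_pow_prime_le ℓ (m := k) (by
    rw [hm]; exact pow_dvd_pow _ (Nat.le_succ k)) S hn (by omega)
  have hidx : M.index = ℓ := by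
    have := M.card_mul_index
    rw [hM, hm, pow_succ] at this
    exact Nat.eq_of_mul_eq_mul_left (pow_pos hp.out.pos k) this
  have : M.Normal := Subgroup.normal_of_index_eq_minFac_card (by
    rw [hidx, hm, hp.out.pow_minFac (Nat.succ_ne_zero k)])
  have hcard : Nat.card (F ⧸ M) = ℓ := hidx
  have : IsCyclic (F ⧸ M) := isCyclic_of_prime_card hcard
  refine ⟨M, ?_, hSM, fun g => ?_, fun g h => ?_⟩
  · rintro rfl
    rw [Subgroup.index_top] at hidx
    exact hp.out.one_lt.ne hidx
  · rw [← QuotientGroup.eq_one_iff, QuotientGroup.mk_pow, ← hcard, pow_card_eq_one']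
  · rw [← QuotientGroup.eq_one_iff]
    change ⁅(g : F ⧸ M), (h : F ⧸ M)⁆ = 1
    rw [commutatorElement_eq_one_iff_mul_comm]
    exact (IsCyclic.isMulCommutative (α := F ⧸ M)).is_comm.comm _ _

/-- If `[g, y] = d` and `[g, d] = e` with `e` central, then
`g ^ n y g ^ (-n) = e ^ (n choose 2) d ^ n y`. -/
theorem conj_pow_of_central {g y d e : F} (hd : g * y * g⁻¹ = d * y) (he : g * d * g⁻¹ = e * d)
    (hg : ∀ x, Commute e x) (n : ℕ) :
    g ^ n * y * (g ^ n)⁻¹ = e ^ n.choose 2 * d ^ n * y := by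
  induction n with
  | zero => simp
  | succ n ih =>
    have h1 : g ^ (n + 1) * y * (g ^ (n + 1))⁻¹ = g * (g ^ n * y * (g ^ n)⁻¹) * g⁻¹ := by
      rw [pow_succ']; group
    have h2 : g * (e ^ n.choose 2 * d ^ n * y) * g⁻¹ =
        (g * e ^ n.choose 2 * g⁻¹) * (g * d * g⁻¹) ^ n * (g * y * g⁻¹) := by
      rw [conj_pow]; group
    rw [h1, ih, h2, he, hd, ((hg g).pow_left _).symm.eq, mul_inv_cancel_right, (hg d).mul_pow,
      Nat.choose_succ_succ' n 1, Nat.choose_one_right, add_comm n, pow_add, pow_succ d]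
    simp only [mul_assoc]

/-- In a group with central `[F', F]`, with `F'` of exponent `ℓ` and generated by elements which
are products of `ℓ`-th powers (fourth powers, if `ℓ = 2`), the commutator subgroup is central. -/
theorem commute_commutator_of_class_three
    (hexp : ∀ d ∈ commutator F, d ^ ℓ = 1)
    (hcent : ∀ d ∈ commutator F, ∀ g x : F, Commute ⁅g, d⁆ x)
    (hpow : commutator F ≤ Subgroup.closure (Set.range fun g : F => g ^ powExp ℓ)) :
    commutator F ≤ Subgroup.center F := by
  refine hpow.trans ((Subgroup.closure_le _).2 ?_)
  rintro _ ⟨g, rfl⟩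
  rw [SetLike.mem_coe, Subgroup.mem_center_iff]
  intro y
  have hd : ⁅g, y⁆ ∈ commutator F :=
    Subgroup.commutator_mem_commutator (Subgroup.mem_top _) (Subgroup.mem_top _)
  have he : ⁅g, ⁅g, y⁆⁆ ∈ commutator F :=
    Subgroup.commutator_mem_commutator (Subgroup.mem_top _) (Subgroup.mem_top _)
  have h := conj_pow_of_central (g := g) (y := y) (d := ⁅g, y⁆) (e := ⁅g, ⁅g, y⁆⁆)
    (by rw [commutatorElement_def]; group) (by rw [commutatorElement_def g ⁅g, y⁆]; group)
    (hcent _ hd g) (powExp ℓ)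
  obtain ⟨a, ha⟩ := dvd_powExp_choose_two ℓ
  obtain ⟨b, hb⟩ := dvd_powExp ℓ
  have h1 : ⁅g, y⁆ ^ powExp ℓ = 1 := by rw [hb, pow_mul, hexp _ hd, one_pow]
  rw [ha, pow_mul, hexp _ he, one_pow, one_mul, h1, one_mul] at h
  exact (mul_inv_eq_iff_eq_mul.1 h).symm

theorem commutator_map_surjective {E : Type*} [Group E] {f : F →* E}
    (hf : Function.Surjective f) : commutator E = (commutator F).map f := by
  rw [commutator_def, commutator_def, Subgroup.map_commutator, ← MonoidHom.range_eq_map,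
    MonoidHom.range_eq_top.2 hf]

theorem closure_powers_map_surjective {E : Type*} [Group E] {f : F →* E}
    (hf : Function.Surjective f) (n : ℕ) :
    Subgroup.closure (Set.range fun g : E => g ^ n) =
      (Subgroup.closure (Set.range fun g : F => g ^ n)).map f := by
  rw [MonoidHom.map_closure]
  congr 1
  ext x
  constructor
  · rintro ⟨g, rfl⟩
    obtain ⟨g, rfl⟩ := hf g
    exact ⟨g ^ n, ⟨g, rfl⟩, map_pow f g n⟩
  · rintro ⟨_, ⟨g, rfl⟩, rfl⟩
    exact ⟨f g, (map_pow f g n).symm⟩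

/-- The hypothesis on `[F', F]` in `commute_commutator_of_class_three` is superfluous for nilpotent
groups: modulo the fourth term of the lower central series it holds, so that the third and the
fourth term coincide. -/
theorem commutator_le_center [Group.IsNilpotent F]
    (hexp : ∀ d ∈ commutator F, d ^ ℓ = 1)
    (hpow : commutator F ≤ Subgroup.closure (Set.range fun g : F => g ^ powExp ℓ)) :
    commutator F ≤ Subgroup.center F := by
  set L := (⊤ : Subgroup F).lowerCentralSeries with hL
  -- `F / L 3` satisfies the hypotheses of `commute_commutator_of_class_three`
  have h23 : L 2 ≤ L 3 := by
    have : (L 3).Normal := inferInstance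
    set f := QuotientGroup.mk' (L 3)
    have hf : Function.Surjective f := QuotientGroup.mk'_surjective _
    have hcomm := commutator_map_surjective hf
    have key : commutator (F ⧸ L 3) ≤ Subgroup.center (F ⧸ L 3) := by
      apply commute_commutator_of_class_three (ℓ := ℓ)
      · rw [hcomm]
        rintro _ ⟨d, hd, rfl⟩
        rw [← map_pow, hexp d hd, map_one]
      · rw [hcomm]
        rintro _ ⟨d, hd, rfl⟩ g x
        obtain ⟨g, rfl⟩ := hf g
        obtain ⟨x, rfl⟩ := hf x
        rw [← commutatorElement_eq_one_iff_commute, ← map_commutatorElement,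
          ← map_commutatorElement]
        refine (QuotientGroup.eq_one_iff _).2 ?_
        have h1 : ⁅g, d⁆ ∈ L 2 := by
          rw [hL, Subgroup.lowerCentralSeries_succ, Subgroup.commutator_comm]
          refine Subgroup.commutator_mem_commutator (Subgroup.mem_top _) ?_
          rwa [Subgroup.top_lowerCentralSeries_one]
        rw [hL, Subgroup.lowerCentralSeries_succ]
        exact Subgroup.commutator_mem_commutator h1 (Subgroup.mem_top _)
      · rw [hcomm, closure_powers_map_surjective hf]
        exact Subgroup.map_mono hpow
    rw [hL, Subgroup.lowerCentralSeries_succ, Subgroup.commutator_le]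
    intro d hd g _
    rw [Subgroup.top_lowerCentralSeries_one] at hd
    have h1 : f d ∈ Subgroup.center (F ⧸ L 3) := key (hcomm ▸ Subgroup.mem_map_of_mem f hd)
    refine (QuotientGroup.eq_one_iff _).1 ?_
    change f ⁅d, g⁆ = 1
    rw [map_commutatorElement, commutatorElement_eq_one_iff_mul_comm]
    exact ((Subgroup.mem_center_iff.1 h1) (f g)).symm
  have h2 : ∀ n, L 2 ≤ L (n + 2) := by
    intro n
    induction n with
    | zero => exact le_rfl
    | succ n ih =>
      refine h23.trans ?_
      rw [hL, Subgroup.lowerCentralSeries_succ, Subgroup.lowerCentralSeries_succ (n := n + 2)]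
      exact Subgroup.commutator_mono ih le_rfl
  obtain ⟨n, hn⟩ := Subgroup.nilpotent_iff_lowerCentralSeries.1 ‹Group.IsNilpotent F›
  have h3 : L 2 = ⊥ := by
    rw [eq_bot_iff]
    calc L 2 ≤ L (n + 2) := h2 n
      _ ≤ L n := Subgroup.lowerCentralSeries_antitone _ (Nat.le_add_right _ _)
      _ ≤ ⊥ := hn.le
  intro d hd
  rw [Subgroup.mem_center_iff]
  intro g
  have h4 : ⁅d, g⁆ ∈ L 2 := by
    rw [hL, Subgroup.lowerCentralSeries_succ]
    refine Subgroup.commutator_mem_commutator ?_ (Subgroup.mem_top _)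
    rwa [Subgroup.top_lowerCentralSeries_one]
  rw [h3, Subgroup.mem_bot, commutatorElement_eq_one_iff_mul_comm] at h4
  exact h4.symm

/-- The commutator subgroup of a two-generator powerful finite `ℓ`-group is cyclic, generated by
the commutator of the generators: it is central modulo `ℓ`-th powers, hence generated by `[x, y]`
modulo `ℓ`-th powers. -/
theorem commutator_le_zpowers [Finite F] (hF : IsPGroup ℓ F) {x y : F}
    (hxy : Subgroup.closure {x, y} = ⊤)
    (hpow : commutator F ≤ Subgroup.closure (Set.range fun g : F => g ^ powExp ℓ)) :
    commutator F ≤ Subgroup.zpowers ⁅x, y⁆ := by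
  set D := commutator F
  have hcD : ⁅x, y⁆ ∈ D :=
    Subgroup.commutator_mem_commutator (Subgroup.mem_top _) (Subgroup.mem_top _)
  set M := Subgroup.closure ((fun d : F => d ^ ℓ) '' (D : Set F)) with hM
  have hMn : M.Normal := by
    refine ⟨fun n hn g => ?_⟩
    induction hn using Subgroup.closure_induction with
    | mem z hz =>
      obtain ⟨d, hd, rfl⟩ := hz
      refine Subgroup.subset_closure ⟨g * d * g⁻¹, ?_, conj_pow⟩
      exact (inferInstance : D.Normal).conj_mem d hd g
    | one => simp
    | mul a b _ _ ha hb =>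
      have := M.mul_mem ha hb
      convert this using 1
      group
    | inv a _ ha =>
      have := M.inv_mem ha
      convert this using 1
      group
  set f := QuotientGroup.mk' M
  have hf : Function.Surjective f := QuotientGroup.mk'_surjective _
  have hcomm := commutator_map_surjective hf
  have : Group.IsNilpotent (F ⧸ M) := (hF.to_quotient M).isNilpotent
  have hcen : commutator (F ⧸ M) ≤ Subgroup.center (F ⧸ M) := by
    apply commutator_le_center (ℓ := ℓ)
    · rw [hcomm]
      rintro _ ⟨d, hd, rfl⟩
      rw [← map_pow]
      exact (QuotientGroup.eq_one_iff _).2 (Subgroup.subset_closure ⟨d, hd, rfl⟩)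
    · rw [hcomm, closure_powers_map_surjective hf]
      exact Subgroup.map_mono hpow
  have hcx : f ⁅x, y⁆ ∈ Subgroup.center (F ⧸ M) := hcen (hcomm ▸ Subgroup.mem_map_of_mem f hcD)
  -- modulo the central subgroup generated by `[x, y]`, the generators commute
  have hcyc : commutator (F ⧸ M) ≤ Subgroup.zpowers (f ⁅x, y⁆) := by
    set Z := Subgroup.zpowers (f ⁅x, y⁆)
    have hZ : Z ≤ Subgroup.center (F ⧸ M) := Subgroup.zpowers_le.2 hcx
    have : Z.Normal := ⟨fun n hn g => by
      rw [Subgroup.mem_center_iff.1 (hZ hn) g, mul_inv_cancel_right]; exact hn⟩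
    set k := (QuotientGroup.mk' Z).comp f
    have hk : Function.Surjective k := (QuotientGroup.mk'_surjective _).comp hf
    have hgen : Subgroup.closure {k x, k y} = ⊤ := by
      have := congrArg (Subgroup.map k) hxy
      rwa [MonoidHom.map_closure, Set.image_pair, ← MonoidHom.range_eq_map,
        MonoidHom.range_eq_top.2 hk] at this
    have hkxy : k x * k y = k y * k x := by
      rw [← commutatorElement_eq_one_iff_mul_comm, ← map_commutatorElement]
      exact (QuotientGroup.eq_one_iff _).2 (Subgroup.mem_zpowers _)
    have hcm := Subgroup.isMulCommutative_closure (k := {k x, k y}) (by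
      rintro a (rfl | rfl) b (rfl | rfl)
      exacts [rfl, hkxy, hkxy.symm, rfl])
    have hall : ∀ a b : (F ⧸ M) ⧸ Z, a * b = b * a := by
      intro a b
      have ha : a ∈ Subgroup.closure {k x, k y} := hgen ▸ trivial
      have hb : b ∈ Subgroup.closure {k x, k y} := hgen ▸ trivial
      exact congrArg Subtype.val (hcm.is_comm.comm ⟨a, ha⟩ ⟨b, hb⟩)
    rw [commutator_def, Subgroup.commutator_le]
    intro a _ b _
    refine (QuotientGroup.eq_one_iff (N := Z) _).1 ?_
    change QuotientGroup.mk' Z ⁅a, b⁆ = 1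
    rw [map_commutatorElement, commutatorElement_eq_one_iff_mul_comm]
    exact hall _ _
  by_contra hnot
  set S := (Subgroup.zpowers ⁅x, y⁆).subgroupOf D
  have hS : S ≠ ⊤ := fun h => hnot (Subgroup.subgroupOf_eq_top.1 h)
  obtain ⟨T, hT, hST, hTp, -⟩ := exists_maximal_subgroup (hF.to_subgroup D) hS
  refine hT ((Subgroup.eq_top_iff' T).2 fun d => ?_)
  have hMT : M ≤ T.map D.subtype := by
    rw [hM, Subgroup.closure_le]
    rintro _ ⟨d, hd, rfl⟩
    exact ⟨_, hTp ⟨d, hd⟩, rfl⟩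
  have h1 : f d ∈ Subgroup.zpowers (f ⁅x, y⁆) :=
    hcyc (hcomm ▸ Subgroup.mem_map_of_mem f d.2)
  obtain ⟨n, hn⟩ := Subgroup.mem_zpowers_iff.1 h1
  rw [← map_zpow] at hn
  have h2 : (⁅x, y⁆ ^ n)⁻¹ * d ∈ M := QuotientGroup.eq.1 hn
  obtain ⟨t, ht, htd⟩ := hMT h2
  have h3 : d = ⟨⁅x, y⁆ ^ n, D.zpow_mem hcD n⟩ * t := by
    ext
    rw [Subgroup.coe_mul]
    change _ = _ * D.subtype t
    rw [htd]
    simp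
  rw [h3]
  exact T.mul_mem (hST (Subgroup.mem_subgroupOf.2 (Subgroup.zpow_mem_zpowers _ n))) ht

end Finite

/-! ### Two-generator powerful pro-ℓ groups -/

section TwoGen

variable {ℓ : ℕ} [hp : Fact ℓ.Prime] {G : Type*} [Group G] [TopologicalSpace G]
  [IsTopologicalGroup G]

theorem IsProL.mem_of_isClosed (hG : IsProL ℓ G) {H : Subgroup G} (hH : IsClosed (H : Set G))
    {x : G} (h : ∀ U : OpenNormalSubgroup G, ∃ s ∈ H, s⁻¹ * x ∈ U.toSubgroup) : x ∈ H := by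
  by_contra hx
  have hV : (fun y => x * y) ⁻¹' (H : Set G)ᶜ ∈ 𝓝 (1 : G) := by
    apply (continuous_const_mul x).continuousAt
    simpa using hH.isOpen_compl.mem_nhds hx
  obtain ⟨U, hU⟩ := hG.exists_le hV
  obtain ⟨s, hs, hsx⟩ := h U
  have := hU (U.toSubgroup.inv_mem hsx)
  simp only [mul_inv_rev, inv_inv, Set.mem_preimage, mul_inv_cancel_left] at this
  exact this hs

theorem isClosed_comap_mk (U : OpenNormalSubgroup G) (K : Subgroup (G ⧸ U.toSubgroup)) :
    IsClosed (K.comap (QuotientGroup.mk' U.toSubgroup) : Set G) := by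
  refine Subgroup.isClosed_of_isOpen _ (Subgroup.isOpen_mono (H₁ := U.toSubgroup) ?_
    U.toOpenSubgroup.isOpen)
  intro g hg
  rw [Subgroup.mem_comap]
  have : QuotientGroup.mk' U.toSubgroup g = 1 := (QuotientGroup.eq_one_iff g).2 hg
  rw [this]
  exact K.one_mem

theorem isClosed_sup (hG : IsProL ℓ G) {A N : Subgroup G} [N.Normal]
    (hA : IsClosed (A : Set G)) (hN : IsClosed (N : Set G)) :
    IsClosed ((A ⊔ N : Subgroup G) : Set G) := by
  have := hG.compact
  have := hG.t2
  rw [Subgroup.mul_normal]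
  exact (hA.isCompact.mul hN.isCompact).isClosed

theorem commutatorElement_mem (g h : G) : ⁅g, h⁆ ∈ closedCommutator G :=
  Subgroup.le_topologicalClosure _
    (Subgroup.commutator_mem_commutator (Subgroup.mem_top g) (Subgroup.mem_top h))

theorem closedPow_le {n : ℕ} {H : Subgroup G} (hH : IsClosed (H : Set G))
    (h : ∀ g, g ^ n ∈ H) : closedPow G n ≤ H := by
  refine Subgroup.topologicalClosure_minimal _ ((Subgroup.closure_le _).2 ?_) hH
  rintro _ ⟨g, rfl⟩
  exact h g

theorem closure_le_of_isClosed {S : Set G} {H : Subgroup G} (hH : IsClosed (H : Set G))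
    (h : S ⊆ H) : (Subgroup.closure S).topologicalClosure ≤ H :=
  Subgroup.topologicalClosure_minimal _ ((Subgroup.closure_le _).2 h) hH

/-- The commutators of a powerful pro-`ℓ` group with topological generators `x` and `y` are
`ℓ`-adic powers of `[x, y]`. -/
theorem exists_commutator_eq_padicPow (hG : IsProL ℓ G) {x y : G}
    (hgen : (Subgroup.closure {x, y}).topologicalClosure = ⊤) (hpow : IsPowerful G ℓ) (g h : G) :
    ∃ z : ℤ_[ℓ], ⁅g, h⁆ = ⁅x, y⁆ ^ₚ z := by
  have := hG.compact
  suffices ⁅g, h⁆ ∈ procyclic hG ⁅x, y⁆ by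
    obtain ⟨z, hz⟩ := (mem_procyclic hG).1 this
    exact ⟨z, hz.symm⟩
  refine hG.mem_of_isClosed (isClosed_procyclic hG _) fun U => ?_
  set f := QuotientGroup.mk' U.toSubgroup
  have hf : Function.Surjective f := QuotientGroup.mk'_surjective _
  have hfin : Finite (G ⧸ U.toSubgroup) :=
    Subgroup.quotient_finite_of_isOpen _ U.toOpenSubgroup.isOpen
  have hgen' : Subgroup.closure {f x, f y} = ⊤ := by
    rw [Subgroup.eq_top_iff']
    intro a
    obtain ⟨a, rfl⟩ := hf a
    have ha : a ∈ (Subgroup.closure {x, y}).topologicalClosure := hgen ▸ Subgroup.mem_top a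
    refine closure_le_of_isClosed (isClosed_comap_mk U (Subgroup.closure {f x, f y})) ?_ ha
    rintro b (rfl | rfl)
    exacts [Subgroup.subset_closure (Or.inl rfl), Subgroup.subset_closure (Or.inr rfl)]
  have hpow' : commutator (G ⧸ U.toSubgroup) ≤
      Subgroup.closure (Set.range fun g : G ⧸ U.toSubgroup => g ^ powExp ℓ) := by
    rw [commutator_map_surjective hf, Subgroup.map_le_iff_le_comap]
    refine le_trans (Subgroup.le_topologicalClosure _) (hpow.trans ?_)
    exact closedPow_le (isClosed_comap_mk U _) fun g =>
      Subgroup.subset_closure ⟨f g, (map_pow f g _).symm⟩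
  have key := commutator_le_zpowers (hG.isPGroup_quotient U) hgen' hpow'
  have hgh : ⁅f g, f h⁆ ∈ commutator (G ⧸ U.toSubgroup) :=
    Subgroup.commutator_mem_commutator (Subgroup.mem_top _) (Subgroup.mem_top _)
  obtain ⟨n, hn⟩ := Subgroup.mem_zpowers_iff.1 (key hgh)
  refine ⟨⁅x, y⁆ ^ n, Subgroup.zpow_mem _ (self_mem_procyclic hG _) n, ?_⟩
  rw [← map_commutatorElement, ← map_commutatorElement, ← map_zpow] at hn
  exact QuotientGroup.eq.1 hn

theorem conj_pow_eq_padicPow (hG : IsProL ℓ G) {g c : G} {u : ℤ_[ℓ]} (h : g * c * g⁻¹ = c ^ₚ u)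
    (n : ℕ) : g ^ n * c * (g ^ n)⁻¹ = c ^ₚ (u ^ n) := by
  induction n with
  | zero => simp [padicPow_one hG]
  | succ n ih =>
    have : g ^ (n + 1) * c * (g ^ (n + 1))⁻¹ = g ^ n * (g * c * g⁻¹) * (g ^ n)⁻¹ := by
      rw [pow_succ]; group
    rw [this, h, conj_padicPow hG, ih, ← padicPow_mul hG, pow_succ]

/-- The exponents by which elements of a torsion-free pro-`ℓ` group act on a procyclic subgroup
are `1` modulo `ℓ`. -/
theorem prime_dvd_sub_one (hG : IsProL ℓ G) (htf : ∀ g : G, IsOfFinOrder g → g = 1)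
    {g c : G} (hc : c ≠ 1) {u : ℤ_[ℓ]} (h : g * c * g⁻¹ = c ^ₚ u) : (ℓ : ℤ_[ℓ]) ∣ u - 1 := by
  have := hG.t2
  have hemb := ((continuous_padicPow hG c).isClosedEmbedding
    (padicPow_injective hG htf hc)).isEmbedding
  have h1 : Tendsto (fun k : ℕ => c ^ₚ (u ^ ℓ ^ k)) atTop (𝓝 (c ^ₚ (1 : ℤ_[ℓ]))) := by
    rw [padicPow_one hG]
    have h2 : Continuous fun a : G => a * c * a⁻¹ := by fun_prop
    have h3 := (h2.tendsto 1).comp (hG.tendsto_pow g)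
    simp only [one_mul, inv_one, mul_one] at h3
    refine h3.congr fun k => ?_
    exact conj_pow_eq_padicPow hG h _
  have h4 : Tendsto (fun k : ℕ => u ^ ℓ ^ k) atTop (𝓝 1) := hemb.tendsto_nhds_iff.2 h1
  obtain ⟨k, hk⟩ := ((Metric.tendsto_nhds.1 h4) 1 one_pos).exists
  rw [dist_eq_norm, PadicInt.norm_lt_one_iff_dvd] at hk
  rw [← Ideal.mem_span_singleton, ← PadicInt.maximalIdeal_eq_span_p, ← PadicInt.ker_toZMod,
    RingHom.mem_ker] at hk ⊢
  rwa [map_sub, map_pow, ZMod.pow_card_pow, ← map_sub] at hk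

/-- An element acting by `u` on a procyclic subgroup, a nontrivial `ℓ`-adic power of which acts
trivially, acts trivially. -/
theorem eq_one_of_commute_padicPow (hG : IsProL ℓ G) (htf : ∀ g : G, IsOfFinOrder g → g = 1)
    {g c : G} (hc : c ≠ 1) {u z : ℤ_[ℓ]} (hu : IsPrincipal u) (h : g * c * g⁻¹ = c ^ₚ u)
    (hz : z ≠ 0) (hgz : Commute (g ^ₚ z) c) : u = 1 := by
  refine hu.eq_one_of_pow (i := z.valuation) ?_
  have h2 := PadicInt.unitCoeff_spec hz
  set v := PadicInt.unitCoeff hz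
  have h3 : ((ℓ ^ z.valuation : ℕ) : ℤ_[ℓ]) = z * (v⁻¹ : ℤ_[ℓ]ˣ) := by
    rw [mul_comm, Units.eq_inv_mul_iff_mul_eq]
    push_cast
    exact h2.symm
  have h4 : Commute (g ^ ℓ ^ z.valuation) c := by
    rw [← padicPow_natCast hG, h3, padicPow_mul hG]
    exact commute_padicPow_left hG hgz _
  have h5 := conj_pow_eq_padicPow hG h (ℓ ^ z.valuation)
  rw [h4.eq, mul_inv_cancel_right] at h5
  refine padicPow_injective hG htf hc ?_
  change c ^ₚ _ = c ^ₚ _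
  rw [← h5, padicPow_one hG]

/-- If `x` and `y` act on a procyclic subgroup by `u` and `v` with `u - 1 ∣ v - 1`, then `y` acts
as an `ℓ`-adic power of `x`. -/
theorem exists_padicPow_conj_eq (hG : IsProL ℓ G) {x y c : G} {u v : ℤ_[ℓ]}
    (hu : IsPrincipal u) (hx : x * c * x⁻¹ = c ^ₚ u) (hy : y * c * y⁻¹ = c ^ₚ v)
    (huv : u - 1 ∣ v - 1) (hall : ∀ g : G, ∃ w : ℤ_[ℓ], g * c * g⁻¹ = c ^ₚ w) :
    ∃ z : ℤ_[ℓ], Commute (y * (x ^ₚ z)⁻¹) c := by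
  have := hG.t2
  have hcont : Continuous fun z : ℤ_[ℓ] => x ^ₚ z * c * (x ^ₚ z)⁻¹ := by
    have := continuous_padicPow hG x
    fun_prop
  have hcl := (isCompact_range hcont).isClosed
  have hmem : c ^ₚ v ∈ closure (Set.range fun z : ℤ_[ℓ] => x ^ₚ z * c * (x ^ₚ z)⁻¹) := by
    refine closure_mono ?_
      ((image_closure_subset_closure_image (continuous_padicPow hG c)) ⟨v, hu.mem_closure huv, rfl⟩)
    rintro _ ⟨_, ⟨m, rfl⟩, rfl⟩
    refine ⟨m, ?_⟩
    simp only [padicPow_natCast hG]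
    exact conj_pow_eq_padicPow hG hx m
  rw [hcl.closure_eq] at hmem
  obtain ⟨z, hz⟩ := hmem
  obtain ⟨w, hw⟩ := hall (x ^ₚ z)⁻¹
  refine ⟨z, mul_inv_eq_iff_eq_mul.1 ?_⟩
  calc y * (x ^ₚ z)⁻¹ * c * (y * (x ^ₚ z)⁻¹)⁻¹
      = y * ((x ^ₚ z)⁻¹ * c * (x ^ₚ z)⁻¹⁻¹) * y⁻¹ := by group
    _ = x ^ₚ z * ((x ^ₚ z)⁻¹ * c * (x ^ₚ z)⁻¹⁻¹) * (x ^ₚ z)⁻¹ := by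
      rw [hw, conj_padicPow hG, conj_padicPow hG, hy, ← hz]
    _ = c := by group

/-- If all `n`-th powers are central modulo a closed normal subgroup `N`, so are the elements of
`G^n`. -/
theorem commutator_mem_of_mem_closedPow {N : Subgroup G} [N.Normal]
    (hN : IsClosed (N : Set G)) {n : ℕ} (h : ∀ g k : G, ⁅g ^ n, k⁆ ∈ N) {g : G}
    (hg : g ∈ closedPow G n) (k : G) : ⁅g, k⁆ ∈ N := by
  set Z : Subgroup G :=
    { carrier := {g | ∀ k, ⁅g, k⁆ ∈ N}
      one_mem' := fun k => by simp [N.one_mem]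
      mul_mem' := fun {a b} ha hb k => by
        have : ⁅a * b, k⁆ = a * ⁅b, k⁆ * a⁻¹ * ⁅a, k⁆ := by
          simp only [commutatorElement_def]; group
        rw [this]
        exact N.mul_mem (Subgroup.Normal.conj_mem inferInstance _ (hb k) a) (ha k)
      inv_mem' := fun {a} ha k => by
        have : ⁅a⁻¹, k⁆ = a⁻¹ * ⁅a, k⁆⁻¹ * a⁻¹⁻¹ := by
          simp only [commutatorElement_def]; group
        rw [this]
        exact Subgroup.Normal.conj_mem inferInstance _ (N.inv_mem (ha k)) _ } with hZ
  have hcl : IsClosed (Z : Set G) := by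
    have : (Z : Set G) = ⋂ k, (fun g => ⁅g, k⁆) ⁻¹' (N : Set G) := by
      ext g
      simp [hZ]
    rw [this]
    refine isClosed_iInter fun k => hN.preimage ?_
    simp only [commutatorElement_def]
    fun_prop
  exact closedPow_le (H := Z) hcl (fun g k => h g k) hg k

theorem dvd_geom_sum {u : ℤ_[ℓ]} (hu : (ℓ : ℤ_[ℓ]) ∣ u - 1) :
    (powExp ℓ : ℤ_[ℓ]) ∣ ∑ i ∈ Finset.range (powExp ℓ), u ^ i := by
  by_cases h : ℓ = 2
  · have h4 : powExp ℓ = 4 := by simp [powExp, h]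
    have h2 : (ℓ : ℤ_[ℓ]) = 2 := by exact_mod_cast congrArg (Nat.cast : ℕ → ℤ_[ℓ]) h
    obtain ⟨a, ha⟩ := hu
    rw [h2] at ha
    rw [h4]
    obtain rfl : u = 1 + 2 * a := by linear_combination ha
    refine ⟨(1 + a) * (1 + 2 * a + 2 * a ^ 2), ?_⟩
    simp only [Finset.sum_range_succ, Finset.sum_range_zero]
    push_cast
    ring
  · have h4 : powExp ℓ = ℓ := if_neg h
    rw [h4]
    have : ∑ i ∈ Finset.range ℓ, u ^ i = ∑ i ∈ Finset.range ℓ, (u ^ i - 1) + ℓ := by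
      simp
    rw [this]
    refine dvd_add (Finset.dvd_sum fun i _ => dvd_trans hu ?_) dvd_rfl
    simpa using sub_dvd_pow_sub_pow u 1 i

/-- If `[g, k] = c ^ s` and `g` acts on `c` by `u`, then `[g ^ n, k]` is the power of `c` with
exponent `(1 + u + ⋯ + u ^ (n - 1)) s`. -/
theorem commutator_pow_eq_padicPow (hG : IsProL ℓ G) {g k c : G} {u s : ℤ_[ℓ]}
    (hu : g * c * g⁻¹ = c ^ₚ u) (hs : ⁅g, k⁆ = c ^ₚ s) (n : ℕ) :
    ⁅g ^ n, k⁆ = c ^ₚ ((∑ i ∈ Finset.range n, u ^ i) * s) := by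
  induction n with
  | zero => simp [padicPow_zero hG]
  | succ n ih =>
    have : ⁅g ^ (n + 1), k⁆ = g ^ n * ⁅g, k⁆ * (g ^ n)⁻¹ * ⁅g ^ n, k⁆ := by
      simp only [commutatorElement_def, pow_succ]; group
    rw [this, hs, conj_padicPow hG, conj_pow_eq_padicPow hG hu, ih, ← padicPow_mul hG,
      ← padicPow_add hG, Finset.sum_range_succ]
    congr 1
    ring

/-- In a torsion-free powerful pro-`ℓ` group, all commutators of which lie in a procyclic
subgroup generated by a commutator `c`, the group acts on `c` by principal units. -/
theorem exists_isPrincipal (hG : IsProL ℓ G) (htf : ∀ g : G, IsOfFinOrder g → g = 1)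
    (hpow : IsPowerful G ℓ) {c : G} (hc : c ≠ 1) (hcc : c ∈ closedCommutator G)
    (hcomm : ∀ g h : G, ∃ z : ℤ_[ℓ], ⁅g, h⁆ = c ^ₚ z) (g : G) :
    ∃ u : ℤ_[ℓ], IsPrincipal u ∧ g * c * g⁻¹ = c ^ₚ u := by
  have hact : ∀ g, ∃ u : ℤ_[ℓ], g * c * g⁻¹ = c ^ₚ u := by
    intro g
    obtain ⟨z, hz⟩ := hcomm g c
    refine ⟨z + 1, ?_⟩
    rw [padicPow_add hG, padicPow_one hG, ← hz]
    simp [commutatorElement_def]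
  set N := procyclic hG (c ^ powExp ℓ)
  have hN : N.Normal := ⟨fun n hn g => by
    obtain ⟨z, rfl⟩ := (mem_procyclic hG).1 hn
    obtain ⟨u, hu⟩ := hact g
    refine (mem_procyclic hG).2 ⟨u * z, ?_⟩
    rw [conj_padicPow hG, ← conj_pow, hu, ← padicPow_natCast_mul hG, ← padicPow_mul_natCast hG,
      ← padicPow_mul hG]
    congr 1
    ring⟩
  have h1 : ⁅c, g⁆ ∈ N := by
    refine commutator_mem_of_mem_closedPow (isClosed_procyclic hG _) (n := powExp ℓ) ?_ (hpow hcc) g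
    intro a k
    obtain ⟨u, hu⟩ := hact a
    obtain ⟨s, hs⟩ := hcomm a k
    obtain ⟨d, hd⟩ := dvd_geom_sum (prime_dvd_sub_one hG htf hc hu)
    rw [commutator_pow_eq_padicPow hG hu hs, hd, mul_assoc]
    exact (mem_procyclic hG).2 ⟨_, (padicPow_natCast_mul hG _ _ _).symm⟩
  obtain ⟨z, hz⟩ := (mem_procyclic hG).1 h1
  refine ⟨-(powExp ℓ * z) + 1, ⟨-z, by ring⟩, ?_⟩
  rw [padicPow_add hG, padicPow_neg hG, padicPow_one hG, padicPow_natCast_mul hG, hz,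
    commutatorElement_def]
  group

/-- If `[X, b] = w` is central, then `(b X) ^ n = w ^ (n choose 2) b ^ n X ^ n`. -/
theorem mul_pow_of_central {X b w : G} (h : X * b = w * b * X) (hw : ∀ k, Commute w k) (n : ℕ) :
    (b * X) ^ n = w ^ n.choose 2 * b ^ n * X ^ n := by
  have hX : ∀ n : ℕ, X ^ n * b = w ^ n * b * X ^ n := by
    intro n
    induction n with
    | zero => simp
    | succ n ih =>
      calc X ^ (n + 1) * b = X * (X ^ n * b) := by rw [pow_succ']; group
        _ = X * w ^ n * b * X ^ n := by rw [ih]; group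
        _ = w ^ n * (X * b) * X ^ n := by rw [((hw X).pow_left n).symm.eq]; group
        _ = w ^ (n + 1) * b * X ^ (n + 1) := by rw [h, pow_succ w, pow_succ' X]; group
  induction n with
  | zero => simp
  | succ n ih =>
    calc (b * X) ^ (n + 1) = w ^ n.choose 2 * b ^ n * (X ^ n * b) * X := by
          rw [pow_succ, ih]; group
      _ = w ^ n.choose 2 * (b ^ n * w ^ n) * b * X ^ (n + 1) := by rw [hX, pow_succ X]; group
      _ = _ := by
        rw [((hw _).pow_left n).symm.eq, Nat.choose_succ_succ' n 1, Nat.choose_one_right,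
          add_comm n (n.choose _), pow_add, pow_succ b]
        group

/-- The subgroup of all `a ^ₚ (k * r) * b ^ₚ (k * s)`, for commuting `a` and `b`. -/
noncomputable def twoSpan (hG : IsProL ℓ G) {a b : G} (hab : Commute a b) (k : ℕ) :
    Subgroup G where
  carrier := {g | ∃ r s : ℤ_[ℓ], g = a ^ₚ ((k : ℤ_[ℓ]) * r) * b ^ₚ ((k : ℤ_[ℓ]) * s)}
  one_mem' := ⟨0, 0, by simp [padicPow_zero hG]⟩
  mul_mem' := by
    rintro _ _ ⟨r, s, rfl⟩ ⟨r', s', rfl⟩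
    refine ⟨r + r', s + s', ?_⟩
    have h := commute_padicPow_left hG (commute_padicPow_right hG hab (k * s)) (k * r')
    rw [mul_add, mul_add, padicPow_add hG, padicPow_add hG, mul_assoc, ← mul_assoc _ _ (b ^ₚ _),
      ← h.eq]
    simp only [mul_assoc]
  inv_mem' := by
    rintro _ ⟨r, s, rfl⟩
    refine ⟨-r, -s, ?_⟩
    have h := commute_padicPow_left hG (commute_padicPow_right hG hab (k * s)) (k * r)
    rw [mul_neg, mul_neg, padicPow_neg hG, padicPow_neg hG, h.eq, mul_inv_rev]

theorem isClosed_twoSpan (hG : IsProL ℓ G) {a b : G} (hab : Commute a b) (k : ℕ) :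
    IsClosed (twoSpan hG hab k : Set G) := by
  have := hG.t2
  have : (twoSpan hG hab k : Set G) =
      Set.range fun z : ℤ_[ℓ] × ℤ_[ℓ] => a ^ₚ ((k : ℤ_[ℓ]) * z.1) * b ^ₚ ((k : ℤ_[ℓ]) * z.2) := by
    ext g
    constructor
    · rintro ⟨r, s, rfl⟩
      exact ⟨(r, s), rfl⟩
    · rintro ⟨⟨r, s⟩, rfl⟩
      exact ⟨r, s, rfl⟩
  rw [this]
  refine (isCompact_range ?_).isClosed
  have h1 := continuous_padicPow hG a
  have h2 := continuous_padicPow hG b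
  fun_prop

theorem mem_twoSpan_one (hG : IsProL ℓ G) {a b : G} (hab : Commute a b) {g : G} :
    g ∈ twoSpan hG hab 1 ↔ ∃ r s : ℤ_[ℓ], g = a ^ₚ r * b ^ₚ s := by
  change (∃ r s : ℤ_[ℓ], g = a ^ₚ (((1 : ℕ) : ℤ_[ℓ]) * r) * b ^ₚ (((1 : ℕ) : ℤ_[ℓ]) * s)) ↔ _
  simp only [Nat.cast_one, one_mul]

theorem pow_mem_twoSpan (hG : IsProL ℓ G) {a b : G} (hab : Commute a b) {g : G} (k : ℕ)
    (hg : g ∈ twoSpan hG hab 1) : g ^ k ∈ twoSpan hG hab k := by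
  obtain ⟨r, s, rfl⟩ := (mem_twoSpan_one hG hab).1 hg
  have h := commute_padicPow_left hG (commute_padicPow_right hG hab s) r
  refine ⟨r, s, ?_⟩
  rw [h.mul_pow, ← padicPow_mul_natCast hG, ← padicPow_mul_natCast hG, mul_comm, mul_comm s]

theorem exists_pow_of_mem_twoSpan (hG : IsProL ℓ G) {a b : G} (hab : Commute a b) {g : G} {k : ℕ}
    (hg : g ∈ twoSpan hG hab k) : ∃ h ∈ twoSpan hG hab 1, h ^ k = g := by
  obtain ⟨r, s, rfl⟩ := hg
  refine ⟨_, (mem_twoSpan_one hG hab).2 ⟨r, s, rfl⟩, ?_⟩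
  have h := commute_padicPow_left hG (commute_padicPow_right hG hab s) r
  rw [h.mul_pow, ← padicPow_mul_natCast hG, ← padicPow_mul_natCast hG, mul_comm, mul_comm s]

/-- The decisive computation: let `x`, `y` generate a torsion-free powerful pro-`ℓ` group, and
suppose that `y` commutes with `c = [x, y] ≠ 1`. Then `c = y ^ t`, that is, `y` generates a normal
procyclic subgroup. Indeed, `w = y ^ (u - 1) c⁻¹` is central, where `u` is the action of `x` on
`c`, and `c` is a product of `ℓ`-th powers (fourth powers, if `ℓ = 2`); modulo the corresponding
powers of elements of `⟨y, c⟩` and of `w ^ ℓ`, these are powers of `x`. -/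
theorem exists_commutator_eq (hG : IsProL ℓ G) (htf : ∀ g : G, IsOfFinOrder g → g = 1)
    {x y : G} (hgen : (Subgroup.closure {x, y}).topologicalClosure = ⊤) (hpow : IsPowerful G ℓ)
    (hc : ⁅x, y⁆ ≠ 1) (hy : Commute y ⁅x, y⁆) :
    ∃ t : ℤ_[ℓ], t ≠ 0 ∧ ⁅x, y⁆ = y ^ₚ t ∧ x * ⁅x, y⁆ * x⁻¹ = ⁅x, y⁆ ^ₚ (1 + t) := by
  have hcomm := exists_commutator_eq_padicPow hG hgen hpow
  obtain ⟨u, hu, hxu⟩ := exists_isPrincipal hG htf hpow hc (commutatorElement_mem x y) hcomm x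
  set c := ⁅x, y⁆ with hcdef
  have hxy : x * y * x⁻¹ = c * y := by rw [hcdef, commutatorElement_def]; group
  have htop : ∀ H : Subgroup G, IsClosed (H : Set G) → x ∈ H → y ∈ H → ∀ g, g ∈ H := by
    intro H hH hx hy g
    have hg : g ∈ (Subgroup.closure {x, y}).topologicalClosure := hgen ▸ Subgroup.mem_top g
    refine closure_le_of_isClosed hH ?_ hg
    rintro b (rfl | rfl)
    exacts [hx, hy]
  have hcentral : ∀ w, Commute x w → Commute y w → ∀ g, Commute w g := by
    intro w h1 h2 g
    have := hG.t2
    refine (htop (Subgroup.centralizer {w}) ?_ ?_ ?_ g) w rfl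
    · exact Set.isClosed_centralizer {w}
    · rintro _ rfl; exact h1.symm
    · rintro _ rfl; exact h2.symm
  -- the central element `w`
  set w := y ^ₚ (u - 1) * c⁻¹ with hw
  have hwx : Commute x w := by
    refine mul_inv_eq_iff_eq_mul.1 ?_
    have h1 : x * w * x⁻¹ = (x * y ^ₚ (u - 1) * x⁻¹) * (x * c * x⁻¹)⁻¹ := by rw [hw]; group
    have h2 : Commute (c ^ₚ (u - 1)) (y ^ₚ (u - 1)) :=
      commute_padicPow_left hG (commute_padicPow_right hG hy.symm _) _
    rw [h1, conj_padicPow hG, hxy, hxu, mul_padicPow hG hy.symm, h2.eq, hw, mul_assoc,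
      ← padicPow_neg hG, ← padicPow_add hG]
    congr 1
    rw [← neg_one_mul, ← padicPow_one hG c⁻¹, inv_padicPow hG, ← padicPow_neg hG]
    congr 1
    ring
  have hwy : Commute y w :=
    (commute_padicPow_right hG (Commute.refl y) _).mul_right hy.inv_right
  have hwc := hcentral w hwx hwy
  have hcw : c = y ^ₚ (u - 1) * w⁻¹ := by
    have h1 : Commute (y ^ₚ (u - 1)) c := commute_padicPow_left hG hy _
    rw [hw, mul_inv_rev, inv_inv, ← mul_assoc, h1.eq, mul_inv_cancel_right]
  set q := powExp ℓ with hq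
  set B := twoSpan hG hy 1 with hB
  set Bq := twoSpan hG hy q with hBq
  have hBn : B.Normal := ⟨fun b hb g => by
    obtain ⟨z, hz⟩ := hcomm g b
    have : g * b * g⁻¹ = c ^ₚ z * b := by rw [← hz, commutatorElement_def]; group
    rw [this]
    exact B.mul_mem ((mem_twoSpan_one hG hy).2 ⟨0, z, by simp [padicPow_zero hG]⟩) hb⟩
  have hBqn : Bq.Normal := ⟨fun b hb g => by
    obtain ⟨h, hh, rfl⟩ := exists_pow_of_mem_twoSpan hG hy hb
    rw [← conj_pow]
    exact pow_mem_twoSpan hG hy q (hBn.conj_mem h hh g)⟩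
  -- every element is of the form `b * x ^ₚ a` with `b ∈ B`
  have hdecomp : ∀ g : G, ∃ b ∈ B, ∃ a : ℤ_[ℓ], g = b * x ^ₚ a := by
    intro g
    have hg : g ∈ procyclic hG x ⊔ B :=
      htop _ (isClosed_sup hG (isClosed_procyclic hG x) (isClosed_twoSpan hG hy 1))
        (Subgroup.mem_sup_left (self_mem_procyclic hG x))
        (Subgroup.mem_sup_right ((mem_twoSpan_one hG hy).2
          ⟨1, 0, by simp [padicPow_zero hG, padicPow_one hG]⟩)) g
    rw [sup_comm, ← SetLike.mem_coe, Subgroup.normal_mul] at hg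
    obtain ⟨b, hb, a, ha, rfl⟩ := Set.mem_mul.1 hg
    obtain ⟨a, rfl⟩ := (mem_procyclic hG).1 ha
    exact ⟨b, hb, a, rfl⟩
  -- all `q`-th powers lie in the closed subgroup `S` of the products of a power of `x ^ q`, the
  -- `q`-th power of an element of `B`, and a power of `w ^ ℓ`
  set W := procyclic hG (w ^ ℓ)
  have hWn : W.Normal := ⟨fun n hn g => by
    obtain ⟨z, rfl⟩ := (mem_procyclic hG).1 hn
    rw [(commute_padicPow_right hG ((hwc g).symm.pow_right ℓ) z).eq, mul_inv_cancel_right]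
    exact hn⟩
  set N := Bq ⊔ W with hN
  have hNcl : IsClosed (N : Set G) :=
    isClosed_sup hG (isClosed_twoSpan hG hy q) (isClosed_procyclic hG _)
  set S := procyclic hG (x ^ q) ⊔ N with hS
  have hScl : IsClosed (S : Set G) := isClosed_sup hG (isClosed_procyclic hG _) hNcl
  have hpowS : ∀ g : G, g ^ q ∈ S := by
    intro g
    obtain ⟨b, hb, a, rfl⟩ := hdecomp g
    obtain ⟨z, hz⟩ := hcomm (x ^ₚ a) b
    obtain ⟨d, hd⟩ := hu
    -- modulo `Bq` the commutator of `x ^ₚ a` and `b` is a power of `w`, hence central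
    set f := QuotientGroup.mk' Bq
    have h1 : f (c ^ₚ z) = f (w ^ₚ (-z)) := by
      have h2 : c ^ₚ z = y ^ₚ ((q : ℤ_[ℓ]) * (d * z)) * w ^ₚ (-z) := by
        have h3 : Commute (y ^ₚ (u - 1)) w⁻¹ :=
          (commute_padicPow_left hG hwy _).inv_right
        rw [hcw, mul_padicPow hG h3, ← padicPow_mul hG, inv_padicPow hG, padicPow_neg hG, hd,
          mul_assoc]
      rw [h2, map_mul, mul_eq_right]
      exact (QuotientGroup.eq_one_iff _).2 ⟨d * z, 0, by simp [padicPow_zero hG]⟩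
    have h2 : f (x ^ₚ a) * f b = f (w ^ₚ (-z)) * f b * f (x ^ₚ a) := by
      rw [← h1, ← hz, ← map_mul, ← map_mul, ← map_mul]
      congr 1
      rw [commutatorElement_def]
      group
    have h3 := mul_pow_of_central h2 (by
      intro k
      obtain ⟨k, rfl⟩ := QuotientGroup.mk'_surjective _ k
      have := commute_padicPow_left hG (hwc k) (-z)
      exact this.map f) q
    rw [← map_mul, ← map_pow, ← map_pow, ← map_pow, ← map_pow, ← map_mul, ← map_mul] at h3
    have h4 := QuotientGroup.eq.1 h3.symm
    obtain ⟨e, he⟩ := dvd_powExp_choose_two ℓ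
    have h5 : (w ^ₚ (-z)) ^ q.choose 2 ∈ W := by
      refine (mem_procyclic hG).2 ⟨-z * e, ?_⟩
      rw [hq, he, ← padicPow_natCast_mul hG, ← padicPow_mul_natCast hG]
      congr 1
      push_cast
      ring
    have h6 : b ^ q ∈ Bq := pow_mem_twoSpan hG hy q hb
    have h7 : (x ^ₚ a) ^ q ∈ procyclic hG (x ^ q) :=
      (mem_procyclic hG).2 ⟨a, by
        rw [← padicPow_natCast_mul hG, ← padicPow_mul_natCast hG, mul_comm]⟩
    have h8 : (w ^ₚ (-z)) ^ q.choose 2 * b ^ q * (x ^ₚ a) ^ q ∈ S :=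
      S.mul_mem (S.mul_mem (Subgroup.mem_sup_right (Subgroup.mem_sup_right h5))
        (Subgroup.mem_sup_right (Subgroup.mem_sup_left h6))) (Subgroup.mem_sup_left h7)
    have h9 := S.mul_mem h8 (Subgroup.mem_sup_right (Subgroup.mem_sup_left h4))
    rwa [mul_inv_cancel_left] at h9
  have hcS : c ∈ S := closedPow_le hScl hpowS (hpow (commutatorElement_mem x y))
  rw [hS, ← SetLike.mem_coe, Subgroup.mul_normal] at hcS
  obtain ⟨X, hX, n, hn, hXn⟩ := Set.mem_mul.1 hcS
  rw [hN, SetLike.mem_coe, ← SetLike.mem_coe, Subgroup.mul_normal] at hn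
  obtain ⟨b, ⟨r, s, rfl⟩, v, hv, rfl⟩ := Set.mem_mul.1 hn
  obtain ⟨a, rfl⟩ := (mem_procyclic hG).1 hX
  obtain ⟨e, rfl⟩ := (mem_procyclic hG).1 hv
  rw [← padicPow_natCast_mul hG, ← padicPow_natCast_mul hG] at hXn
  -- the exponent of `x` vanishes, since that power of `x` is central
  have ha : (q * a : ℤ_[ℓ]) = 0 := by
    by_contra ha
    have h1 : x ^ₚ (q * a : ℤ_[ℓ]) =
        c * (y ^ₚ (q * r : ℤ_[ℓ]) * c ^ₚ (q * s : ℤ_[ℓ]) * w ^ₚ (ℓ * e : ℤ_[ℓ]))⁻¹ :=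
      eq_mul_inv_of_mul_eq hXn
    have hyx : Commute y (x ^ₚ (q * a : ℤ_[ℓ])) := by
      rw [h1]
      exact hy.mul_right (((((commute_padicPow_right hG (Commute.refl y) _).mul_right
        (commute_padicPow_right hG hy _)).mul_right (commute_padicPow_right hG hwy _))).inv_right)
    have hcx := hcentral _ (commute_padicPow_right hG (Commute.refl x) _) hyx c
    have hu1 := eq_one_of_commute_padicPow hG htf hc hu hxu ha hcx
    rw [hu1, padicPow_one hG] at hxu
    have hcx' : Commute c⁻¹ x := (Commute.inv_right (mul_inv_eq_iff_eq_mul.1 hxu)).symm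
    have h2 := conj_padicPow hG y x (q * a : ℤ_[ℓ])
    have h3 : y * x * y⁻¹ = c⁻¹ * x := by rw [hcdef, commutatorElement_def]; group
    rw [h3, mul_padicPow hG hcx', hyx.eq, mul_inv_cancel_right, eq_comm, mul_eq_right,
      inv_padicPow hG, inv_eq_one] at h2
    exact hc (eq_one_of_padicPow_eq_one hG htf ha h2)
  rw [ha, padicPow_zero hG, one_mul] at hXn
  -- solve the remaining equation between powers of `y` and `c` for `c`, whose exponent is a unit
  obtain ⟨t, ht⟩ : ∃ t : ℤ_[ℓ], c = y ^ₚ t := by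
    obtain ⟨k, hk⟩ := dvd_powExp ℓ
    have h1 : Commute (y ^ₚ (u - 1)) c⁻¹ := (commute_padicPow_left hG hy _).inv_right
    have h2 : c ^ₚ (1 + ℓ * (e - k * s) : ℤ_[ℓ]) =
        y ^ₚ (q * r + (u - 1) * (ℓ * e) : ℤ_[ℓ]) := by
      have h3 : Commute (y ^ₚ ((u - 1) * (ℓ * e) : ℤ_[ℓ])) (c ^ₚ (q * s : ℤ_[ℓ])) :=
        commute_padicPow_left hG (commute_padicPow_right hG hy _) _
      have h4 : w ^ₚ (ℓ * e : ℤ_[ℓ]) =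
          y ^ₚ ((u - 1) * (ℓ * e) : ℤ_[ℓ]) * c ^ₚ (-(ℓ * e) : ℤ_[ℓ]) := by
        rw [hw, mul_padicPow hG h1, ← padicPow_mul hG, inv_padicPow hG, padicPow_neg hG]
      have h5 : (1 + ℓ * (e - k * s) : ℤ_[ℓ]) = 1 + -(q * s + -(ℓ * e)) := by
        rw [hq, hk]
        push_cast
        ring
      have h6 : y ^ₚ (q * r + (u - 1) * (ℓ * e) : ℤ_[ℓ]) *
          c ^ₚ (q * s + -(ℓ * e) : ℤ_[ℓ]) = c := by
        refine Eq.trans ?_ hXn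
        rw [h4, padicPow_add hG, padicPow_add hG c]
        simp only [mul_assoc]
        rw [← mul_assoc (c ^ₚ _) (y ^ₚ _), ← h3.eq, mul_assoc]
      rw [h5, padicPow_add hG, padicPow_one hG, padicPow_neg hG, mul_inv_eq_iff_eq_mul]
      exact h6.symm
    obtain ⟨v, hv⟩ := isUnit_one_add (e - k * s : ℤ_[ℓ])
    refine ⟨(q * r + (u - 1) * (ℓ * e) : ℤ_[ℓ]) * (v⁻¹ : ℤ_[ℓ]ˣ), ?_⟩
    rw [padicPow_mul hG, ← h2, ← padicPow_mul hG, ← hv, Units.mul_inv, padicPow_one hG]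
  refine ⟨t, ?_, ht, ?_⟩
  · rintro rfl
    exact hc (by rw [ht, padicPow_zero hG])
  · have h1 : x * y ^ₚ t * x⁻¹ = (y ^ₚ t) ^ₚ (1 + t) := by
      rw [conj_padicPow hG, hxy, ht, ← padicPow_mul hG, mul_comm t, padicPow_mul hG]
      congr 1
      rw [add_comm, padicPow_add hG, padicPow_one hG]
    rw [ht]
    exact h1

/-- The structure of a torsion-free powerful pro-`ℓ` group generated by two elements `x`, `y` with
`c = [x, y] ≠ 1`: it acts nontrivially on `c`, and the centralizer of `c` is commensurable with
the procyclic subgroup generated by `c`. After a change of generators, which leaves `c` unchanged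
or inverts it, one of the generators commutes with `c`, and `exists_commutator_eq` applies. -/
theorem structure_of_two_generators (hG : IsProL ℓ G) (htf : ∀ g : G, IsOfFinOrder g → g = 1)
    {x y : G} (hgen : (Subgroup.closure {x, y}).topologicalClosure = ⊤) (hpow : IsPowerful G ℓ)
    (hc : ⁅x, y⁆ ≠ 1) :
    ¬ (Commute x ⁅x, y⁆ ∧ Commute y ⁅x, y⁆) ∧
      ∀ h, Commute h ⁅x, y⁆ → ∃ t s : ℤ_[ℓ], t ≠ 0 ∧ h ^ₚ t = ⁅x, y⁆ ^ₚ s := by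
  have hact : ∀ x y : G, (Subgroup.closure {x, y}).topologicalClosure = ⊤ → ⁅x, y⁆ ≠ 1 →
      ∀ g, ∃ u : ℤ_[ℓ], IsPrincipal u ∧ g * ⁅x, y⁆ * g⁻¹ = ⁅x, y⁆ ^ₚ u :=
    fun x y hgen hc => exists_isPrincipal hG htf hpow hc (commutatorElement_mem x y)
      (exists_commutator_eq_padicPow hG hgen hpow)
  have core : ∀ x y : G, (Subgroup.closure {x, y}).topologicalClosure = ⊤ → ⁅x, y⁆ ≠ 1 →
      Commute y ⁅x, y⁆ → ¬ Commute x ⁅x, y⁆ ∧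
      ∀ h, Commute h ⁅x, y⁆ → ∃ t s : ℤ_[ℓ], t ≠ 0 ∧ h ^ₚ t = ⁅x, y⁆ ^ₚ s := by
    intro x y hgen hc hy
    obtain ⟨t, ht0, ht, hxt⟩ := exists_commutator_eq hG htf hgen hpow hc hy
    obtain ⟨u, hu, hxu⟩ := hact x y hgen hc x
    have hut : u = 1 + t := padicPow_injective hG htf hc (hxu.symm.trans hxt)
    refine ⟨fun hx => ?_, fun h hh => ⟨t, ?_⟩⟩
    · rw [hx.eq, mul_inv_cancel_right] at hxu
      have : u = 1 := padicPow_injective hG htf hc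
        (by change _ ^ₚ _ = _ ^ₚ _; rw [← hxu, padicPow_one hG])
      rw [this, left_eq_add] at hut
      exact ht0 hut
    · -- `h = y ^ₚ r * x ^ₚ a`, and `x ^ₚ a` commutes with `[x, y]`, so `a = 0`
      have hcomm := exists_commutator_eq_padicPow hG hgen hpow
      have hYn : (procyclic hG y).Normal := ⟨fun b hb g => by
        obtain ⟨z, hz⟩ := hcomm g b
        have : g * b * g⁻¹ = ⁅x, y⁆ ^ₚ z * b := by rw [← hz, commutatorElement_def]; group
        rw [this]
        refine Subgroup.mul_mem _ ((mem_procyclic hG).2 ⟨t * z, ?_⟩) hb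
        rw [padicPow_mul hG, ← ht]⟩
      have hmem : h ∈ procyclic hG x ⊔ procyclic hG y := by
        have hh : h ∈ (Subgroup.closure {x, y}).topologicalClosure := hgen ▸ Subgroup.mem_top h
        refine closure_le_of_isClosed
          (isClosed_sup hG (isClosed_procyclic hG x) (isClosed_procyclic hG y)) ?_ hh
        rintro b (rfl | rfl)
        exacts [Subgroup.mem_sup_left (self_mem_procyclic hG _),
          Subgroup.mem_sup_right (self_mem_procyclic hG _)]
      rw [← SetLike.mem_coe, Subgroup.mul_normal] at hmem
      obtain ⟨_, ha, _, hr, rfl⟩ := Set.mem_mul.1 hmem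
      obtain ⟨a, rfl⟩ := (mem_procyclic hG).1 ha
      obtain ⟨r, rfl⟩ := (mem_procyclic hG).1 hr
      have h1 : Commute (x ^ₚ a) ⁅x, y⁆ := by
        have := hh.mul_left (commute_padicPow_left hG hy r).inv_left
        rwa [mul_inv_cancel_right] at this
      obtain rfl : a = 0 := by
        by_contra ha
        have := eq_one_of_commute_padicPow hG htf hc hu hxu ha h1
        rw [this, left_eq_add] at hut
        exact ht0 hut
      refine ⟨r, ht0, ?_⟩
      rw [padicPow_zero hG, one_mul, ht, ← padicPow_mul hG, ← padicPow_mul hG, mul_comm]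
  have swap : ∀ x y : G, (Subgroup.closure {x, y}).topologicalClosure = ⊤ → ⁅x, y⁆ ≠ 1 →
      ∀ u v : ℤ_[ℓ], IsPrincipal u → x * ⁅x, y⁆ * x⁻¹ = ⁅x, y⁆ ^ₚ u →
      y * ⁅x, y⁆ * y⁻¹ = ⁅x, y⁆ ^ₚ v → u - 1 ∣ v - 1 → ¬ Commute x ⁅x, y⁆ ∧
      ∀ h, Commute h ⁅x, y⁆ → ∃ t s : ℤ_[ℓ], t ≠ 0 ∧ h ^ₚ t = ⁅x, y⁆ ^ₚ s := by
    intro x y hgen hc u v hu hxu hyv huv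
    obtain ⟨z, hz⟩ := exists_padicPow_conj_eq hG hu hxu hyv huv fun g =>
      (hact x y hgen hc g).imp fun _ h => h.2
    have h1 : ⁅x, y * (x ^ₚ z)⁻¹⁆ = ⁅x, y⁆ := by
      have := (commute_padicPow_right hG (Commute.refl x) z).inv_right
      rw [commutatorElement_def, commutatorElement_def, mul_inv_rev, inv_inv,
        ← mul_assoc x y, mul_assoc (x * y), ← this.inv_left.eq]
      group
    have h2 : (Subgroup.closure {x, y * (x ^ₚ z)⁻¹}).topologicalClosure = ⊤ := by
      rw [eq_top_iff, ← hgen]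
      refine closure_le_of_isClosed (Subgroup.isClosed_topologicalClosure _) ?_
      have hx : x ∈ (Subgroup.closure {x, y * (x ^ₚ z)⁻¹}).topologicalClosure :=
        Subgroup.le_topologicalClosure _ (Subgroup.subset_closure (Or.inl rfl))
      rintro b (rfl | rfl)
      · exact hx
      · have h3 := Subgroup.mul_mem _ (Subgroup.le_topologicalClosure _
          (Subgroup.subset_closure (Or.inr rfl) :
            b * (x ^ₚ z)⁻¹ ∈ Subgroup.closure {x, b * (x ^ₚ z)⁻¹}))
          (padicPow_mem_of_isClosed hG (Subgroup.isClosed_topologicalClosure _) hx z)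
        rwa [inv_mul_cancel_right] at h3
    have := core x (y * (x ^ₚ z)⁻¹) h2
    rw [h1] at this
    exact this hc hz
  obtain ⟨u, hu, hxu⟩ := hact x y hgen hc x
  obtain ⟨v, hv, hyv⟩ := hact x y hgen hc y
  rcases ValuationRing.dvd_total (u - 1) (v - 1) with h | h
  · obtain ⟨h1, h2⟩ := swap x y hgen hc u v hu hxu hyv h
    exact ⟨fun h => h1 h.1, h2⟩
  · have hinv : ⁅y, x⁆ = ⁅x, y⁆⁻¹ := (commutatorElement_inv x y).symm
    have hconj : ∀ {g : G} {u : ℤ_[ℓ]}, g * ⁅x, y⁆ * g⁻¹ = ⁅x, y⁆ ^ₚ u →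
        g * ⁅x, y⁆⁻¹ * g⁻¹ = ⁅x, y⁆⁻¹ ^ₚ u := by
      intro g u h
      rw [inv_padicPow hG, ← h]
      group
    have := swap y x (by rwa [Set.pair_comm]) (by rwa [hinv, ne_eq, inv_eq_one]) v u hv
      (by rw [hinv]; exact hconj hyv) (by rw [hinv]; exact hconj hxu) h
    rw [hinv] at this
    refine ⟨fun h => this.1 h.2.inv_right, fun g hg => ?_⟩
    obtain ⟨t, s, ht, hts⟩ := this.2 g hg.inv_right
    exact ⟨t, -s, ht, by rw [hts, inv_padicPow hG, padicPow_neg hG]⟩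

end TwoGen

/-! ### Locally uniform pro-ℓ groups -/

section LocallyUniform

variable {ℓ : ℕ} [hp : Fact ℓ.Prime] {G : Type*} [Group G] [TopologicalSpace G]
  [IsTopologicalGroup G]

/-- A topological generating set of a closed subgroup generates it as a topological group. -/
theorem topologicalClosure_closure_preimage (hG : IsProL ℓ G) {H : Subgroup G}
    (hH : IsClosed (H : Set G)) {S : Set G} (hS : (Subgroup.closure S).topologicalClosure = H) :
    (Subgroup.closure ((↑) ⁻¹' S : Set H)).topologicalClosure = ⊤ := by
  have := hG.t2
  have := (hG.subgroup hH).compact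
  set T := (Subgroup.closure ((↑) ⁻¹' S : Set H)).topologicalClosure
  have hT : IsClosed (T : Set H) := Subgroup.isClosed_topologicalClosure _
  have hTm : IsClosed ((T.map H.subtype : Subgroup G) : Set G) :=
    (hT.isCompact.image continuous_subtype_val).isClosed
  have hSH : S ⊆ H := by
    rw [← hS]
    exact Subgroup.subset_closure.trans (Subgroup.le_topologicalClosure _)
  have h1 : H ≤ T.map H.subtype := by
    refine hS.symm.le.trans ?_
    refine closure_le_of_isClosed hTm fun s hs => ?_
    exact ⟨⟨s, hSH hs⟩, Subgroup.le_topologicalClosure _ (Subgroup.subset_closure hs), rfl⟩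
  rw [Subgroup.eq_top_iff']
  intro h
  obtain ⟨t, ht, hth⟩ := h1 h.2
  have : t = h := Subtype.ext hth
  rwa [← this]

theorem IsLocallyUniform.torsionFree (hLU : IsLocallyUniform G ℓ) :
    ∀ g : G, IsOfFinOrder g → g = 1 := by
  intro g hg
  have := (hLU ⊤ isClosed_univ).torsionFree ⟨g, trivial⟩ (by
    rw [isOfFinOrder_iff_pow_eq_one] at hg ⊢
    obtain ⟨n, hn, hgn⟩ := hg
    exact ⟨n, hn, Subtype.ext hgn⟩)
  exact congrArg Subtype.val this

/-- The structure of the closed subgroup generated by two noncommuting elements of a locally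
uniform pro-`ℓ` group. -/
theorem IsLocallyUniform.two_generators (hG : IsProL ℓ G) (hLU : IsLocallyUniform G ℓ) {x y : G}
    (hc : ⁅x, y⁆ ≠ 1) :
    (∀ g ∈ (Subgroup.closure {x, y}).topologicalClosure,
      ∀ h ∈ (Subgroup.closure {x, y}).topologicalClosure, ∃ z : ℤ_[ℓ], ⁅g, h⁆ = ⁅x, y⁆ ^ₚ z) ∧
    (∀ g ∈ (Subgroup.closure {x, y}).topologicalClosure,
      ∃ u : ℤ_[ℓ], IsPrincipal u ∧ g * ⁅x, y⁆ * g⁻¹ = ⁅x, y⁆ ^ₚ u) ∧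
    ¬ (Commute x ⁅x, y⁆ ∧ Commute y ⁅x, y⁆) ∧
    ∀ h ∈ (Subgroup.closure {x, y}).topologicalClosure, Commute h ⁅x, y⁆ →
      ∃ t s : ℤ_[ℓ], t ≠ 0 ∧ h ^ₚ t = ⁅x, y⁆ ^ₚ s := by
  set H := (Subgroup.closure {x, y}).topologicalClosure with hHdef
  have hH : IsClosed (H : Set G) := Subgroup.isClosed_topologicalClosure _
  have hx : x ∈ H := Subgroup.le_topologicalClosure _ (Subgroup.subset_closure (Or.inl rfl))
  have hy : y ∈ H := Subgroup.le_topologicalClosure _ (Subgroup.subset_closure (Or.inr rfl))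
  have hPH := hG.subgroup hH
  obtain ⟨hpow, -, htf⟩ := hLU H hH
  set X : H := ⟨x, hx⟩
  set Y : H := ⟨y, hy⟩
  have hgen : (Subgroup.closure {X, Y}).topologicalClosure = ⊤ := by
    have := topologicalClosure_closure_preimage hG hH hHdef.symm
    convert this using 3
    ext a
    simp [X, Y, Subtype.ext_iff]
  have hXY : ((⁅X, Y⁆ : H) : G) = ⁅x, y⁆ := rfl
  have hcXY : ⁅X, Y⁆ ≠ 1 := fun h => hc (by rw [← hXY, h]; rfl)
  have h1 := exists_commutator_eq_padicPow hPH hgen hpow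
  have h2 := exists_isPrincipal hPH htf hpow hcXY (commutatorElement_mem X Y) h1
  obtain ⟨h3, h4⟩ := structure_of_two_generators hPH htf hgen hpow hcXY
  have hcoe : ∀ z : ℤ_[ℓ], ((⁅X, Y⁆ ^ₚ z : H) : G) = ⁅x, y⁆ ^ₚ z := coe_padicPow hG hH _
  refine ⟨fun g hg h hh => ?_, fun g hg => ?_, ?_, fun h hh hhc => ?_⟩
  · obtain ⟨z, hz⟩ := h1 ⟨g, hg⟩ ⟨h, hh⟩
    exact ⟨z, by rw [← hcoe, ← hz]; rfl⟩
  · obtain ⟨u, hu, hz⟩ := h2 ⟨g, hg⟩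
    exact ⟨u, hu, by rw [← hcoe, ← hz]; rfl⟩
  · rintro ⟨ha, hb⟩
    exact h3 ⟨Subtype.ext ha, Subtype.ext hb⟩
  · obtain ⟨t, s, ht, hts⟩ := h4 ⟨h, hh⟩ (Subtype.ext hhc)
    refine ⟨t, s, ht, ?_⟩
    rw [← hcoe, ← hts, coe_padicPow hG hH]

theorem mem_left (x y : G) : x ∈ (Subgroup.closure {x, y}).topologicalClosure :=
  Subgroup.le_topologicalClosure _ (Subgroup.subset_closure (Or.inl rfl))

theorem mem_right (x y : G) : y ∈ (Subgroup.closure {x, y}).topologicalClosure :=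
  Subgroup.le_topologicalClosure _ (Subgroup.subset_closure (Or.inr rfl))

/-- Commuting eigenvectors `e` and `f` of `b` in a locally uniform pro-`ℓ` group have the same
eigenvalue. Otherwise `e` and `f` are independent, and `e f` commutes with
`[b, e f] = e ^ (α - 1) f ^ (β - 1)`; by the structure of the subgroup generated by `b` and `e f`,
a power of `e f` is a power of this commutator, whence `α = β`. -/
theorem IsLocallyUniform.eigenvalue_eq (hG : IsProL ℓ G) (hLU : IsLocallyUniform G ℓ)
    {b e f : G} {α β : ℤ_[ℓ]} (he : e ≠ 1) (hf : f ≠ 1) (hef : Commute e f)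
    (hα : b * e * b⁻¹ = e ^ₚ α) (hβ : b * f * b⁻¹ = f ^ₚ β) : α = β := by
  have htf := hLU.torsionFree
  by_contra hne
  -- otherwise `e` and `f` are independent
  have hind : ∀ r s : ℤ_[ℓ], e ^ₚ r = f ^ₚ s → r = 0 ∧ s = 0 := by
    intro r s hrs
    have h1 : e ^ₚ (r * α) = e ^ₚ (r * β) := by
      rw [mul_comm, padicPow_mul hG, ← hα, ← conj_padicPow hG, hrs, conj_padicPow hG, hβ,
        ← padicPow_mul hG, mul_comm, padicPow_mul hG, ← hrs, ← padicPow_mul hG]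
    have h2 : r * α = r * β := padicPow_injective hG htf he h1
    have hr : r = 0 := by
      by_contra hr
      exact hne (mul_left_cancel₀ hr h2)
    refine ⟨hr, ?_⟩
    by_contra hs
    rw [hr, padicPow_zero hG] at hrs
    exact hf (eq_one_of_padicPow_eq_one hG htf hs hrs.symm)
  have hind' : ∀ r s r' s' : ℤ_[ℓ], e ^ₚ r * f ^ₚ s = e ^ₚ r' * f ^ₚ s' → r = r' ∧ s = s' := by
    intro r s r' s' h
    have h1 : e ^ₚ (-r' + r) = f ^ₚ (s' - s) := by
      rw [padicPow_add hG, padicPow_sub hG, padicPow_neg hG, eq_mul_inv_iff_mul_eq, mul_assoc, h,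
        inv_mul_cancel_left]
    obtain ⟨h2, h3⟩ := hind _ _ h1
    exact ⟨by linear_combination h2, by linear_combination -h3⟩
  have hef' : ∀ r s : ℤ_[ℓ], Commute (e ^ₚ r) (f ^ₚ s) := fun r s =>
    commute_padicPow_left hG (commute_padicPow_right hG hef s) r
  have hk : ⁅b, e * f⁆ = e ^ₚ (α - 1) * f ^ₚ (β - 1) := by
    have h1 : ⁅b, e * f⁆ = (b * e * b⁻¹) * ((b * f * b⁻¹) * f⁻¹) * e⁻¹ := by
      rw [commutatorElement_def]; group
    have h2 := hef' (-1) (β - 1)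
    rw [padicPow_neg hG, padicPow_one hG] at h2
    rw [h1, hα, hβ, padicPow_sub hG, padicPow_sub hG f, padicPow_one hG, padicPow_one hG,
      mul_assoc (e ^ₚ α)]
    rw [padicPow_sub hG, padicPow_one hG] at h2
    rw [← h2.eq, mul_assoc]
  by_cases hk1 : ⁅b, e * f⁆ = 1
  · rw [hk] at hk1
    obtain ⟨h1, h2⟩ := hind' (α - 1) (β - 1) 0 0 (by
      rw [hk1, padicPow_zero hG, padicPow_zero hG, mul_one])
    exact hne (by linear_combination h1 - h2)
  · obtain ⟨-, hact, -, hcen⟩ := hLU.two_generators hG hk1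
    obtain ⟨w, -, hw⟩ := hact b (mem_left _ _)
    have h1 : b * (e ^ₚ (α - 1) * f ^ₚ (β - 1)) * b⁻¹ =
        e ^ₚ (α * (α - 1)) * f ^ₚ (β * (β - 1)) := by
      have : b * (e ^ₚ (α - 1) * f ^ₚ (β - 1)) * b⁻¹ =
        (b * e ^ₚ (α - 1) * b⁻¹) * (b * f ^ₚ (β - 1) * b⁻¹) := by group
      rw [this, conj_padicPow hG, conj_padicPow hG, hα, hβ, ← padicPow_mul hG, ← padicPow_mul hG]
    rw [hk, h1, mul_padicPow hG (hef' _ _), ← padicPow_mul hG, ← padicPow_mul hG] at hw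
    obtain ⟨h2, h3⟩ := hind' _ _ _ _ hw
    have h4 : (α - 1) * (α - w) = 0 := by linear_combination h2
    have h5 : (β - 1) * (β - w) = 0 := by linear_combination h3
    have hcomm : Commute (e * f) ⁅b, e * f⁆ → False := by
      intro hc
      obtain ⟨t, s, ht, hts⟩ := hcen (e * f) (mem_right _ _) hc
      rw [hk, mul_padicPow hG hef, mul_padicPow hG (hef' _ _), ← padicPow_mul hG,
        ← padicPow_mul hG] at hts
      obtain ⟨h6, h7⟩ := hind' _ _ _ _ hts
      have : s * (α - β) = 0 := by linear_combination h7 - h6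
      rcases mul_eq_zero.1 this with h | h
      · exact ht (by rw [h6, h, mul_zero])
      · exact hne (sub_eq_zero.1 h)
    refine hcomm ?_
    rw [hk]
    have he1 := commute_padicPow_right hG (Commute.refl e) (α - 1)
    have hf1 := commute_padicPow_right hG (Commute.refl f) (β - 1)
    exact (he1.mul_right (commute_padicPow_right hG hef _)).mul_left
      ((commute_padicPow_right hG hef.symm _).mul_right hf1)

/-- If some element acts nontrivially on the procyclic subgroup generated by `c`, then this
subgroup is normal in the locally uniform group. Let `e = [g, c]`. If `c` and `e` commute, they have
a common power, which `g` conjugates to a power of itself. Otherwise `e` and `f = x e x⁻¹` are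
eigenvectors of `b = x c x⁻¹`, a power of `c`, with different eigenvalues, so that they do not
commute. As `b` acts on their commutator, `e` and `f` commute with it, which is impossible. -/
theorem IsLocallyUniform.exists_conj_eq (hG : IsProL ℓ G) (hLU : IsLocallyUniform G ℓ)
    {c x : G} {u : ℤ_[ℓ]} (hu : IsPrincipal u) (hu1 : u ≠ 1)
    (hx : x * c * x⁻¹ = c ^ₚ u) (g : G) :
    ∃ v : ℤ_[ℓ], IsPrincipal v ∧ g * c * g⁻¹ = c ^ₚ v := by
  have htf := hLU.torsionFree
  by_cases hgc : Commute g c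
  · exact ⟨1, isPrincipal_one, by rw [hgc.eq, mul_inv_cancel_right, padicPow_one hG]⟩
  have he : ⁅g, c⁆ ≠ 1 := fun h => hgc (commutatorElement_eq_one_iff_commute.1 h)
  obtain ⟨-, hact, -, hcen⟩ := hLU.two_generators hG he
  obtain ⟨v, hv, hcv⟩ := hact c (mem_right _ _)
  set e := ⁅g, c⁆ with hedef
  by_cases hv1 : v = 1
  · -- `c` commutes with `e`, so that a power of `c` is a power of `e`
    have hce : Commute c e := by
      rw [hv1, padicPow_one hG] at hcv
      exact mul_inv_eq_iff_eq_mul.1 hcv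
    obtain ⟨t, s, ht, hts⟩ := hcen c (mem_right _ _) hce
    obtain ⟨w, hw, hgw⟩ := hact g (mem_left _ _)
    refine ⟨w, hw, ?_⟩
    have h1 : g * c * g⁻¹ = e * c := by rw [hedef, commutatorElement_def]; group
    have h2 : (g * c * g⁻¹) ^ₚ t = (c ^ₚ w) ^ₚ t := by
      rw [← conj_padicPow hG, hts, conj_padicPow hG, hgw, ← padicPow_mul hG, ← padicPow_mul hG,
        mul_comm, padicPow_mul hG, ← hts, ← padicPow_mul hG, mul_comm]
    have h3 : Commute (g * c * g⁻¹) (c ^ₚ w)⁻¹ := by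
      rw [h1]
      exact (commute_padicPow_right hG (hce.symm.mul_left (Commute.refl c)) w).inv_right
    rw [← mul_inv_eq_one]
    refine eq_one_of_padicPow_eq_one hG htf ht ?_
    rw [mul_padicPow hG h3, h2, inv_padicPow hG, mul_inv_cancel]
  · exfalso
    have hu0 : u ≠ 0 := hu.isUnit.ne_zero
    have hcH := padicPow_mem_of_isClosed hG (Subgroup.isClosed_topologicalClosure _)
      (mem_right g c) u
    obtain ⟨α, hα, hbα⟩ := hact _ hcH
    set b := c ^ₚ u with hb
    set f := x * e * x⁻¹ with hf
    have hf1 : f ≠ 1 := by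
      rw [hf, ne_eq, conj_eq_one_iff]
      exact he
    have hbf : b * f * b⁻¹ = f ^ₚ v := by
      rw [hf, ← conj_padicPow hG, ← hcv, ← hx]
      group
    have hα1 : α ≠ 1 := by
      rintro rfl
      rw [padicPow_one hG, mul_inv_eq_iff_eq_mul] at hbα
      exact hv1 (eq_one_of_commute_padicPow hG htf he hv hcv hu0 hbα)
    have hαv : α ≠ v := by
      rintro rfl
      refine hv1 (eq_one_of_commute_padicPow hG htf he hv hcv (sub_ne_zero.2 hu1) ?_)
      rw [sub_eq_neg_add, padicPow_add hG, padicPow_neg hG, padicPow_one hG, ← hb]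
      refine mul_inv_eq_iff_eq_mul.1 ?_
      calc c⁻¹ * b * e * (c⁻¹ * b)⁻¹ = c⁻¹ * (b * e * b⁻¹) * c := by group
        _ = c⁻¹ * (c * e * c⁻¹) * c := by rw [hbα, hcv]
        _ = e := by group
    by_cases hef : Commute e f
    · exact hαv (hLU.eigenvalue_eq hG he hf1 hef hbα hbf)
    have hk : ⁅e, f⁆ ≠ 1 := fun h => hef (commutatorElement_eq_one_iff_commute.1 h)
    obtain ⟨hcomm, hact', hncomm, -⟩ := hLU.two_generators hG hk
    have hcl := Subgroup.isClosed_topologicalClosure (Subgroup.closure {e, f})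
    obtain ⟨r, hr⟩ := hcomm _ (padicPow_mem_of_isClosed hG hcl (mem_left e f) α)
      _ (padicPow_mem_of_isClosed hG hcl (mem_right e f) v)
    have hbk : b * ⁅e, f⁆ * b⁻¹ = ⁅e, f⁆ ^ₚ r := by
      rw [← hr, ← hbα, ← hbf]
      simp only [commutatorElement_def]
      group
    set k := ⁅e, f⁆
    have hkr : k ^ₚ r ≠ 1 := by
      rw [← hbk, ne_eq, conj_eq_one_iff]
      exact hk
    -- conjugation by `b` shows that `d` and `d ^ₚ γ` act on `k` in the same way
    have key : ∀ d ∈ (Subgroup.closure {e, f}).topologicalClosure, ∀ γ : ℤ_[ℓ], γ ≠ 1 →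
        b * d * b⁻¹ = d ^ₚ γ → Commute d k := by
      intro d hd γ hγ hbd
      obtain ⟨s, hs, hds⟩ := hact' d hd
      have h1 : d * k ^ₚ r * d⁻¹ = (k ^ₚ r) ^ₚ s := by
        rw [conj_padicPow hG, hds, ← padicPow_mul hG, ← padicPow_mul hG, mul_comm]
      have h2 : d ^ₚ γ * k ^ₚ r * (d ^ₚ γ)⁻¹ = (k ^ₚ r) ^ₚ s := by
        rw [← hbd, ← hbk, ← conj_padicPow hG, ← hds]
        group
      have h3 : s = 1 := by
        refine eq_one_of_commute_padicPow hG htf hkr hs h1 (sub_ne_zero.2 hγ) ?_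
        rw [sub_eq_neg_add, padicPow_add hG, padicPow_neg hG, padicPow_one hG]
        refine mul_inv_eq_iff_eq_mul.1 ?_
        calc d⁻¹ * d ^ₚ γ * k ^ₚ r * (d⁻¹ * d ^ₚ γ)⁻¹
            = d⁻¹ * (d ^ₚ γ * k ^ₚ r * (d ^ₚ γ)⁻¹) * d := by group
          _ = d⁻¹ * (d * k ^ₚ r * d⁻¹) * d := by rw [h2, h1]
          _ = k ^ₚ r := by group
      rw [h3, padicPow_one hG] at hds
      exact mul_inv_eq_iff_eq_mul.1 hds
    exact hncomm ⟨key e (mem_left _ _) α hα1 hbα, key f (mem_right _ _) v hv1 hbf⟩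

/-- A locally uniform pro-`ℓ` group has a torsion-free orientation `θ` such that `g` acts on
`ker θ` as the power with exponent `θ(g)`. If the group is not abelian, `θ` is the action on any
nontrivial commutator. -/
theorem IsLocallyUniform.exists_orientation (hG : IsProL ℓ G) (hLU : IsLocallyUniform G ℓ) :
    ∃ θ : G →ₜ* ℤ_[ℓ]ˣ, IsTorsionFreeOrientation θ ∧
      ∀ h ∈ kernel θ, ∀ g, g * h * g⁻¹ = h ^ₚ (θ g : ℤ_[ℓ]) := by
  have htf := hLU.torsionFree
  by_cases hab : ∀ x y : G, ⁅x, y⁆ = 1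
  · refine ⟨1, fun _ g => by simp, fun h _ g => ?_⟩
    have : Commute g h := commutatorElement_eq_one_iff_commute.1 (hab g h)
    simp [this.eq, padicPow_one hG]
  push Not at hab
  obtain ⟨x, y, hc⟩ := hab
  have hact : ∀ g, ∃ v : ℤ_[ℓ], IsPrincipal v ∧ g * ⁅x, y⁆ * g⁻¹ = ⁅x, y⁆ ^ₚ v := by
    obtain ⟨-, h1, h2, -⟩ := hLU.two_generators hG hc
    have key : ∀ a ∈ (Subgroup.closure {x, y}).topologicalClosure, ¬ Commute a ⁅x, y⁆ →
        ∀ g, ∃ v : ℤ_[ℓ], IsPrincipal v ∧ g * ⁅x, y⁆ * g⁻¹ = ⁅x, y⁆ ^ₚ v := by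
      intro a ha hna
      obtain ⟨u, hu, hau⟩ := h1 a ha
      refine hLU.exists_conj_eq hG hu ?_ hau
      rintro rfl
      rw [padicPow_one hG] at hau
      exact hna (mul_inv_eq_iff_eq_mul.1 hau)
    by_cases hx : Commute x ⁅x, y⁆
    · exact key y (mem_right _ _) fun hy => h2 ⟨hx, hy⟩
    · exact key x (mem_left _ _) hx
  set c := ⁅x, y⁆
  choose u hu hcu using hact
  have hinj := padicPow_injective hG htf hc
  let f : G →* ℤ_[ℓ] :=
    { toFun := u
      map_one' := hinj (by
        change c ^ₚ _ = c ^ₚ _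
        rw [← hcu, padicPow_one hG]; group)
      map_mul' := fun a b => hinj (by
        change c ^ₚ _ = c ^ₚ _
        have h1 : a * b * c * (a * b)⁻¹ = a * (b * c * b⁻¹) * a⁻¹ := by group
        rw [← hcu, padicPow_mul hG, ← hcu a, h1, hcu b, conj_padicPow hG]) }
  have hfc : Continuous u := by
    have := hG.t2
    have hemb := ((continuous_padicPow hG c).isClosedEmbedding hinj).isEmbedding
    rw [hemb.continuous_iff]
    have : ((fun z : ℤ_[ℓ] => c ^ₚ z) ∘ u) = fun g => g * c * g⁻¹ := funext fun g => (hcu g).symm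
    rw [this]
    fun_prop
  let θ : G →ₜ* ℤ_[ℓ]ˣ :=
    { toMonoidHom := f.toHomUnits
      continuous_toFun := Units.continuous_iff.2 ⟨hfc, by
        have : (fun g => ((f.toHomUnits g)⁻¹ : ℤ_[ℓ]ˣ).val) = fun g => u g⁻¹ := by
          ext g
          rw [← map_inv]
          rfl
        change Continuous (fun g => ((f.toHomUnits g)⁻¹ : ℤ_[ℓ]ˣ).val)
        rw [this]
        exact hfc.comp continuous_inv⟩ }
  have hθ : ∀ g, (θ g : ℤ_[ℓ]) = u g := fun g => rfl
  refine ⟨θ, fun h2 g => ?_, fun h hh g => ?_⟩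
  · have := hu g
    rw [IsPrincipal, powExp, if_pos h2] at this
    exact_mod_cast this
  · rw [hθ]
    by_cases h1 : h = 1
    · rw [h1, one_padicPow hG, mul_one, mul_inv_cancel]
    have huh : u h = 1 := by
      have : θ h = 1 := hh
      rw [← hθ, this, Units.val_one]
    have hhc : Commute h c := by
      have := hcu h
      rw [huh, padicPow_one hG] at this
      exact mul_inv_eq_iff_eq_mul.1 this
    by_cases hgh : Commute g h
    · -- then `g` acts trivially, since `h` and `c` have the same eigenvalue
      have := hLU.eigenvalue_eq hG h1 hc hhc (b := g) (α := 1)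
        (by rw [hgh.eq, mul_inv_cancel_right, padicPow_one hG]) (hcu g)
      rw [← this, padicPow_one hG, hgh.eq, mul_inv_cancel_right]
    have hk : ⁅g, h⁆ ≠ 1 := fun hk => hgh (commutatorElement_eq_one_iff_commute.1 hk)
    obtain ⟨-, hact', -, hcen⟩ := hLU.two_generators hG hk
    have hkc : Commute ⁅g, h⁆ c := by
      have h2 : u ⁅g, h⁆ = 1 := by
        change f ⁅g, h⁆ = 1
        rw [commutatorElement_def, map_mul, map_mul, map_mul]
        have h3 : f h = 1 := huh
        have h4 : f h⁻¹ = 1 := by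
          have := map_mul f h h⁻¹
          rw [mul_inv_cancel, map_one, h3, one_mul] at this
          exact this.symm
        rw [h3, h4, mul_one, mul_one, ← map_mul, mul_inv_cancel, map_one]
      have := hcu ⁅g, h⁆
      rw [h2, padicPow_one hG] at this
      exact mul_inv_eq_iff_eq_mul.1 this
    obtain ⟨β, -, hβ⟩ := hact' g (mem_left _ _)
    obtain ⟨γ, -, hγ⟩ := hact' h (mem_right _ _)
    have hβu := hLU.eigenvalue_eq hG hk hc hkc hβ (hcu g)
    have hγu := hLU.eigenvalue_eq hG hk hc hkc hγ (hcu h)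
    rw [hγu, huh, padicPow_one hG, mul_inv_eq_iff_eq_mul] at hγ
    obtain ⟨t, s, ht, hts⟩ := hcen h (mem_right _ _) hγ
    have h2 : g * h * g⁻¹ = ⁅g, h⁆ * h := by rw [commutatorElement_def]; group
    have h3 : (g * h * g⁻¹) ^ₚ t = (h ^ₚ u g) ^ₚ t := by
      rw [← conj_padicPow hG, hts, conj_padicPow hG, hβ, hβu, ← padicPow_mul hG,
        ← padicPow_mul hG, mul_comm, padicPow_mul hG, ← hts, ← padicPow_mul hG, mul_comm]
    have h4 : Commute (g * h * g⁻¹) (h ^ₚ u g)⁻¹ := by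
      rw [h2]
      exact (commute_padicPow_right hG
        ((show Commute h ⁅g, h⁆ from hγ).symm.mul_left (Commute.refl h)) _).inv_right
    rw [← mul_inv_eq_one]
    refine eq_one_of_padicPow_eq_one hG htf ht ?_
    rw [mul_padicPow hG h4, h3, inv_padicPow hG, mul_inv_cancel]

end LocallyUniform

/-! ### Orientations acting on their kernel by powers -/

section Orientations

variable {ℓ : ℕ} [hp : Fact ℓ.Prime] {G : Type*} [Group G] [TopologicalSpace G]
  [IsTopologicalGroup G]

/-- The group acts on the kernel of the orientation `θ` through `θ`; equivalently, `K_θ(G)` is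
trivial. -/
def IsAbelianOrientation (θ : G →ₜ* ℤ_[ℓ]ˣ) : Prop :=
  ∀ h ∈ kernel θ, ∀ g, g * h * g⁻¹ = h ^ₚ (θ g : ℤ_[ℓ])

theorem continuous_coe_orientation (θ : G →ₜ* ℤ_[ℓ]ˣ) : Continuous fun g => (θ g : ℤ_[ℓ]) :=
  Units.continuous_val.comp θ.continuous_toFun

theorem mem_kernel {Q : Type*} [Group Q] [TopologicalSpace Q] {φ : G →ₜ* Q} {g : G} :
    g ∈ kernel φ ↔ φ g = 1 := Iff.rfl

theorem isClosed_kernel {Q : Type*} [Group Q] [TopologicalSpace Q] [T1Space Q] (φ : G →ₜ* Q) :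
    IsClosed (kernel φ : Set G) :=
  isClosed_singleton.preimage φ.continuous_toFun

instance normal_kernel {Q : Type*} [Group Q] [TopologicalSpace Q] (φ : G →ₜ* Q) :
    (kernel φ).Normal :=
  inferInstanceAs φ.toMonoidHom.ker.Normal

/-- For odd `ℓ`, all orientations of a pro-`ℓ` group have values in `1 + ℓℤ_ℓ`. -/
theorem IsTorsionFreeOrientation.isPrincipal (hG : IsProL ℓ G) {θ : G →ₜ* ℤ_[ℓ]ˣ}
    (hθ : IsTorsionFreeOrientation θ) (g : G) : IsPrincipal (θ g : ℤ_[ℓ]) := by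
  unfold IsPrincipal powExp
  split_ifs with h
  · exact_mod_cast hθ h g
  · have h1 := ((continuous_coe_orientation θ).tendsto 1).comp (hG.tendsto_pow g)
    rw [map_one, Units.val_one] at h1
    obtain ⟨k, hk⟩ := ((Metric.tendsto_nhds.1 h1) 1 one_pos).exists
    rw [dist_eq_norm, PadicInt.norm_lt_one_iff_dvd] at hk
    simp only [Function.comp_apply, map_pow, Units.val_pow_eq_pow_val] at hk
    rw [← Ideal.mem_span_singleton, ← PadicInt.maximalIdeal_eq_span_p, ← PadicInt.ker_toZMod,
      RingHom.mem_ker] at hk ⊢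
    rwa [map_sub, map_pow, ZMod.pow_card_pow, ← map_sub] at hk

/-- If `θ(x) - 1` divides `θ(g) - 1`, then `θ(g)` is an `ℓ`-adic power of `θ(x)`. -/
theorem exists_mul_inv_mem_kernel (hG : IsProL ℓ G) {θ : G →ₜ* ℤ_[ℓ]ˣ}
    (hθ : IsTorsionFreeOrientation θ) {x g : G} (h : (θ x - 1 : ℤ_[ℓ]) ∣ θ g - 1) :
    ∃ z : ℤ_[ℓ], g * (x ^ₚ z)⁻¹ ∈ kernel θ := by
  have hcont : Continuous fun z : ℤ_[ℓ] => (θ (x ^ₚ z) : ℤ_[ℓ]) :=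
    (continuous_coe_orientation θ).comp (continuous_padicPow hG x)
  have hmem : (θ g : ℤ_[ℓ]) ∈ closure (Set.range fun z : ℤ_[ℓ] => (θ (x ^ₚ z) : ℤ_[ℓ])) := by
    refine closure_mono ?_ ((hθ.isPrincipal hG x).mem_closure h)
    rintro _ ⟨m, rfl⟩
    refine ⟨m, ?_⟩
    simp only [padicPow_natCast hG, map_pow, Units.val_pow_eq_pow_val]
  rw [(isCompact_range hcont).isClosed.closure_eq] at hmem
  obtain ⟨z, hz⟩ := hmem
  refine ⟨z, ?_⟩
  rw [mem_kernel, map_mul, map_inv, mul_inv_eq_one]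
  exact Units.ext hz.symm

theorem exists_forall_dvd (θ : G →ₜ* ℤ_[ℓ]ˣ) : ∃ x, ∀ g, (θ x - 1 : ℤ_[ℓ]) ∣ θ g - 1 := by
  obtain ⟨I, ⟨x, rfl⟩, hx⟩ := set_has_maximal_iff_noetherian.2
    (inferInstance : IsNoetherian ℤ_[ℓ] ℤ_[ℓ])
    (Set.range fun g => Ideal.span {(θ g - 1 : ℤ_[ℓ])}) (Set.range_nonempty _)
  refine ⟨x, fun g => ?_⟩
  rcases ValuationRing.dvd_total (θ x - 1 : ℤ_[ℓ]) (θ g - 1) with h | h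
  · exact h
  · have h1 := (Ideal.span_singleton_le_span_singleton.2 h).eq_of_not_lt (hx _ ⟨g, rfl⟩)
    exact Ideal.span_singleton_le_span_singleton.1 h1.ge

/-- There is an `x` such that every element is an element of `ker θ` times an `ℓ`-adic power
of `x`. -/
theorem exists_generator (hG : IsProL ℓ G) {θ : G →ₜ* ℤ_[ℓ]ˣ}
    (hθ : IsTorsionFreeOrientation θ) :
    ∃ x, (∀ g, (θ x - 1 : ℤ_[ℓ]) ∣ θ g - 1) ∧ ∀ g, ∃ z : ℤ_[ℓ], g * (x ^ₚ z)⁻¹ ∈ kernel θ := by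
  obtain ⟨x, hx⟩ := exists_forall_dvd θ
  exact ⟨x, hx, fun g => exists_mul_inv_mem_kernel hG hθ (hx g)⟩

theorem eq_one_of_map_padicPow (hG : IsProL ℓ G) {θ : G →ₜ* ℤ_[ℓ]ˣ}
    (hθ : IsTorsionFreeOrientation θ) {x : G} {z : ℤ_[ℓ]} (hz : z ≠ 0)
    (h : x ^ₚ z ∈ kernel θ) : θ x = 1 := by
  have h2 := PadicInt.unitCoeff_spec hz
  set v := PadicInt.unitCoeff hz
  have h3 : ((ℓ ^ z.valuation : ℕ) : ℤ_[ℓ]) = z * (v⁻¹ : ℤ_[ℓ]ˣ) := by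
    rw [mul_comm, Units.eq_inv_mul_iff_mul_eq]
    push_cast
    exact h2.symm
  have h4 : x ^ ℓ ^ z.valuation ∈ kernel θ := by
    rw [← padicPow_natCast hG, h3, padicPow_mul hG]
    exact padicPow_mem_of_isClosed hG (isClosed_kernel θ) h _
  rw [mem_kernel, map_pow] at h4
  refine Units.ext ((hθ.isPrincipal hG x).eq_one_of_pow (i := z.valuation) ?_)
  rw [← Units.val_pow_eq_pow_val, h4, Units.val_one]

theorem mem_kernel_of_pow (hG : IsProL ℓ G) {θ : G →ₜ* ℤ_[ℓ]ˣ}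
    (hθ : IsTorsionFreeOrientation θ) {x : G} (h : x ^ ℓ ∈ kernel θ) : x ∈ kernel θ :=
  eq_one_of_map_padicPow hG hθ (z := (ℓ : ℤ_[ℓ])) (by exact_mod_cast hp.out.ne_zero)
    (by rwa [padicPow_natCast hG])

theorem IsAbelianOrientation.commute (hG : IsProL ℓ G) {θ : G →ₜ* ℤ_[ℓ]ˣ}
    (hab : IsAbelianOrientation θ) {a b : G} (ha : a ∈ kernel θ) (hb : b ∈ kernel θ) :
    Commute a b := by
  have := hab b hb a
  rw [mem_kernel.1 ha, Units.val_one, padicPow_one hG] at this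
  exact mul_inv_eq_iff_eq_mul.1 this

theorem IsAbelianOrientation.exists_commutator_eq_pow (hG : IsProL ℓ G) {θ : G →ₜ* ℤ_[ℓ]ˣ}
    (hθ : IsTorsionFreeOrientation θ) (hab : IsAbelianOrientation θ) (g h : G) :
    ∃ a ∈ kernel θ, ⁅g, h⁆ = a ^ powExp ℓ := by
  have key : ∀ g h : G, (θ g - 1 : ℤ_[ℓ]) ∣ θ h - 1 → ∃ a ∈ kernel θ, ⁅g, h⁆ = a ^ powExp ℓ := by
    intro g h hgh
    obtain ⟨z, hz⟩ := exists_mul_inv_mem_kernel hG hθ hgh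
    obtain ⟨d, hd⟩ := hθ.isPrincipal hG g
    set a := h * (g ^ₚ z)⁻¹ with ha
    have h1 : ⁅g, h⁆ = g * a * g⁻¹ * a⁻¹ := by
      have hh : h = a * g ^ₚ z := by rw [ha]; group
      have hc : g ^ₚ z * g⁻¹ = g⁻¹ * g ^ₚ z :=
        (commute_padicPow_right hG (Commute.refl g) z).inv_left.eq.symm
      calc ⁅g, h⁆ = g * a * (g ^ₚ z * g⁻¹) * (g ^ₚ z)⁻¹ * a⁻¹ := by
            rw [commutatorElement_def, hh]; group
        _ = _ := by rw [hc]; group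
    refine ⟨a ^ₚ d, padicPow_mem_of_isClosed hG (isClosed_kernel θ) hz d, ?_⟩
    rw [h1, hab a hz g, ← padicPow_mul_natCast hG, mul_comm, ← hd, padicPow_sub hG,
      padicPow_one hG]
  rcases ValuationRing.dvd_total (θ g - 1 : ℤ_[ℓ]) (θ h - 1) with hd | hd
  · exact key g h hd
  · obtain ⟨a, ha, hgh⟩ := key h g hd
    exact ⟨a⁻¹, inv_mem ha, by rw [← commutatorElement_inv, hgh, inv_pow]⟩

theorem mem_frattiniSubgroup_le {H : Subgroup G} (hH : IsClosed (H : Set G))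
    (h1 : ∀ g, g ^ ℓ ∈ H) (h2 : ∀ g h : G, ⁅g, h⁆ ∈ H) : frattiniSubgroup G ℓ ≤ H := by
  refine Subgroup.topologicalClosure_minimal _ (sup_le (closedPow_le hH h1) ?_) hH
  refine Subgroup.topologicalClosure_minimal _ ?_ hH
  rw [commutator_def, Subgroup.commutator_le]
  exact fun g _ h _ => h2 g h

theorem pow_mem_frattiniSubgroup (g : G) : g ^ ℓ ∈ frattiniSubgroup G ℓ :=
  Subgroup.le_topologicalClosure _ (Subgroup.mem_sup_left
    (Subgroup.le_topologicalClosure _ (Subgroup.subset_closure ⟨g, rfl⟩)))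

theorem commutator_mem_frattiniSubgroup (g h : G) : ⁅g, h⁆ ∈ frattiniSubgroup G ℓ :=
  Subgroup.le_topologicalClosure _ (Subgroup.mem_sup_right (commutatorElement_mem g h))

theorem isClosed_frattiniSubgroup : IsClosed (frattiniSubgroup G ℓ : Set G) :=
  Subgroup.isClosed_topologicalClosure _

theorem map_mem_frattiniSubgroup {Q : Type*} [Group Q] [TopologicalSpace Q] [IsTopologicalGroup Q]
    (f : G →* Q) (hf : Continuous f) {g : G} (hg : g ∈ frattiniSubgroup G ℓ) :
    f g ∈ frattiniSubgroup Q ℓ := by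
  refine mem_frattiniSubgroup_le (H := (frattiniSubgroup Q ℓ).comap f)
    (isClosed_frattiniSubgroup.preimage hf) (fun g => ?_) (fun g h => ?_) hg
  · rw [Subgroup.mem_comap, map_pow]
    exact pow_mem_frattiniSubgroup _
  · rw [Subgroup.mem_comap, map_commutatorElement]
    exact commutator_mem_frattiniSubgroup _ _

/-- An element of `ker θ ∩ Φ(G)` is an `ℓ`-th power in `ker θ`: modulo the `ℓ`-th powers of
elements of `ker θ` the group is abelian, so that `Φ(G)` consists of `ℓ`-th powers, and the image
of `θ` is torsion-free. -/
theorem IsAbelianOrientation.exists_pow_eq (hG : IsProL ℓ G) {θ : G →ₜ* ℤ_[ℓ]ˣ}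
    (hθ : IsTorsionFreeOrientation θ) (hab : IsAbelianOrientation θ) {d : G} (hd : d ∈ kernel θ)
    (hdΦ : d ∈ frattiniSubgroup G ℓ) : ∃ a ∈ kernel θ, a ^ ℓ = d := by
  have := hG.compact
  have := hG.t2
  set P : Subgroup G :=
    { carrier := {g | ∃ a ∈ kernel θ, a ^ ℓ = g}
      one_mem' := ⟨1, one_mem _, one_pow _⟩
      mul_mem' := by
        rintro _ _ ⟨a, ha, rfl⟩ ⟨b, hb, rfl⟩
        exact ⟨a * b, mul_mem ha hb, (hab.commute hG ha hb).mul_pow _⟩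
      inv_mem' := by
        rintro _ ⟨a, ha, rfl⟩
        exact ⟨a⁻¹, inv_mem ha, inv_pow _ _⟩ }
  have hPcl : IsClosed (P : Set G) := by
    have : (P : Set G) = (fun a => a ^ ℓ) '' (kernel θ : Set G) := rfl
    rw [this]
    exact ((isClosed_kernel θ).isCompact.image (continuous_pow ℓ)).isClosed
  have hPn : P.Normal := ⟨by
    rintro _ ⟨a, ha, rfl⟩ g
    exact ⟨g * a * g⁻¹, (normal_kernel θ).conj_mem a ha g, conj_pow⟩⟩
  have hcommP : ∀ g h : G, ⁅g, h⁆ ∈ P := by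
    intro g h
    obtain ⟨a, ha, hgh⟩ := hab.exists_commutator_eq_pow hG hθ g h
    obtain ⟨k, hk⟩ := dvd_powExp ℓ
    exact ⟨a ^ k, pow_mem ha k, by rw [hgh, hk, mul_comm, pow_mul]⟩
  have hcomm : ∀ g h : G, Commute (g : G ⧸ P) (h : G ⧸ P) := by
    intro g h
    rw [← commutatorElement_eq_one_iff_commute]
    exact (QuotientGroup.eq_one_iff _).2 (hcommP g h)
  set S : Subgroup G :=
    { carrier := {g | ∃ k : G, (k : G ⧸ P) ^ ℓ = g}
      one_mem' := ⟨1, by simp⟩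
      mul_mem' := by
        rintro a b ⟨k, hk⟩ ⟨m, hm⟩
        exact ⟨k * m, by rw [QuotientGroup.mk_mul, (hcomm k m).mul_pow, hk, hm]; rfl⟩
      inv_mem' := by
        rintro a ⟨k, hk⟩
        exact ⟨k⁻¹, by rw [QuotientGroup.mk_inv, inv_pow, hk]; rfl⟩ }
  have hScl : IsClosed (S : Set G) := by
    have h1 : (S : Set G) =
        (QuotientGroup.mk : G → G ⧸ P) ⁻¹' Set.range fun k : G => (k : G ⧸ P) ^ ℓ := rfl
    rw [h1]
    have := (hG.quotient hPcl).t2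
    have h2 : Continuous fun k : G => (k : G ⧸ P) ^ ℓ := by fun_prop
    exact (isCompact_range h2).isClosed.preimage QuotientGroup.continuous_mk
  obtain ⟨k, hk⟩ := mem_frattiniSubgroup_le (H := S) hScl (fun g => ⟨g, rfl⟩)
    (fun g h => ⟨1, by
      rw [QuotientGroup.mk_one, one_pow]
      exact ((QuotientGroup.eq_one_iff _).2 (hcommP g h)).symm⟩) hdΦ
  obtain ⟨a, ha, hak⟩ : (k ^ ℓ)⁻¹ * d ∈ P := QuotientGroup.eq.1 hk
  have hkd : k ^ ℓ * a ^ ℓ = d := by rw [hak, mul_inv_cancel_left]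
  have hkθ : k ∈ kernel θ := by
    refine mem_kernel_of_pow hG hθ ?_
    rw [eq_mul_inv_of_mul_eq hkd]
    exact mul_mem hd (inv_mem (pow_mem ha ℓ))
  exact ⟨k * a, mul_mem hkθ ha, by rw [(hab.commute hG hkθ ha).mul_pow, hkd]⟩

/-- A nontrivial element of a subgroup `A` is an `ℓ ^ k`-th power of an element of `A`
which is not an `ℓ`-th power in `A`. -/
theorem exists_pow_eq_not_pow (hG : IsProL ℓ G) (A : Subgroup G) {b : G} (hb : b ∈ A)
    (hb1 : b ≠ 1) : ∃ (k : ℕ) (d : G), d ∈ A ∧ d ^ ℓ ^ k = b ∧ ¬ ∃ a ∈ A, a ^ ℓ = d := by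
  by_contra! hcon
  have key : ∀ k : ℕ, ∃ d ∈ A, d ^ ℓ ^ k = b := by
    intro k
    induction k with
    | zero => exact ⟨b, hb, by simp⟩
    | succ k ih =>
      obtain ⟨d, hd, hdb⟩ := ih
      obtain ⟨a, ha, had⟩ := hcon k d hd hdb
      exact ⟨a, ha, by rw [pow_succ', pow_mul, had, hdb]⟩
  refine hb1 (hG.eq_one fun U => ?_)
  have := hG.compact
  have hfin : Finite (G ⧸ U.toSubgroup) :=
    Subgroup.quotient_finite_of_isOpen _ U.toOpenSubgroup.isOpen
  obtain ⟨k, hk⟩ := IsPGroup.iff_card.1 (hG.isPGroup_quotient U)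
  obtain ⟨d, -, rfl⟩ := key k
  rw [← QuotientGroup.eq_one_iff, QuotientGroup.mk_pow, ← hk, pow_card_eq_one']

/-! ### The subgroup `K_θ(G)` -/

theorem mul_conj_mem_kSubgroup (θ : G →ₜ* ℤ_[ℓ]ˣ) {h : G} (hh : h ∈ kernel θ) (g : G) :
    (h ^ₚ (θ g : ℤ_[ℓ]))⁻¹ * (g * h * g⁻¹) ∈ kSubgroup θ :=
  Subgroup.le_topologicalClosure _ (Subgroup.subset_closure ⟨g, h, hh, rfl⟩)

theorem isClosed_kSubgroup (θ : G →ₜ* ℤ_[ℓ]ˣ) : IsClosed (kSubgroup θ : Set G) :=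
  Subgroup.isClosed_topologicalClosure _

theorem kSubgroup_le {θ : G →ₜ* ℤ_[ℓ]ˣ} {H : Subgroup G} (hH : IsClosed (H : Set G))
    (h : ∀ g, ∀ h ∈ kernel θ, (h ^ₚ (θ g : ℤ_[ℓ]))⁻¹ * (g * h * g⁻¹) ∈ H) : kSubgroup θ ≤ H := by
  refine closure_le_of_isClosed hH ?_
  rintro _ ⟨g, k, hk, rfl⟩
  exact h g k hk

theorem kSubgroup_le_kernel (hG : IsProL ℓ G) (θ : G →ₜ* ℤ_[ℓ]ˣ) : kSubgroup θ ≤ kernel θ :=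
  kSubgroup_le (isClosed_kernel θ) fun g h hh =>
    mul_mem (inv_mem (padicPow_mem_of_isClosed hG (isClosed_kernel θ) hh _))
      ((normal_kernel θ).conj_mem h hh g)

theorem normal_kSubgroup (hG : IsProL ℓ G) (θ : G →ₜ* ℤ_[ℓ]ˣ) : (kSubgroup θ).Normal := by
  refine ⟨fun n hn a => ?_⟩
  refine kSubgroup_le (H := (kSubgroup θ).comap (MulAut.conj a).toMonoidHom) ?_ ?_ hn
  · refine (isClosed_kSubgroup θ).preimage ?_
    change Continuous fun x => a * x * a⁻¹
    fun_prop
  · intro g h hh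
    change a * ((h ^ₚ (θ g : ℤ_[ℓ]))⁻¹ * (g * h * g⁻¹)) * a⁻¹ ∈ kSubgroup θ
    have h1 := mul_conj_mem_kSubgroup θ ((normal_kernel θ).conj_mem h hh a) (a * g * a⁻¹)
    have h2 : θ (a * g * a⁻¹) = θ g := by
      rw [map_mul, map_mul, map_inv, mul_comm, inv_mul_cancel_left]
    rw [h2, ← conj_padicPow hG] at h1
    convert h1 using 1
    group

theorem kSubgroup_le_frattiniSubgroup (hG : IsProL ℓ G) {θ : G →ₜ* ℤ_[ℓ]ˣ}
    (hθ : IsTorsionFreeOrientation θ) : kSubgroup θ ≤ frattiniSubgroup G ℓ := by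
  refine kSubgroup_le isClosed_frattiniSubgroup fun g h _ => ?_
  obtain ⟨d, hd⟩ := (hθ.isPrincipal hG g).dvd
  have h1 : h ^ₚ (θ g : ℤ_[ℓ]) = h * (h ^ₚ d) ^ ℓ := by
    rw [← sub_add_cancel (θ g : ℤ_[ℓ]) 1, hd, add_comm, padicPow_add hG, padicPow_one hG,
      mul_comm, padicPow_mul_natCast hG]
  have h2 : (h ^ₚ (θ g : ℤ_[ℓ]))⁻¹ * (g * h * g⁻¹) = ((h ^ₚ d) ^ ℓ)⁻¹ * ⁅h⁻¹, g⁆ := by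
    rw [h1, commutatorElement_def]; group
  rw [h2]
  exact mul_mem (inv_mem (pow_mem_frattiniSubgroup _)) (commutator_mem_frattiniSubgroup _ _)

/-- An orientation `θ` with `K_θ(G) ⊆ N ⊆ ker θ` induces an orientation of `G / N`, which acts on
its kernel by powers. -/
theorem exists_descended_orientation (hG : IsProL ℓ G) {Q : Type*} [Group Q] [TopologicalSpace Q]
    [IsTopologicalGroup Q] (hQ : IsProL ℓ Q) {φ : G →ₜ* Q} (hφ : Function.Surjective φ)
    {θ : G →ₜ* ℤ_[ℓ]ˣ} (hθ : IsTorsionFreeOrientation θ) (h1 : kSubgroup θ ≤ kernel φ)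
    (h2 : kernel φ ≤ kernel θ) :
    ∃ η : Q →ₜ* ℤ_[ℓ]ˣ, (∀ g, η (φ g) = θ g) ∧ IsTorsionFreeOrientation η ∧
      IsAbelianOrientation η := by
  have := hG.compact
  have := hQ.t2
  set f := φ.toMonoidHom.liftOfSurjective hφ ⟨θ.toMonoidHom, h2⟩ with hf
  have hfφ : ∀ g, f (φ g) = θ g := fun g =>
    MonoidHom.liftOfRightInverse_comp_apply φ.toMonoidHom _ _ ⟨θ.toMonoidHom, h2⟩ g
  have hq : IsQuotientMap φ :=
    φ.continuous_toFun.isClosedMap.isQuotientMap φ.continuous_toFun hφ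
  have hcont : Continuous f := by
    rw [hq.continuous_iff]
    have : f ∘ φ = θ := funext hfφ
    rw [this]
    exact θ.continuous_toFun
  refine ⟨⟨f, hcont⟩, hfφ, fun hl q => ?_, fun h hh q => ?_⟩
  · obtain ⟨g, rfl⟩ := hφ q
    have := hθ hl g
    rwa [← hfφ] at this
  · obtain ⟨g, rfl⟩ := hφ q
    obtain ⟨h, rfl⟩ := hφ h
    have hh' : h ∈ kernel θ := (hfφ h).symm.trans hh
    have h3 := h1 (mul_conj_mem_kSubgroup θ hh' g)
    have h4 : φ ((h ^ₚ (θ g : ℤ_[ℓ]))⁻¹ * (g * h * g⁻¹)) = 1 := h3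
    have h5 : φ (h ^ₚ (θ g : ℤ_[ℓ])) = φ h ^ₚ (θ g : ℤ_[ℓ]) :=
      map_padicPow hG φ.toMonoidHom φ.continuous_toFun h _
    rw [map_mul, map_inv, inv_mul_eq_one, h5, map_mul, map_mul, map_inv] at h4
    rw [← h4, ← hfφ]
    rfl

end Orientations

/-! ### Homomorphisms to `ℤ/ℓ` and the Frattini subgroup -/

section Homs

variable {ℓ : ℕ} [hp : Fact ℓ.Prime] {G : Type*} [Group G] [TopologicalSpace G]
  [IsTopologicalGroup G]

theorem continuous_toZModPow (n : ℕ) :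
    Continuous (PadicInt.toZModPow n : ℤ_[ℓ] →+* ZMod (ℓ ^ n)) := by
  rw [continuous_iff_continuousAt]
  intro z
  refine tendsto_const_nhds.congr' ?_
  have hball : Metric.ball z ((ℓ : ℝ) ^ (-(n : ℤ))) ∈ 𝓝 z :=
    Metric.ball_mem_nhds _ (zpow_pos (by exact_mod_cast hp.out.pos) _)
  filter_upwards [hball] with w hw
  rw [eq_comm, ← sub_eq_zero, ← map_sub, ← RingHom.mem_ker, PadicInt.ker_toZModPow,
    ← PadicInt.norm_le_pow_iff_mem_span_pow, ← dist_eq_norm]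
  exact (Metric.mem_ball.1 hw).le

theorem map_padicPow_zmod (hG : IsProL ℓ G) {n : ℕ} {f : G → ZMod (ℓ ^ n)} (hf : Continuous f)
    {h : G} (hpow : ∀ m : ℕ, f (h ^ m) = m * f h) (z : ℤ_[ℓ]) :
    f (h ^ₚ z) = PadicInt.toZModPow n z * f h := by
  have h1 := hf.comp (continuous_padicPow hG h)
  have h2 : Continuous fun z : ℤ_[ℓ] => PadicInt.toZModPow n z * f h :=
    (continuous_of_discreteTopology (f := fun a : ZMod (ℓ ^ n) => a * f h)).comp
      (continuous_toZModPow n)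
  refine congr_fun (PadicInt.denseRange_natCast.equalizer h1 h2 (funext fun m => ?_)) z
  simp [padicPow_natCast hG, hpow]

theorem map_pow_of_additive {H : Type*} [Group H] {R : Type*} [Ring R] {f : H → R}
    (hf : ∀ a b, f (a * b) = f a + f b) (h : H) (m : ℕ) : f (h ^ m) = m * f h := by
  have h1 : f 1 = 0 := by simpa using hf 1 1
  induction m with
  | zero => simp [h1]
  | succ m ih => rw [pow_succ, hf, ih, Nat.cast_succ, add_mul, one_mul]

/-- An element outside the Frattini subgroup is detected by a homomorphism to `ℤ/ℓ`. -/
theorem exists_additive_ne_zero (hG : IsProL ℓ G) {d : G} (hd : d ∉ frattiniSubgroup G ℓ) :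
    ∃ χ : G → ZMod (ℓ ^ 1), Continuous χ ∧ (∀ g h, χ (g * h) = χ g + χ h) ∧ χ d ≠ 0 := by
  obtain ⟨U, hU⟩ : ∃ U : OpenNormalSubgroup G,
      ∀ s ∈ frattiniSubgroup G ℓ, s⁻¹ * d ∉ U.toSubgroup := by
    by_contra! hcon
    exact hd (hG.mem_of_isClosed isClosed_frattiniSubgroup hcon)
  set V := frattiniSubgroup G ℓ ⊔ U.toSubgroup with hV
  have hΦV : frattiniSubgroup G ℓ ≤ V := le_sup_left
  have hVn : V.Normal := ⟨fun n hn g => by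
    have : g * n * g⁻¹ = ⁅g, n⁆ * n := by rw [commutatorElement_def]; group
    rw [this]
    exact V.mul_mem (hΦV (commutator_mem_frattiniSubgroup _ _)) hn⟩
  have hVo : IsOpen (V : Set G) :=
    Subgroup.isOpen_mono (le_sup_right : U.toSubgroup ≤ V) U.toOpenSubgroup.isOpen
  have hdV : d ∉ V := by
    intro hdV
    rw [hV, ← SetLike.mem_coe, Subgroup.mul_normal] at hdV
    obtain ⟨s, hs, u, hu, rfl⟩ := Set.mem_mul.1 hdV
    exact hU s hs (by rwa [inv_mul_cancel_left])
  let _ : CommGroup (G ⧸ V) :=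
    { (inferInstance : Group (G ⧸ V)) with
      mul_comm := by
        rintro ⟨a⟩ ⟨b⟩
        change (a : G ⧸ V) * (b : G ⧸ V) = (b : G ⧸ V) * (a : G ⧸ V)
        rw [← commutatorElement_eq_one_iff_mul_comm]
        exact (QuotientGroup.eq_one_iff _).2 (hΦV (commutator_mem_frattiniSubgroup a b)) }
  let _ : Module (ZMod (ℓ ^ 1)) (Additive (G ⧸ V)) := AddCommGroup.zmodModule (by
    intro a
    obtain ⟨a, rfl⟩ := Additive.ofMul.surjective a
    obtain ⟨a, rfl⟩ := QuotientGroup.mk_surjective a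
    rw [pow_one, ← ofMul_pow, ← QuotientGroup.mk_pow,
      (QuotientGroup.eq_one_iff _).2 (hΦV (pow_mem_frattiniSubgroup a)), ofMul_one])
  have : Fact (ℓ ^ 1).Prime := ⟨by rw [pow_one]; exact hp.out⟩
  obtain ⟨f, hfadd, hf⟩ : ∃ f : G ⧸ V → ZMod (ℓ ^ 1), (∀ a b, f (a * b) = f a + f b) ∧
      f (d : G ⧸ V) ≠ 0 := by
    by_contra! hcon
    have := (Module.forall_dual_apply_eq_zero_iff (ZMod (ℓ ^ 1))
      (Additive.ofMul (d : G ⧸ V))).1 fun f =>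
        hcon (fun a => f (Additive.ofMul a)) fun a b => map_add f (Additive.ofMul a) _
    exact hdV ((QuotientGroup.eq_one_iff _).1 (ofMul_eq_zero.1 this))
  have : DiscreteTopology (G ⧸ V) := QuotientGroup.discreteTopology hVo
  exact ⟨fun g => f (g : G ⧸ V),
    (continuous_of_discreteTopology (f := f)).comp QuotientGroup.continuous_mk,
    fun g h => hfadd g h, hf⟩

theorem additive_eq_zero_of_mem_frattiniSubgroup {χ : G → ZMod (ℓ ^ 1)} (hχ : Continuous χ)
    (hadd : ∀ g h, χ (g * h) = χ g + χ h) {d : G} (hd : d ∈ frattiniSubgroup G ℓ) : χ d = 0 := by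
  have h1 : χ 1 = 0 := by simpa using hadd 1 1
  have hinv : ∀ g, χ g⁻¹ = -χ g := fun g => by
    have := hadd g g⁻¹
    rw [mul_inv_cancel, h1] at this
    exact (neg_eq_of_add_eq_zero_right this.symm).symm
  set K : Subgroup G :=
    { carrier := {g | χ g = 0}
      one_mem' := h1
      mul_mem' := fun {a b} (ha : χ a = 0) (hb : χ b = 0) => by
        change χ (a * b) = 0
        rw [hadd, ha, hb, add_zero]
      inv_mem' := fun {a} (ha : χ a = 0) => by
        change χ a⁻¹ = 0
        rw [hinv, ha, neg_zero] }
  have hK : IsClosed (K : Set G) := isClosed_singleton.preimage hχ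
  refine mem_frattiniSubgroup_le (H := K) hK (fun g => ?_) (fun g h => ?_) hd
  · change χ (g ^ ℓ) = 0
    have h2 : ((ℓ : ℕ) : ZMod (ℓ ^ 1)) = 0 := by
      rw [ZMod.natCast_eq_zero_iff, pow_one]
    rw [map_pow_of_additive hadd, h2, zero_mul]
  · change χ ⁅g, h⁆ = 0
    rw [commutatorElement_def, hadd, hadd, hadd, hinv, hinv]
    ring

/-- A Frattini cover of a topologically finitely generated group is topologically finitely
generated. -/
theorem IsTopFG.of_frattini_cover (hG : IsProL ℓ G) {Q : Type*} [Group Q] [TopologicalSpace Q]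
    [IsTopologicalGroup Q] (hQ : IsProL ℓ Q) {φ : G →ₜ* Q} (hφ : Function.Surjective φ)
    (hker : kernel φ ≤ frattiniSubgroup G ℓ) (hfg : IsTopFG Q) : IsTopFG G := by
  have := hG.compact
  have := hQ.t2
  obtain ⟨S, hS, hSQ⟩ := hfg
  obtain ⟨r, hr⟩ := hφ.hasRightInverse
  refine ⟨r '' S, hS.image r, ?_⟩
  set T := (Subgroup.closure (r '' S)).topologicalClosure with hT
  have hTcl : IsClosed (T : Set G) := Subgroup.isClosed_topologicalClosure _
  have hTQ : ∀ q, ∃ t ∈ T, φ t = q := by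
    have h1 : IsClosed ((T.map φ.toMonoidHom : Subgroup Q) : Set Q) :=
      (hTcl.isCompact.image φ.continuous_toFun).isClosed
    have h2 : (⊤ : Subgroup Q) ≤ T.map φ.toMonoidHom := by
      rw [← hSQ]
      refine closure_le_of_isClosed h1 fun s hs => ⟨r s, ?_, hr s⟩
      exact Subgroup.le_topologicalClosure _ (Subgroup.subset_closure ⟨s, hs, rfl⟩)
    exact fun q => h2 (Subgroup.mem_top q)
  rw [Subgroup.eq_top_iff']
  intro g
  refine hG.mem_of_isClosed hTcl fun U => ?_
  by_contra! hcon
  set f := QuotientGroup.mk' U.toSubgroup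
  have hfin : Finite (G ⧸ U.toSubgroup) :=
    Subgroup.quotient_finite_of_isOpen _ U.toOpenSubgroup.isOpen
  have hne : T.map f ≠ ⊤ := by
    intro htop
    obtain ⟨t, ht, htg⟩ : f g ∈ T.map f := htop ▸ Subgroup.mem_top _
    exact hcon t ht (QuotientGroup.eq.1 htg)
  obtain ⟨M, hM, hTM, hMp, hMc⟩ := exists_maximal_subgroup (hG.isPGroup_quotient U) hne
  refine hM ((Subgroup.eq_top_iff' M).2 fun a => ?_)
  obtain ⟨a, rfl⟩ := QuotientGroup.mk'_surjective _ a
  obtain ⟨t, ht, hta⟩ := hTQ (φ a)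
  have h1 : t⁻¹ * a ∈ frattiniSubgroup G ℓ := hker (by
    rw [mem_kernel, map_mul, map_inv, hta, inv_mul_cancel])
  have h2 : frattiniSubgroup G ℓ ≤ M.comap f := by
    refine mem_frattiniSubgroup_le (isClosed_comap_mk U M) (fun g => ?_) fun g h => ?_
    · rw [Subgroup.mem_comap, map_pow]
      exact hMp _
    · rw [Subgroup.mem_comap, map_commutatorElement]
      exact hMc _ _
  have h3 : f t * f (t⁻¹ * a) ∈ M := M.mul_mem (hTM ⟨t, ht, rfl⟩) (h2 h1)
  rwa [← map_mul, mul_inv_cancel_left] at h3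

theorem IsTopFG.image {Q : Type*} [Group Q] [TopologicalSpace Q]
    [IsTopologicalGroup Q] {φ : G →ₜ* Q} (hφ : Function.Surjective φ) (hfg : IsTopFG G) :
    IsTopFG Q := by
  obtain ⟨S, hS, hSG⟩ := hfg
  refine ⟨φ '' S, hS.image _, ?_⟩
  rw [Subgroup.eq_top_iff']
  intro q
  obtain ⟨g, rfl⟩ := hφ q
  have hg : g ∈ (Subgroup.closure S).topologicalClosure := hSG ▸ Subgroup.mem_top g
  refine closure_le_of_isClosed
    (H := ((Subgroup.closure (φ '' S)).topologicalClosure).comap φ.toMonoidHom)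
    ((Subgroup.isClosed_topologicalClosure _).preimage φ.continuous_toFun) ?_ hg
  exact fun s hs => Subgroup.le_topologicalClosure _ (Subgroup.subset_closure ⟨s, hs, rfl⟩)

theorem IsTopFG.of_closure (hG : IsProL ℓ G) {H : Subgroup G} (hH : IsClosed (H : Set G))
    {S : Set G} (hS : S.Finite) (hSH : (Subgroup.closure S).topologicalClosure = H) :
    IsTopFG H :=
  ⟨_, hS.preimage Subtype.val_injective.injOn, topologicalClosure_closure_preimage hG hH hSH⟩

theorem IsTopFG.exists_closure {H : Subgroup G} (hH : IsClosed (H : Set G))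
    (hfg : IsTopFG H) : ∃ S : Set G, S.Finite ∧ (Subgroup.closure S).topologicalClosure = H := by
  obtain ⟨S, hS, hSH⟩ := hfg
  set K := (Subgroup.closure (Subtype.val '' S)).topologicalClosure with hK
  have hKcl : IsClosed (K : Set G) := Subgroup.isClosed_topologicalClosure _
  refine ⟨Subtype.val '' S, hS.image _, le_antisymm ?_ fun h hh => ?_⟩
  · refine closure_le_of_isClosed hH ?_
    rintro _ ⟨s, -, rfl⟩
    exact s.2
  · have h1 : (⟨h, hh⟩ : H) ∈ (Subgroup.closure S).topologicalClosure := hSH ▸ Subgroup.mem_top _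
    refine closure_le_of_isClosed (H := K.comap H.subtype)
      (hKcl.preimage continuous_subtype_val) (fun s hs => ?_) h1
    exact Subgroup.le_topologicalClosure _ (Subgroup.subset_closure ⟨s, hs, rfl⟩)

end Homs

/-! ### Abelian pro-ℓ groups as `ℤ_ℓ`-modules -/

section Modules

variable {ℓ : ℕ} [hp : Fact ℓ.Prime] {A : Type*} [CommGroup A] [TopologicalSpace A]
  [IsTopologicalGroup A]

/-- The `ℤ_ℓ`-module structure of an abelian pro-`ℓ` group, written additively. -/
noncomputable abbrev padicModule (hA : IsProL ℓ A) : Module ℤ_[ℓ] (Additive A) where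
  smul z a := Additive.ofMul (a.toMul ^ₚ z)
  one_smul a := padicPow_one hA a.toMul
  mul_smul z w a := by
    change a.toMul ^ₚ (z * w) = (a.toMul ^ₚ w) ^ₚ z
    rw [mul_comm, padicPow_mul hA]
  smul_zero z := one_padicPow hA z
  smul_add z a b := by
    change (a.toMul * b.toMul) ^ₚ z = a.toMul ^ₚ z * b.toMul ^ₚ z
    exact mul_padicPow hA (Commute.all a.toMul b.toMul) z
  add_smul z w a := by
    change a.toMul ^ₚ (z + w) = a.toMul ^ₚ z * a.toMul ^ₚ w
    exact padicPow_add hA a.toMul z w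
  zero_smul a := by
    change a.toMul ^ₚ (0 : ℤ_[ℓ]) = 1
    exact padicPow_zero hA a.toMul

/-- The closed subgroup generated by a finite subset of an abelian pro-`ℓ` group consists of the
`ℤ_ℓ`-linear combinations. -/
theorem mem_closure_iff_mem_span (hA : IsProL ℓ A) {S : Set A} (hS : S.Finite) {a : A} :
    a ∈ (Subgroup.closure S).topologicalClosure ↔
      letI := padicModule hA
      Additive.ofMul a ∈ Submodule.span ℤ_[ℓ] (Additive.toMul ⁻¹' S) := by
  let _ := padicModule hA
  have := hA.t2
  have : Fintype S := hS.fintype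
  set M := Submodule.span ℤ_[ℓ] (Additive.toMul ⁻¹' S)
  have hmem : ∀ a : A, Additive.ofMul a ∈ M ↔
      ∃ z : S → ℤ_[ℓ], ∏ s : S, (s : A) ^ₚ z s = a := by
    intro a
    have : (Additive.toMul ⁻¹' S : Set (Additive A)) =
        Set.range fun s : S => Additive.ofMul (s : A) := by
      ext b
      exact ⟨fun hb => ⟨⟨_, hb⟩, rfl⟩, by rintro ⟨s, rfl⟩; exact s.2⟩
    change _ ∈ Submodule.span ℤ_[ℓ] (Additive.toMul ⁻¹' S) ↔ _
    rw [this, Submodule.mem_span_range_iff_exists_fun]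
    refine exists_congr fun z => ?_
    rw [← Additive.ofMul.apply_eq_iff_eq (x := ∏ s : S, (s : A) ^ₚ z s), ofMul_prod]
    rfl
  constructor
  · intro ha
    set T : Subgroup A :=
      { carrier := {a | Additive.ofMul a ∈ M}
        one_mem' := M.zero_mem
        mul_mem' := fun ha hb => M.add_mem ha hb
        inv_mem' := fun ha => M.neg_mem ha }
    have hT : IsClosed (T : Set A) := by
      have : (T : Set A) = Set.range fun z : S → ℤ_[ℓ] => ∏ s : S, (s : A) ^ₚ z s := by
        ext a
        exact hmem a
      rw [this]
      refine (isCompact_range (continuous_finsetProd _ fun s _ => ?_)).isClosed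
      exact (continuous_padicPow hA (s : A)).comp (continuous_apply s)
    have hST : ∀ s ∈ S, s ∈ T := fun s hs =>
      Submodule.subset_span (R := ℤ_[ℓ]) (M := Additive A) (s := Additive.toMul ⁻¹' S)
        (a := Additive.ofMul s) hs
    exact closure_le_of_isClosed (H := T) hT hST ha
  · intro ha
    obtain ⟨z, rfl⟩ := (hmem a).1 ha
    refine Subgroup.prod_mem _ fun s _ => ?_
    exact padicPow_mem_of_isClosed hA (Subgroup.isClosed_topologicalClosure _)
      (Subgroup.le_topologicalClosure _ (Subgroup.subset_closure s.2)) _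

theorem module_finite (hA : IsProL ℓ A) (hfg : IsTopFG A) :
    letI := padicModule hA
    Module.Finite ℤ_[ℓ] (Additive A) := by
  let _ := padicModule hA
  obtain ⟨S, hS, hSA⟩ := hfg
  have hS' : (Additive.toMul ⁻¹' S : Set (Additive A)).Finite :=
    hS.preimage Additive.toMul.injective.injOn
  refine ⟨⟨hS'.toFinset, ?_⟩⟩
  rw [hS'.coe_toFinset, Submodule.eq_top_iff']
  intro a
  exact (mem_closure_iff_mem_span hA hS (a := a.toMul)).1 (hSA ▸ Subgroup.mem_top _)

/-- Closed subgroups of topologically finitely generated abelian pro-`ℓ` groups are topologically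
finitely generated, since `ℤ_ℓ` is Noetherian. -/
theorem exists_closure_eq_of_comm (hA : IsProL ℓ A) (hfg : IsTopFG A) {B : Subgroup A}
    (hB : IsClosed (B : Set A)) :
    ∃ S : Set A, S.Finite ∧ (Subgroup.closure S).topologicalClosure = B := by
  let _ := padicModule hA
  have := module_finite hA hfg
  let M : Submodule ℤ_[ℓ] (Additive A) :=
    { carrier := {a | a.toMul ∈ B}
      zero_mem' := B.one_mem
      add_mem' := fun ha hb => B.mul_mem ha hb
      smul_mem' := fun z _ ha => padicPow_mem_of_isClosed hA hB ha z }
  obtain ⟨T, hT⟩ : M.FG := IsNoetherian.noetherian M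
  have hTf : (Additive.ofMul ⁻¹' (T : Set (Additive A)) : Set A).Finite :=
    T.finite_toSet.preimage Additive.ofMul.injective.injOn
  refine ⟨_, hTf, ?_⟩
  ext a
  rw [mem_closure_iff_mem_span hA hTf]
  change Additive.ofMul a ∈ Submodule.span ℤ_[ℓ] (T : Set (Additive A)) ↔ a ∈ B
  rw [hT]
  rfl

/-- A continuous homomorphism from a topologically finitely generated torsion-free abelian
pro-`ℓ` group to `ℤ/ℓ` lifts to `ℤ/ℓ^n`, since the group is a free `ℤ_ℓ`-module. -/
theorem exists_additive_lift (hA : IsProL ℓ A) (hfg : IsTopFG A)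
    (htf : ∀ a : A, IsOfFinOrder a → a = 1) {n : ℕ} (hn : 1 ≤ n) {χ : A → ZMod (ℓ ^ 1)}
    (hχ : Continuous χ) (hadd : ∀ a b, χ (a * b) = χ a + χ b) :
    ∃ f : A → ZMod (ℓ ^ n), Continuous f ∧ (∀ a b, f (a * b) = f a + f b) ∧
      ∀ a, reduction ℓ hn (f a) = χ a := by
  let _ := padicModule hA
  have := hA.t2
  have := module_finite hA hfg
  have : Module.IsTorsionFree ℤ_[ℓ] (Additive A) := by
    refine Module.IsTorsionFree.of_smul_eq_zero fun z a hza => ?_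
    refine or_iff_not_imp_left.2 fun hz => ?_
    exact congrArg Additive.ofMul (eq_one_of_padicPow_eq_one hA htf (h := a.toMul) hz hza)
  have hfree : Module.Free ℤ_[ℓ] (Additive A) := Module.free_of_finite_type_torsion_free'
  let b := Module.Free.chooseBasis ℤ_[ℓ] (Additive A)
  set ι := Module.Free.ChooseBasisIndex ℤ_[ℓ] (Additive A)
  -- the coordinates are continuous, since `A` is compact
  have hcont : Continuous fun z : ι → ℤ_[ℓ] => (b.equivFun.symm z).toMul := by
    have : (fun z : ι → ℤ_[ℓ] => (b.equivFun.symm z).toMul) =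
        fun z => ∏ i, (b i).toMul ^ₚ z i := by
      ext z
      rw [Module.Basis.equivFun_symm_apply, toMul_sum]
      rfl
    rw [this]
    exact continuous_finsetProd _ fun i _ =>
      (continuous_padicPow hA _).comp (continuous_apply i)
  let e : (ι → ℤ_[ℓ]) ≃ A := b.equivFun.symm.toEquiv.trans Additive.toMul
  have hinv : Continuous fun a : A => b.equivFun (Additive.ofMul a) :=
    (Continuous.homeoOfEquivCompactToT2 (f := e) hcont).symm.continuous
  have hcoord : ∀ i, Continuous fun a : A => b.equivFun (Additive.ofMul a) i := fun i =>
    (continuous_apply i).comp hinv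
  have hsurj : Function.Surjective (reduction ℓ hn) := ZMod.castHom_surjective _
  choose x hx using fun i => hsurj (χ (b i).toMul)
  refine ⟨fun a => ∑ i, PadicInt.toZModPow n (b.equivFun (Additive.ofMul a) i) * x i, ?_, ?_, ?_⟩
  · refine continuous_finsetSum _ fun i _ => ?_
    exact (continuous_of_discreteTopology (f := fun y : ZMod (ℓ ^ n) => y * x i)).comp
      ((continuous_toZModPow n).comp (hcoord i))
  · intro a c
    simp only [ofMul_mul, map_add, Pi.add_apply, add_mul, Finset.sum_add_distrib]
  · intro a
    have h1 : a = ∏ i, (b i).toMul ^ₚ (b.equivFun (Additive.ofMul a) i) := by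
      have := b.sum_equivFun (Additive.ofMul a)
      have := congrArg Additive.toMul this
      rw [toMul_sum] at this
      exact this.symm
    have h2 : ∀ (s : Finset ι) (y : ι → A), χ (∏ i ∈ s, y i) = ∑ i ∈ s, χ (y i) := by
      intro s y
      have h0 : χ 1 = 0 := by simpa using hadd 1 1
      classical
      induction s using Finset.induction_on with
      | empty => simp [h0]
      | insert i s hi ih => rw [Finset.prod_insert hi, Finset.sum_insert hi, hadd, ih]
    conv_rhs => rw [h1, h2]
    rw [map_sum]
    refine Finset.sum_congr rfl fun i _ => ?_
    rw [map_mul, hx, map_padicPow_zmod hA hχ (map_pow_of_additive hadd _)]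
    congr 1
    exact PadicInt.cast_toZModPow 1 n hn _

/-- The variant of `exists_closure_eq_of_comm` with commutativity as a hypothesis. -/
theorem exists_closure_eq_of_mul_comm {A : Type*} [Group A] [TopologicalSpace A]
    [IsTopologicalGroup A] (hcomm : ∀ a b : A, a * b = b * a) (hA : IsProL ℓ A)
    (hfg : IsTopFG A) {B : Subgroup A} (hB : IsClosed (B : Set A)) :
    ∃ S : Set A, S.Finite ∧ (Subgroup.closure S).topologicalClosure = B :=
  @exists_closure_eq_of_comm ℓ _ A (CommGroup.mk hcomm) _ _ hA hfg B hB

/-- The variant of `exists_additive_lift` with commutativity as a hypothesis. -/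
theorem exists_additive_lift_of_mul_comm {A : Type*} [Group A] [TopologicalSpace A]
    [IsTopologicalGroup A] (hcomm : ∀ a b : A, a * b = b * a) (hA : IsProL ℓ A) (hfg : IsTopFG A)
    (htf : ∀ a : A, IsOfFinOrder a → a = 1) {n : ℕ} (hn : 1 ≤ n) {χ : A → ZMod (ℓ ^ 1)}
    (hχ : Continuous χ) (hadd : ∀ a b, χ (a * b) = χ a + χ b) :
    ∃ f : A → ZMod (ℓ ^ n), Continuous f ∧ (∀ a b, f (a * b) = f a + f b) ∧
      ∀ a, reduction ℓ hn (f a) = χ a :=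
  @exists_additive_lift ℓ _ A (CommGroup.mk hcomm) _ _ hA hfg htf n hn χ hχ hadd

end Modules

/-! ### Lifting classes for groups acted on through an orientation -/

section Lifting

variable {ℓ : ℕ} [hp : Fact ℓ.Prime] {G : Type*} [Group G] [TopologicalSpace G]
  [IsTopologicalGroup G]

theorem IsTorsionFreeOrientation.twist_one (hG : IsProL ℓ G) {θ : G →ₜ* ℤ_[ℓ]ˣ}
    (hθ : IsTorsionFreeOrientation θ) (g : G) : twist θ 1 g = 1 := by
  rw [twist, ← sub_eq_zero, ← map_one (PadicInt.toZModPow 1 : ℤ_[ℓ] →+* ZMod (ℓ ^ 1)), ← map_sub,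
    ← RingHom.mem_ker, PadicInt.ker_toZModPow, Ideal.mem_span_singleton, pow_one]
  exact (hθ.isPrincipal hG g).dvd

/-- If `G` acts on `ker θ` through `θ`, every homomorphism to `ℤ/ℓ` lifts to a cocycle with values
in `ℤ_ℓ(1)/ℓ^n`. Writing `G` as the semidirect product of `ker θ` and the procyclic group
generated by some `x`, the cocycle is the sum of a lift on `ker θ` and of a multiple of the
cocycle `g ↦ (θ(g) - 1) / (θ(x) - 1)`. -/
theorem IsAbelianOrientation.exists_cocycle (hG : IsProL ℓ G) {θ : G →ₜ* ℤ_[ℓ]ˣ}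
    (hθ : IsTorsionFreeOrientation θ) (hab : IsAbelianOrientation θ)
    (htf : ∀ g : G, IsOfFinOrder g → g = 1) (hfg : IsTopFG (kernel θ)) {n : ℕ} (hn : 1 ≤ n)
    {χ : G → ZMod (ℓ ^ 1)} (hχ : Continuous χ) (hadd : ∀ g h, χ (g * h) = χ g + χ h) :
    ∃ c ∈ cocycles θ n, ∀ g, reduction ℓ hn (c g) = χ g := by
  have := hG.compact
  have := hG.t2
  have hA : IsProL ℓ (kernel θ) := hG.subgroup (isClosed_kernel θ)
  have htfA : ∀ a : kernel θ, IsOfFinOrder a → a = 1 := fun a ha =>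
    Subtype.ext (htf a ((kernel θ).subtype.isOfFinOrder ha))
  obtain ⟨f, hfc, hfadd, hfχ⟩ := exists_additive_lift_of_mul_comm
    (fun a b : kernel θ => Subtype.ext (hab.commute hG a.2 b.2).eq) hA hfg htfA hn
    (χ := fun a => χ a) (hχ.comp continuous_subtype_val) (fun a b => hadd a b)
  obtain ⟨x, hx, hz⟩ := exists_generator hG hθ
  by_cases hx1 : θ x = 1
  · have htriv : ∀ g, θ g = 1 := fun g => by
      have := hx g
      rw [hx1, Units.val_one, sub_self, zero_dvd_iff, sub_eq_zero] at this
      exact Units.ext this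
    refine ⟨fun g => f ⟨g, htriv g⟩, ⟨hfc.comp (by fun_prop), fun g h => ?_⟩, fun g => hfχ _⟩
    rw [twist, htriv g, Units.val_one, map_one, one_mul, ← hfadd]
    rfl
  choose z hz using hz
  have hθz : ∀ g, θ (x ^ₚ z g) = θ g := fun g => by
    have := mem_kernel.1 (hz g)
    rw [map_mul, map_inv, mul_inv_eq_one] at this
    exact this.symm
  have hinj : Function.Injective fun w : ℤ_[ℓ] => (θ (x ^ₚ w) : ℤ_[ℓ]) := by
    intro w v hwv
    by_contra hne
    refine hx1 (eq_one_of_map_padicPow hG hθ (sub_ne_zero.2 hne) ?_)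
    rw [padicPow_sub hG, mem_kernel, map_mul, map_inv, mul_inv_eq_one]
    exact Units.ext hwv
  have hzc : Continuous z := by
    have hF : Continuous fun w : ℤ_[ℓ] => (θ (x ^ₚ w) : ℤ_[ℓ]) :=
      (continuous_coe_orientation θ).comp (continuous_padicPow hG x)
    rw [(hF.isClosedEmbedding hinj).isEmbedding.continuous_iff]
    exact (continuous_coe_orientation θ).congr fun g => by
      simp only [Function.comp_apply, hθz]
  have hzadd : ∀ g h, z (g * h) = z g + z h := fun g h => hinj (by
    simp only [hθz, padicPow_add hG, map_mul])
  let a : G → kernel θ := fun g => ⟨g * (x ^ₚ z g)⁻¹, hz g⟩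
  have hac : Continuous a :=
    (continuous_id.mul ((continuous_padicPow hG x).comp hzc).inv).subtype_mk _
  have haadd : ∀ g h, a (g * h) = (a h) ^ₚ (θ g : ℤ_[ℓ]) * a g := fun g h => Subtype.ext (by
    rw [Subgroup.coe_mul, coe_padicPow hG (isClosed_kernel θ), ← hab _ (a h).2 g]
    simp only [a, hzadd, padicPow_add hG]
    group)
  have he : ∀ g, ∃ e, (θ g : ℤ_[ℓ]) - 1 = (θ x - 1 : ℤ_[ℓ]) * e := hx
  choose e he using he
  have hx0 : (θ x - 1 : ℤ_[ℓ]) ≠ 0 := fun h => hx1 (Units.ext (sub_eq_zero.1 h))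
  have hec : Continuous e := by
    have hE : Continuous fun w : ℤ_[ℓ] => (θ x - 1 : ℤ_[ℓ]) * w := by fun_prop
    rw [(hE.isClosedEmbedding (mul_right_injective₀ hx0)).isEmbedding.continuous_iff]
    exact ((continuous_coe_orientation θ).sub continuous_const).congr he
  have headd : ∀ g h, e (g * h) = e g + θ g * e h := fun g h => by
    refine mul_left_cancel₀ hx0 ?_
    rw [← he, mul_add, ← he, mul_left_comm, ← he, map_mul, Units.val_mul]
    ring
  have hex : e x = 1 := mul_left_cancel₀ hx0 (by rw [← he, mul_one])
  have heker : ∀ b ∈ kernel θ, e b = 0 := fun b hb => mul_left_cancel₀ hx0 (by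
    rw [← he, mem_kernel.1 hb, Units.val_one, sub_self, mul_zero])
  -- modulo `ℓ`, the cocycle `e` is the homomorphism `z`
  have hez : ∀ g, PadicInt.toZModPow 1 (e g) = PadicInt.toZModPow 1 (z g) := fun g => by
    have hmul : ∀ g h, PadicInt.toZModPow 1 (e (g * h)) =
        PadicInt.toZModPow 1 (e g) + PadicInt.toZModPow 1 (e h) := fun g h => by
      have := hθ.twist_one hG g
      rw [twist] at this
      rw [headd, map_add, map_mul, this, one_mul]
    have h1 := map_padicPow_zmod hG ((continuous_toZModPow 1).comp hec)
      (map_pow_of_additive hmul x) (z g)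
    simp only [Function.comp_apply, hex, map_one, mul_one] at h1
    have h2 := hmul (a g) (x ^ₚ z g)
    rw [heker _ (a g).2, map_zero, zero_add, h1] at h2
    rw [← h2]
    simp only [a, inv_mul_cancel_right]
  obtain ⟨t, ht⟩ : ∃ t, reduction ℓ hn t = χ x := ZMod.castHom_surjective _ _
  refine ⟨fun g => f (a g) + PadicInt.toZModPow n (e g) * t, ⟨?_, fun g h => ?_⟩, fun g => ?_⟩
  · exact (hfc.comp hac).add ((continuous_of_discreteTopology
      (f := fun y : ZMod (ℓ ^ n) => y * t)).comp ((continuous_toZModPow n).comp hec))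
  · have h1 := map_padicPow_zmod hA hfc (map_pow_of_additive hfadd (a h)) (θ g : ℤ_[ℓ])
    simp only [haadd, hfadd, h1, headd, map_add, map_mul, twist]
    ring
  · have h1 := map_padicPow_zmod hG hχ (map_pow_of_additive hadd x) (z g)
    have h2 := hadd (a g) (x ^ₚ z g)
    have h3 : (a g : G) * x ^ₚ z g = g := by simp only [a, inv_mul_cancel_right]
    have h4 : reduction ℓ hn (PadicInt.toZModPow n (e g)) = PadicInt.toZModPow 1 (e g) :=
      PadicInt.cast_toZModPow 1 n hn _
    rw [h3, h1] at h2
    rw [map_add, map_mul, hfχ, ht, h4, hez, h2]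

end Lifting

/-! ### Local uniformity from an orientation -/

section LocallyUniform

variable {ℓ : ℕ} [hp : Fact ℓ.Prime] {G : Type*} [Group G] [TopologicalSpace G]
  [IsTopologicalGroup G]

theorem IsTopFG.of_kernel (hG : IsProL ℓ G) {θ : G →ₜ* ℤ_[ℓ]ˣ}
    (hθ : IsTorsionFreeOrientation θ) (hfg : IsTopFG (kernel θ)) : IsTopFG G := by
  obtain ⟨T, hT, hTk⟩ := hfg.exists_closure (isClosed_kernel θ)
  obtain ⟨x, -, hx⟩ := exists_generator hG hθ
  refine ⟨insert x T, hT.insert x, Subgroup.eq_top_iff' _ |>.2 fun g => ?_⟩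
  obtain ⟨z, hz⟩ := hx g
  rw [← inv_mul_cancel_right g (x ^ₚ z)]
  refine mul_mem ?_ ?_
  · rw [← hTk] at hz
    exact Subgroup.topologicalClosure_mono (Subgroup.closure_mono (Set.subset_insert x T)) hz
  · exact padicPow_mem_of_isClosed hG (Subgroup.isClosed_topologicalClosure _)
      (Subgroup.le_topologicalClosure _ (Subgroup.subset_closure (Set.mem_insert x T))) z

/-- The kernel is generated by the components in `ker θ` of generators of `G`: the closed subgroup
they generate is normal, and a complement to it is procyclic and meets `ker θ` trivially. -/
theorem IsAbelianOrientation.isTopFG_kernel (hG : IsProL ℓ G) {θ : G →ₜ* ℤ_[ℓ]ˣ}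
    (hθ : IsTorsionFreeOrientation θ) (hab : IsAbelianOrientation θ) (hfg : IsTopFG G) :
    IsTopFG (kernel θ) := by
  obtain ⟨S, hS, hSG⟩ := hfg
  obtain ⟨x, hx, hz⟩ := exists_generator hG hθ
  by_cases hx1 : θ x = 1
  · refine IsTopFG.of_closure hG (isClosed_kernel θ) hS ?_
    rw [hSG, eq_comm, Subgroup.eq_top_iff']
    intro g
    have := hx g
    rw [hx1, Units.val_one, sub_self, zero_dvd_iff, sub_eq_zero] at this
    exact Units.ext this
  choose z hz using hz
  set T : Set G := (fun s => s * (x ^ₚ z s)⁻¹) '' S with hT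
  set M := (Subgroup.closure T).topologicalClosure with hM
  have hMc : IsClosed (M : Set G) := Subgroup.isClosed_topologicalClosure _
  have hMk : M ≤ kernel θ := by
    refine closure_le_of_isClosed (isClosed_kernel θ) ?_
    rintro _ ⟨s, -, rfl⟩
    exact hz s
  have hMn : M.Normal := ⟨fun m hm g => by
    rw [hab m (hMk hm) g]
    exact padicPow_mem_of_isClosed hG hMc hm _⟩
  refine IsTopFG.of_closure hG (isClosed_kernel θ) (hS.image _)
    (le_antisymm hMk fun b hb => ?_)
  have htop : procyclic hG x ⊔ M = ⊤ := by
    rw [eq_top_iff, ← hSG]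
    refine closure_le_of_isClosed (isClosed_sup hG (isClosed_procyclic hG x) hMc) fun s hs => ?_
    rw [← inv_mul_cancel_right s (x ^ₚ z s)]
    exact mul_mem (Subgroup.mem_sup_right (Subgroup.le_topologicalClosure _
      (Subgroup.subset_closure ⟨s, hs, rfl⟩)))
      (Subgroup.mem_sup_left ((mem_procyclic hG).2 ⟨_, rfl⟩))
  obtain ⟨y, hy, m, hm, rfl⟩ := Subgroup.mem_sup_of_normal_right.1 (htop ▸ Subgroup.mem_top b)
  obtain ⟨w, rfl⟩ := (mem_procyclic hG).1 hy
  have hw : w = 0 := by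
    by_contra hw
    exact hx1 (eq_one_of_map_padicPow hG hθ hw ((Subgroup.mul_mem_cancel_right _ (hMk hm)).1 hb))
  rw [hw, padicPow_zero hG, one_mul]
  exact hm

/-- A topologically finitely generated torsion-free group that acts on the kernel of an orientation
through that orientation is locally uniform. -/
theorem IsAbelianOrientation.isLocallyUniform (hG : IsProL ℓ G) {θ : G →ₜ* ℤ_[ℓ]ˣ}
    (hθ : IsTorsionFreeOrientation θ) (hab : IsAbelianOrientation θ)
    (htf : ∀ g : G, IsOfFinOrder g → g = 1) (hfg : IsTopFG G) : IsLocallyUniform G ℓ := by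
  intro H hH
  have hHL := hG.subgroup hH
  set η : H →ₜ* ℤ_[ℓ]ˣ := θ.comp ⟨H.subtype, continuous_subtype_val⟩ with hη
  have hηθ : IsTorsionFreeOrientation η := fun hl g => hθ hl g
  have hηab : IsAbelianOrientation η := fun h hh g => Subtype.ext (by
    rw [coe_padicPow hG hH]
    exact hab h hh g)
  refine ⟨?_, IsTopFG.of_kernel hHL hηθ ?_, fun h hh =>
    Subtype.ext (htf h (H.subtype.isOfFinOrder hh))⟩
  · refine Subgroup.topologicalClosure_minimal _ ?_ (Subgroup.isClosed_topologicalClosure _)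
    rw [commutator_def, Subgroup.commutator_le]
    rintro g - h -
    obtain ⟨a, -, ha⟩ := hηab.exists_commutator_eq_pow hHL hηθ g h
    rw [ha]
    exact Subgroup.le_topologicalClosure _ (Subgroup.subset_closure ⟨a, rfl⟩)
  · have hA := hG.subgroup (isClosed_kernel θ)
    set B : Subgroup (kernel θ) := H.subgroupOf (kernel θ) with hB
    have hBc : IsClosed (B : Set (kernel θ)) := hH.preimage continuous_subtype_val
    obtain ⟨S, hS, hSB⟩ := exists_closure_eq_of_mul_comm
      (fun a b : kernel θ => Subtype.ext (hab.commute hG a.2 b.2).eq) hA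
      (hab.isTopFG_kernel hG hθ hfg) hBc
    let ψ : B →ₜ* kernel η :=
      { toFun := fun b => ⟨⟨b.1.1, b.2⟩, b.1.2⟩
        map_one' := rfl
        map_mul' := fun _ _ => rfl
        continuous_toFun := by fun_prop }
    exact IsTopFG.image (φ := ψ) (fun h => ⟨⟨⟨h.1.1, h.2⟩, h.1.2⟩, rfl⟩)
      (IsTopFG.of_closure hA hBc hS hSB)

end LocallyUniform

/-! ### Kummerian orientations and Frattini covers -/

section Kummerian

variable {ℓ : ℕ} [hp : Fact ℓ.Prime] {G : Type*} [Group G] [TopologicalSpace G]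
  [IsTopologicalGroup G]

/-- Being Kummerian in terms of cocycles: modulo `ℓ` there are no non-zero coboundaries. -/
theorem isKummerian_iff (hG : IsProL ℓ G) {θ : G →ₜ* ℤ_[ℓ]ˣ} (hθ : IsTorsionFreeOrientation θ) :
    IsKummerian θ ↔ ∀ (n : ℕ) (hn : 1 ≤ n) (χ : G → ZMod (ℓ ^ 1)), Continuous χ →
      (∀ g h, χ (g * h) = χ g + χ h) → ∃ c ∈ cocycles θ n, ∀ g, reduction ℓ hn (c g) = χ g := by
  refine forall₂_congr fun n hn => ⟨fun hK χ hχ hadd => ?_, fun hK => ?_⟩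
  · obtain ⟨⟨c⟩, hc⟩ := hK (QuotientAddGroup.mk
      ⟨χ, hχ, fun g h => by rw [hθ.twist_one hG, one_mul, hadd]⟩)
    obtain ⟨m, hm⟩ := QuotientAddGroup.eq.1 hc
    refine ⟨c.1, c.2, fun g => ?_⟩
    have h1 := hm g
    rw [hθ.twist_one hG, one_mul, sub_self] at h1
    exact (neg_add_eq_zero.1 h1)
  · rintro ⟨χ⟩
    obtain ⟨c, hc, hcχ⟩ := hK χ.1 χ.2.1 fun g h => by
      rw [χ.2.2, hθ.twist_one hG, one_mul]
    exact ⟨QuotientAddGroup.mk ⟨c, hc⟩,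
      congrArg QuotientAddGroup.mk (Subtype.ext (funext hcχ))⟩

theorem IsProL.isQuotientMap (hG : IsProL ℓ G) {Q : Type*} [Group Q] [TopologicalSpace Q]
    [IsTopologicalGroup Q] (hQ : IsProL ℓ Q) {φ : G →ₜ* Q} (hφ : Function.Surjective φ) :
    IsQuotientMap φ := by
  have := hG.compact
  have := hQ.t2
  exact φ.continuous_toFun.isClosedMap.isQuotientMap φ.continuous_toFun hφ

/-- Homomorphisms to `ℤ/ℓ` factor through Frattini covers, so that the lifting property passes
from the quotient to the cover. -/
theorem isKummerian_of_frattini_cover (hG : IsProL ℓ G) {Q : Type*} [Group Q]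
    [TopologicalSpace Q] [IsTopologicalGroup Q] (hQ : IsProL ℓ Q) {φ : G →ₜ* Q}
    (hφ : Function.Surjective φ) (hker : kernel φ ≤ frattiniSubgroup G ℓ)
    {θ : G →ₜ* ℤ_[ℓ]ˣ} (hθ : IsTorsionFreeOrientation θ) {η : Q →ₜ* ℤ_[ℓ]ˣ}
    (hη : ∀ g, η (φ g) = θ g) (hηK : IsKummerian η) : IsKummerian θ := by
  have hηθ : IsTorsionFreeOrientation η := fun hl q => by
    obtain ⟨g, rfl⟩ := hφ q
    rw [hη]
    exact hθ hl g
  rw [isKummerian_iff hG hθ]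
  intro n hn χ hχ hadd
  obtain ⟨r, hr⟩ := hφ.hasRightInverse
  have hχr : ∀ g, χ (r (φ g)) = χ g := fun g => by
    have h1 : g⁻¹ * r (φ g) ∈ kernel φ := by
      rw [mem_kernel, map_mul, map_inv, hr, inv_mul_cancel]
    have h2 := hadd g (g⁻¹ * r (φ g))
    rw [additive_eq_zero_of_mem_frattiniSubgroup hχ hadd (hker h1), mul_inv_cancel_left,
      add_zero] at h2
    exact h2
  have hχrc : Continuous fun q => χ (r q) := by
    rw [(hG.isQuotientMap hQ hφ).continuous_iff]
    exact hχ.congr fun g => (hχr g).symm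
  obtain ⟨c, ⟨hc, hcadd⟩, hcχ⟩ := (isKummerian_iff hQ hηθ).1 hηK n hn (fun q => χ (r q)) hχrc
    fun p q => by
      obtain ⟨g, rfl⟩ := hφ p
      obtain ⟨h, rfl⟩ := hφ q
      rw [← map_mul, hχr, hχr, hχr, hadd]
  refine ⟨fun g => c (φ g), ⟨hc.comp φ.continuous_toFun, fun g h => ?_⟩, fun g => ?_⟩
  · simp only [map_mul, hcadd, twist, hη]
  · rw [hcχ, hχr]

theorem exists_quotient_kSubgroup (hG : IsProL ℓ G) {θ : G →ₜ* ℤ_[ℓ]ˣ} :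
    ∃ (_ : (kSubgroup θ).Normal) (π : G →ₜ* G ⧸ kSubgroup θ), IsProL ℓ (G ⧸ kSubgroup θ) ∧
      Function.Surjective π ∧ kernel π = kSubgroup θ := by
  have hn := normal_kSubgroup hG θ
  exact ⟨hn, ⟨QuotientGroup.mk' _, continuous_quotient_mk'⟩, hG.quotient (isClosed_kSubgroup θ),
    QuotientGroup.mk'_surjective _, QuotientGroup.ker_mk' _⟩

/-- A Frattini quotient by a subgroup of `ker θ` containing `K_θ(G)` is torsion-free only if the
subgroup is `K_θ(G)`: in `G / K_θ(G)` an element that is not an `ℓ`-th power in the kernel of the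
orientation does not lie in the Frattini subgroup. -/
theorem kernel_le_kSubgroup (hG : IsProL ℓ G) {Q : Type*} [Group Q]
    [TopologicalSpace Q] [IsTopologicalGroup Q] {φ : G →ₜ* Q}
    (hker : kernel φ ≤ frattiniSubgroup G ℓ) (htf : ∀ q : Q, IsOfFinOrder q → q = 1)
    {θ : G →ₜ* ℤ_[ℓ]ˣ} (hθ : IsTorsionFreeOrientation θ) (h1 : kSubgroup θ ≤ kernel φ)
    (h2 : kernel φ ≤ kernel θ) : kernel φ ≤ kSubgroup θ := by
  intro b hb
  obtain ⟨_, π, hK, hπ, hπk⟩ := exists_quotient_kSubgroup hG (θ := θ)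
  obtain ⟨ζ, hζπ, hζ, hab⟩ := exists_descended_orientation hG hK hπ hθ hπk.ge
    (hπk.le.trans (kSubgroup_le_kernel hG θ))
  by_contra hbK
  have hb1 : π b ≠ 1 := fun h => hbK (hπk ▸ h)
  obtain ⟨k, d, hd, hdb, hnot⟩ := exists_pow_eq_not_pow hK (kernel ζ) (b := π b)
    ((hζπ b).trans (h2 hb)) hb1
  obtain ⟨d, rfl⟩ := hπ d
  have h3 : φ d ^ ℓ ^ k = 1 := by
    have h4 : d ^ ℓ ^ k * b⁻¹ ∈ kernel π := by
      rw [mem_kernel, map_mul, map_inv, map_pow, hdb, mul_inv_cancel]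
    have h5 := mem_kernel.1 (h1 (hπk ▸ h4))
    rwa [map_mul, map_inv, mem_kernel.1 hb, inv_one, mul_one, map_pow] at h5
  have h6 : φ d = 1 := htf _ (isOfFinOrder_iff_pow_eq_one.2 ⟨_, pow_pos hp.out.pos k, h3⟩)
  exact hnot (hab.exists_pow_eq hK hζ hd
    (map_mem_frattiniSubgroup π.toMonoidHom π.continuous_toFun (hker h6)))

theorem reduction_eq_zero_of_pow_mul {k : ℕ} (hk : 1 ≤ k + 2) {y : ZMod (ℓ ^ (k + 2))}
    (h : ((ℓ ^ (k + 1) : ℕ) : ZMod (ℓ ^ (k + 2))) * y = 0) : reduction ℓ hk y = 0 := by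
  obtain ⟨m, rfl⟩ := ZMod.natCast_zmod_surjective y
  rw [← Nat.cast_mul, ZMod.natCast_eq_zero_iff, pow_succ ℓ (k + 1)] at h
  have h1 := Nat.dvd_of_mul_dvd_mul_left (pow_pos hp.out.pos _) h
  rw [map_natCast, ZMod.natCast_eq_zero_iff, pow_one]
  exact h1

/-- A cocycle vanishes on `K_θ(G)`. -/
theorem cocycle_eq_zero_of_mem_kSubgroup (hG : IsProL ℓ G) {θ : G →ₜ* ℤ_[ℓ]ˣ} {n : ℕ}
    {c : G → ZMod (ℓ ^ n)} (hc : c ∈ cocycles θ n) {g : G} (hg : g ∈ kSubgroup θ) : c g = 0 := by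
  obtain ⟨hcc, hcadd⟩ := hc
  have h1 : c 1 = 0 := by
    have := hcadd 1 1
    simpa [twist] using this
  have hker : ∀ a ∈ kernel θ, ∀ b, c (a * b) = c a + c b := fun a ha b => by
    rw [hcadd, twist, mem_kernel.1 ha, Units.val_one, map_one, one_mul]
  set H : Subgroup G :=
    { carrier := {g | g ∈ kernel θ ∧ c g = 0}
      one_mem' := ⟨one_mem _, h1⟩
      mul_mem' := fun {a b} ha hb =>
        ⟨mul_mem ha.1 hb.1, by rw [hker a ha.1, ha.2, hb.2, add_zero]⟩
      inv_mem' := fun {a} ha => ⟨inv_mem ha.1, by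
        have := hker a ha.1 a⁻¹
        rwa [mul_inv_cancel, h1, ha.2, zero_add, eq_comm] at this⟩ }
  have hH : IsClosed (H : Set G) :=
    (isClosed_kernel θ).inter (isClosed_singleton.preimage hcc)
  refine (kSubgroup_le (H := H) hH (fun g h hh => ⟨?_, ?_⟩) hg).2
  · exact kSubgroup_le_kernel hG θ (mul_conj_mem_kSubgroup θ hh g)
  · have hp : h ^ₚ (θ g : ℤ_[ℓ]) ∈ kernel θ := padicPow_mem_of_isClosed hG (isClosed_kernel θ) hh _
    have h2 : c (h ^ₚ (θ g : ℤ_[ℓ])) = twist θ n g * c h := by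
      refine map_padicPow_zmod hG hcc (fun m => ?_) _
      exact map_pow_of_additive (f := fun a : kernel θ => c a) (fun a b => hker a a.2 b) ⟨h, hh⟩ m
    have h3 : c (g * h * g⁻¹) = twist θ n g * c h := by
      have h4 := hcadd g g⁻¹
      rw [mul_inv_cancel, h1] at h4
      rw [mul_assoc, hcadd, hker h hh, mul_add, add_left_comm, ← h4, add_zero]
    have h5 := hker _ hp ((h ^ₚ (θ g : ℤ_[ℓ]))⁻¹ * (g * h * g⁻¹))
    rw [mul_inv_cancel_left, h2, h3] at h5
    exact (left_eq_add.1 h5)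

/-- If `(G, θ)` is Kummerian then `G / K_θ(G)` is torsion-free. An element of order `ℓ` would be
`d ^ ℓ ^ k` for some `d` that is detected by a homomorphism `χ` to `ℤ/ℓ`; as a cocycle that
lifts `χ` modulo `ℓ ^ (k + 2)` kills `ℓ ^ (k + 1) • d`, this contradicts `χ d ≠ 0`. -/
theorem IsKummerian.torsionFree_quotient (hG : IsProL ℓ G) {Q : Type*} [Group Q]
    [TopologicalSpace Q] [IsTopologicalGroup Q] (hQ : IsProL ℓ Q) {φ : G →ₜ* Q}
    (hφ : Function.Surjective φ) {θ : G →ₜ* ℤ_[ℓ]ˣ} (hθ : IsTorsionFreeOrientation θ)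
    (hK : IsKummerian θ) (hker : kernel φ = kSubgroup θ) {η : Q →ₜ* ℤ_[ℓ]ˣ}
    (hη : ∀ g, η (φ g) = θ g) (hηθ : IsTorsionFreeOrientation η) (hab : IsAbelianOrientation η) :
    ∀ q : Q, IsOfFinOrder q → q = 1 := by
  refine torsionFree_of_pow_prime hQ fun q hq => ?_
  by_contra hq1
  have hqk : q ∈ kernel η := mem_kernel_of_pow hQ hηθ (hq ▸ one_mem _)
  obtain ⟨k, d, hd, hdq, hnot⟩ := exists_pow_eq_not_pow hQ (kernel η) hqk hq1
  obtain ⟨χ, hχ, hadd, hχd⟩ := exists_additive_ne_zero hQ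
    (fun h => hnot (hab.exists_pow_eq hQ hηθ hd h))
  have hk : 1 ≤ k + 2 := by omega
  obtain ⟨c, hc, hcχ⟩ := (isKummerian_iff hG hθ).1 hK (k + 2) hk (fun g => χ (φ g))
    (hχ.comp φ.continuous_toFun) fun g h => by rw [map_mul, hadd]
  obtain ⟨d, rfl⟩ := hφ d
  have hdk : d ∈ kernel θ := (hη d).symm.trans hd
  have h1 : d ^ ℓ ^ (k + 1) ∈ kSubgroup θ := by
    rw [← hker, mem_kernel, map_pow, pow_succ, pow_mul, hdq, hq]
  have h2 := cocycle_eq_zero_of_mem_kSubgroup hG hc h1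
  have h3 : c (d ^ ℓ ^ (k + 1)) = (ℓ ^ (k + 1) : ℕ) * c d :=
    map_pow_of_additive (f := fun a : kernel θ => c a) (fun a b => by
      rw [Subgroup.coe_mul, hc.2, twist, mem_kernel.1 a.2, Units.val_one, map_one, one_mul])
      ⟨d, hdk⟩ _
  rw [h3] at h2
  exact hχd ((hcχ d).symm.trans (reduction_eq_zero_of_pow_mul hk h2))

end Kummerian

section FrattiniCovers

variable {ℓ : ℕ} [hp : Fact ℓ.Prime] {G : Type u} [Group G] [TopologicalSpace G]
  [IsTopologicalGroup G]

theorem IsFrattiniCoverKernel.isKummerian_and_eq (hG : IsProL ℓ G) {N : Subgroup G}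
    (hN : IsFrattiniCoverKernel ℓ N) {θ : G →ₜ* ℤ_[ℓ]ˣ} (hθ : IsTorsionFreeOrientation θ)
    (h1 : kSubgroup θ ≤ N) (h2 : N ≤ kernel θ) : IsKummerian θ ∧ N = kSubgroup θ := by
  obtain ⟨Q, _, _, _, φ, hQ, hφ, rfl, hΦ, hLU⟩ := hN
  obtain ⟨η, hη, hηθ, hab⟩ := exists_descended_orientation hG hQ hφ hθ h1 h2
  refine ⟨isKummerian_of_frattini_cover hG hQ hφ hΦ hθ hη ?_,
    le_antisymm (kernel_le_kSubgroup hG hΦ hLU.torsionFree hθ h1 h2) h1⟩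
  exact (isKummerian_iff hQ hηθ).2 fun n hn χ hχ hadd =>
    hab.exists_cocycle hQ hηθ hLU.torsionFree (hLU _ (isClosed_kernel η)).fg hn hχ hadd

theorem IsFrattiniCoverKernel.exists_orientation (hG : IsProL ℓ G) {N : Subgroup G}
    (hN : IsFrattiniCoverKernel ℓ N) :
    IsTopFG G ∧ ∃ θ : G →ₜ* ℤ_[ℓ]ˣ, N ≤ kernel θ ∧ IsTorsionFreeOrientation θ ∧
      kSubgroup θ ≤ N := by
  obtain ⟨Q, _, _, _, φ, hQ, hφ, rfl, hΦ, hLU⟩ := hN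
  have := hQ.t2
  have hfgQ : IsTopFG Q := by
    obtain ⟨S, hS, hSQ⟩ := (hLU ⊤ isClosed_univ).fg.exists_closure isClosed_univ
    exact ⟨S, hS, hSQ⟩
  obtain ⟨η, hηθ, hab⟩ := hLU.exists_orientation hQ
  refine ⟨IsTopFG.of_frattini_cover hG hQ hφ hΦ hfgQ, η.comp φ, fun g hg => ?_, fun hl g =>
    hηθ hl _, kSubgroup_le (isClosed_kernel φ) fun g h hh => ?_⟩
  · change η (φ g) = 1
    rw [mem_kernel.1 hg, map_one]
  · have h1 : φ (h ^ₚ (η (φ g) : ℤ_[ℓ])) = φ h ^ₚ (η (φ g) : ℤ_[ℓ]) :=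
      map_padicPow hG φ.toMonoidHom φ.continuous_toFun h _
    change φ ((h ^ₚ (η (φ g) : ℤ_[ℓ]))⁻¹ * (g * h * g⁻¹)) = 1
    rw [map_mul, map_inv, h1, map_mul, map_mul, map_inv, hab (φ h) hh (φ g), inv_mul_cancel]

theorem IsKummerian.isFrattiniCoverKernel (hG : IsProL ℓ G) (hfg : IsTopFG G)
    {θ : G →ₜ* ℤ_[ℓ]ˣ} (hθ : IsTorsionFreeOrientation θ) (hK : IsKummerian θ) :
    IsFrattiniCoverKernel ℓ (kSubgroup θ) := by
  obtain ⟨_, π, hQ, hπ, hπk⟩ := exists_quotient_kSubgroup hG (θ := θ)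
  obtain ⟨η, hη, hηθ, hab⟩ := exists_descended_orientation hG hQ hπ hθ hπk.ge
    (hπk.le.trans (kSubgroup_le_kernel hG θ))
  exact ⟨G ⧸ kSubgroup θ, _, _, inferInstance, π, hQ, hπ, hπk, kSubgroup_le_frattiniSubgroup hG hθ,
    hab.isLocallyUniform hQ hηθ (hK.torsionFree_quotient hG hQ hπ hθ hπk hη hηθ hab)
      (hfg.image hπ)⟩

end FrattiniCovers

end OrientedProL

theorem proposition3p11 (ℓ : ℕ) [Fact ℓ.Prime] (G : Type u) [Group G] [TopologicalSpace G]
    [IsTopologicalGroup G] (hG : OrientedProL.IsProL ℓ G) :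
    -- existence of a Frattini cover of a locally uniform group
    ((∃ N : Subgroup G, OrientedProL.IsFrattiniCoverKernel ℓ N) ↔
      OrientedProL.IsTopFG G ∧ ∃ θ : G →ₜ* ℤ_[ℓ]ˣ,
        OrientedProL.IsTorsionFreeOrientation θ ∧ OrientedProL.IsKummerian θ) ∧
    -- the same with the kernel `N` specified
    (∀ N : Subgroup G, OrientedProL.IsFrattiniCoverKernel ℓ N ↔
      OrientedProL.IsTopFG G ∧ ∃ θ : G →ₜ* ℤ_[ℓ]ˣ, N ≤ OrientedProL.kernel θ ∧
        OrientedProL.IsTorsionFreeOrientation θ ∧ OrientedProL.IsKummerian θ ∧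
        N = OrientedProL.kSubgroup θ) ∧
    -- `N = K_θ(G)` is forced for every torsion-free orientation with `K_θ(G) ⊆ N ⊆ ker θ`
    (∀ N : Subgroup G, OrientedProL.IsFrattiniCoverKernel ℓ N →
      ∀ θ : G →ₜ* ℤ_[ℓ]ˣ, OrientedProL.IsTorsionFreeOrientation θ →
        OrientedProL.kSubgroup θ ≤ N → N ≤ OrientedProL.kernel θ →
        OrientedProL.IsKummerian θ ∧ N = OrientedProL.kSubgroup θ) := by
  have key : ∀ N : Subgroup G, OrientedProL.IsFrattiniCoverKernel ℓ N ↔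
      OrientedProL.IsTopFG G ∧ ∃ θ : G →ₜ* ℤ_[ℓ]ˣ, N ≤ OrientedProL.kernel θ ∧
        OrientedProL.IsTorsionFreeOrientation θ ∧ OrientedProL.IsKummerian θ ∧
        N = OrientedProL.kSubgroup θ := by
    refine fun N => ⟨fun hN => ?_, ?_⟩
    · obtain ⟨hfg, θ, h1, hθ, h2⟩ := hN.exists_orientation hG
      exact ⟨hfg, θ, h1, hθ, hN.isKummerian_and_eq hG hθ h2 h1⟩
    · rintro ⟨hfg, θ, -, hθ, hK, rfl⟩
      exact hK.isFrattiniCoverKernel hG hfg hθ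
  refine ⟨⟨fun ⟨N, hN⟩ => ?_, fun ⟨hfg, θ, hθ, hK⟩ => ⟨_, hK.isFrattiniCoverKernel hG hfg hθ⟩⟩,
    key, fun N hN θ hθ h1 h2 => hN.isKummerian_and_eq hG hθ h1 h2⟩
  obtain ⟨hfg, θ, -, hθ, hK, -⟩ := (key N).1 hN
  exact ⟨hfg, θ, hθ, hK⟩
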